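/- Let $l\ge 2$ and read all indices in $\mathbb Z/(l+1)\mathbb Z$. Let $\mathbb C(\alpha;f;\tau)$ be the field of rational functions over $\mathbb C$ in the $3(l+1)$ variables $\alpha_j,f_j,\tau_j$ ($0\le j\le l$), and put $k=\alpha_0+\cdots+\alpha_l$. *System.* If $l=2n$, let $$F_j=f_j\Big(\sum_{1\le r\le n}f_{j+2r-1}-\sum_{1\le r\le n}f_{j+2r}\Big)+\alpha_j ,$$ and if $l=2n+1$, let $$F_j=f_j\Big(\sum_{1\le r\le s\le n}f_{j+2r-1}f_{j+2s}-\sum_{1\le r\le s\le n}f_{j+2r}f_{j+2s+1}\Big)+\Big(\tfrac k2-\sum_{1\le r\le n}\alpha_{j+2r}\Big)f_j+\alpha_j\sum_{1\le r\le n}f_{j+2r}.$$ *Hamiltonians.* Let $\varpi_0=0$ and $\varpi_i=\sum_{r=1}^{l}\big(\min\{i,r\}-\frac{ir}{l+1}\big)\alpha_r$ for $1\le i\le l$. Let $\Gamma$ be the cycle with nodes $\mathbb Z/(l+1)\mathbb Z$ (with $j$ adjacent to $j\pm1$). For $d\ge1$ let $\mathcal S_d$ be the set of all $K\subset\Gamma$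 with $|K|=d$ such that every connected component of $\Gamma\setminus K$ has an even number of nodes. Let $f_K=\prod_{i\in K}f_i$, and let $\chi(\Gamma\setminus K)$ be the sum of $\varpi_j-\varpi_{j+1}+\cdots+(-1)^{m-1}\varpi_{j+m-1}$ over the connected components $\{j,j+1,\dots,j+m-1\}$ of $\Gamma\setminus K$. Put $$h_0=\sum_{K\in\mathcal S_3}f_K+\sum_{K\in\mathcal S_1}\chi(\Gamma\setminus K)f_K\quad(l=2n),$$ $$h_0=\sum_{K\in\mathcal S_4}f_K+\sum_{K\in\mathcal S_2}\chi(\Gamma\setminus K)f_K+\Big(\sum_{i=1}^{2n+1}(-1)^{i-1}\varpi_i\Big)^2\quad(l=2n+1),$$ and for $1\le i\le l$ let $h_i$ be obtained from $h_{i-1}$ by replacing $\alpha_j\mapsto\alpha_{j+1}$, $f_j\mapsto f_{j+1}$ for all $j$. *Group.* Let $\widetilde W=\langle s_0,\dots,s_l,\pi\rangle$ be the extended affine Weyl group of type $A^{(1)}_l$, i.e. the group with defining relations $s_i^2=1$; $s_is_j=s_js_i$ for $j\ne i,i\pm1$; $s_is_js_i=s_js_is_j$ for $j=i\pm1$; $\pi^{l+1}=1$;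 $\pi s_i=s_{i+1}\pi$. **Theorem.** There is a unique $\mathbb C$-linear derivation $'$ of $\mathbb C(\alpha;f;\tau)$ with $$\alpha_j'=0,\qquad f_j'=F_j,\qquad k\,\tau_j'=h_j\tau_j\qquad(j=0,\dots,l),$$ and there is a unique action of $\widetilde W$ on $\mathbb C(\alpha;f;\tau)$ by $\mathbb C$-automorphisms such that $$s_i(\alpha_i)=-\alpha_i,\quad s_i(\alpha_{i\pm1})=\alpha_{i\pm1}+\alpha_i,\quad s_i(\alpha_j)=\alpha_j\ (j\ne i,i\pm1),$$ $$s_i(f_i)=f_i,\quad s_i(f_{i\pm1})=f_{i\pm1}\pm\frac{\alpha_i}{f_i},\quad s_i(f_j)=f_j\ (j\ne i,i\pm1),$$ $$s_j(\tau_j)=f_j\,\frac{\tau_{j-1}\tau_{j+1}}{\tau_j},\quad s_i(\tau_j)=\tau_j\ (i\ne j),$$ $$\pi(\alpha_j)=\alpha_{j+1},\quad \pi(f_j)=f_{j+1},\quad \pi(\tau_j)=\tau_{j+1}.$$ This action commutes with the derivation: $w(\varphi')=(w(\varphi))'$ for all $w\in\widetilde W$ and $\varphi\in\mathbb C(\alpha;f;\tau)$.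 Moreover $$f_j=\frac{\tau_j\,s_j(\tau_j)}{\tau_{j-1}\tau_{j+1}}\qquad(j=0,\dots,l).$$ -/

import Mathlib

noncomputable section

namespace NoumiYamada

/-! ### The field `ℂ(α; f; τ)`; indices `0, …, l` are elements of `ℤ/(l+1)ℤ` -/

/-- The variables `α_j`, `f_j`, `τ_j` with `j ∈ ℤ/(l+1)ℤ`. -/
inductive Var (l : ℕ) : Type
  | alpha (j : ZMod (l + 1))
  | f (j : ZMod (l + 1))
  | tau (j : ZMod (l + 1))

/-- The polynomial ring `ℂ[α; f; τ]`. -/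
abbrev Poly (l : ℕ) : Type := MvPolynomial (Var l) ℂ

/-- The field `ℂ(α; f; τ)` of rational functions. -/
abbrev RatField (l : ℕ) : Type := FractionRing (Poly l)

/-- `α_j` as a polynomial. -/
def pα {l : ℕ} (j : ZMod (l + 1)) : Poly l := MvPolynomial.X (Var.alpha j)

/-- `f_j` as a polynomial. -/
def pf {l : ℕ} (j : ZMod (l + 1)) : Poly l := MvPolynomial.X (Var.f j)

/-- `k = α_0 + ⋯ + α_l` as a polynomial. -/
def pk (l : ℕ) : Poly l := ∑ j : ZMod (l + 1), pα j

/-- The inclusion `ℂ[α; f; τ] → ℂ(α; f; τ)`. -/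
def toField {l : ℕ} (p : Poly l) : RatField l := algebraMap (Poly l) (RatField l) p

/-- `α_j` as an element of `ℂ(α; f; τ)`. -/
def α {l : ℕ} (j : ZMod (l + 1)) : RatField l := toField (pα j)

/-- `f_j` as an element of `ℂ(α; f; τ)`. -/
def f {l : ℕ} (j : ZMod (l + 1)) : RatField l := toField (pf j)

/-- `τ_j` as an element of `ℂ(α; f; τ)`. -/
def τ {l : ℕ} (j : ZMod (l + 1)) : RatField l := toField (MvPolynomial.X (Var.tau j))

/-- `k = α_0 + ⋯ + α_l` as an element of `ℂ(α; f; τ)`. -/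
def k (l : ℕ) : RatField l := toField (pk l)

/-! ### The differential system -/

/-- The right-hand side of the system for `l = 2n`. -/
def sysEven (l n : ℕ) (j : ZMod (l + 1)) : Poly l :=
  pf j * ((∑ r ∈ Finset.Icc 1 n, pf (j + 2 * (r : ZMod (l + 1)) - 1))
    - ∑ r ∈ Finset.Icc 1 n, pf (j + 2 * (r : ZMod (l + 1)))) + pα j

/-- The right-hand side of the system for `l = 2n + 1`. -/
def sysOdd (l n : ℕ) (j : ZMod (l + 1)) : Poly l :=
  pf j * ((∑ s ∈ Finset.Icc 1 n, ∑ r ∈ Finset.Icc 1 s,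
        pf (j + 2 * (r : ZMod (l + 1)) - 1) * pf (j + 2 * (s : ZMod (l + 1))))
      - ∑ s ∈ Finset.Icc 1 n, ∑ r ∈ Finset.Icc 1 s,
        pf (j + 2 * (r : ZMod (l + 1))) * pf (j + 2 * (s : ZMod (l + 1)) + 1))
    + (MvPolynomial.C (1 / 2 : ℂ) * pk l
        - ∑ r ∈ Finset.Icc 1 n, pα (j + 2 * (r : ZMod (l + 1)))) * pf j
    + pα j * ∑ r ∈ Finset.Icc 1 n, pf (j + 2 * (r : ZMod (l + 1)))

/-- The right-hand side `F_j` of the differential system `f_j' = F_j` of type `A_l^{(1)}`;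
here `l / 2` is the integer `n` with `l = 2n` or `l = 2n + 1`. -/
def F {l : ℕ} (j : ZMod (l + 1)) : Poly l :=
  if Even l then sysEven l (l / 2) j else sysOdd l (l / 2) j

/-! ### The Hamiltonians -/

/-- The fundamental weight
`ϖ_i = ∑_{r=1}^{l} (min{i, r} - i r / (l + 1)) α_r` for `i = 1, …, l`, and `ϖ_0 = 0`. -/
def ϖ {l : ℕ} (i : ZMod (l + 1)) : Poly l :=
  ∑ r ∈ Finset.Icc 1 l,
    MvPolynomial.C (((min i.val r : ℕ) : ℂ) - (i.val : ℂ) * (r : ℂ) / ((l : ℂ) + 1))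
      * pα (r : ZMod (l + 1))

/-- The number of steps from `v` forward along the circle `Γ = ℤ/(l+1)ℤ` to the next element
of `K` (at least one step). For `v ∈ K`, the chain of `Γ \ K` between `v` and
the next element of `K` has `stepsForward K v - 1` nodes (possibly none). -/
def stepsForward {l : ℕ} (K : Finset (ZMod (l + 1))) (v : ZMod (l + 1)) : ℕ :=
  sInf {m : ℕ | 0 < m ∧ v + (m : ZMod (l + 1)) ∈ K}

/-- The number of steps from `v` backward along `Γ` to the previous element of `K`. A node
`v ∉ K` is the `stepsBack K v`-th node of the chain (component of `Γ \ K`) that contains it. -/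
def stepsBack {l : ℕ} (K : Finset (ZMod (l + 1))) (v : ZMod (l + 1)) : ℕ :=
  sInf {m : ℕ | 0 < m ∧ v - (m : ZMod (l + 1)) ∈ K}

/-- `S_d`: the sets `K ⊆ Γ` of cardinality `d` such that all connected components of `Γ \ K`
are chains with an even number of nodes (used for `d ≥ 1`). -/
def S (l d : ℕ) : Finset (Finset (ZMod (l + 1))) :=
  (Finset.powersetCard d Finset.univ).filter fun K => ∀ v ∈ K, Odd (stepsForward K v)

/-- `χ(Γ \ K)`: the sum over the chains `{j, j+1, …, j+m-1}` of `Γ \ K` of the alternating sums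
`ϖ_j - ϖ_{j+1} + ⋯ + (-1)^{m-1} ϖ_{j+m-1}` (for `K` non-empty). -/
def χCompl {l : ℕ} (K : Finset (ZMod (l + 1))) : Poly l :=
  ∑ v ∈ Kᶜ, (-1) ^ (stepsBack K v - 1) * ϖ v

/-- `f_K = ∏_{i ∈ K} f_i`. -/
def fProd {l : ℕ} (K : Finset (ZMod (l + 1))) : Poly l := ∏ i ∈ K, pf i

/-- The Hamiltonian `h_0`. -/
def h₀ (l : ℕ) : Poly l :=
  if Even l then
    (∑ K ∈ S l 3, fProd K) + ∑ K ∈ S l 1, χCompl K * fProd K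
  else
    (∑ K ∈ S l 4, fProd K) + (∑ K ∈ S l 2, χCompl K * fProd K)
      + (∑ i ∈ Finset.Icc 1 l, (-1) ^ (i - 1) * ϖ (i : ZMod (l + 1))) ^ 2

/-- The rotation of indices `j ↦ j + 1` on the variables. -/
def Var.rotate {l : ℕ} : Var l → Var l
  | .alpha j => .alpha (j + 1)
  | .f j => .f (j + 1)
  | .tau j => .tau (j + 1)

/-- The Hamiltonians `h_0, …, h_l`, where `h_i` for `i = 1, …, l` is obtained from `h_{i-1}` by
the rotation of indices. -/
def h {l : ℕ} (j : ZMod (l + 1)) : Poly l :=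
  (fun p => MvPolynomial.rename Var.rotate p)^[j.val] (h₀ l)

/-- `D` is the derivation of the differential field `ℂ(α; f; τ)`: the `α_j` are constants,
`f_j' = F_j`, and `k τ_j' = h_j τ_j`. -/
structure IsSystemDerivation {l : ℕ} (D : Derivation ℂ (RatField l) (RatField l)) : Prop where
  alpha : ∀ j, D (α j) = 0
  f : ∀ j, D (f j) = toField (F j)
  tau : ∀ j, k l * D (τ j) = toField (h j) * τ j

/-! ### The extended affine Weyl group of type `A_l^{(1)}` and its action -/

/-- The generators `s_0, …, s_l, π`. -/
inductive Gen (l : ℕ) : Type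
  | s (i : ZMod (l + 1))
  | rot

/-- The relators of the extended affine Weyl group of type `A_l^{(1)}` (`l ≥ 2`). -/
inductive Relator (l : ℕ) : FreeGroup (Gen l) → Prop
  | sq (i : ZMod (l + 1)) : Relator l (FreeGroup.of (.s i) ^ 2)
  | comm (i j : ZMod (l + 1)) (h₀ : j ≠ i) (h₁ : j ≠ i + 1) (h₂ : j ≠ i - 1) :
      Relator l ((FreeGroup.of (.s i) * FreeGroup.of (.s j)) *
        (FreeGroup.of (.s j) * FreeGroup.of (.s i))⁻¹)
  | braid (i j : ZMod (l + 1)) (hij : j = i + 1 ∨ j = i - 1) :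
      Relator l ((FreeGroup.of (.s i) * FreeGroup.of (.s j) * FreeGroup.of (.s i)) *
        (FreeGroup.of (.s j) * FreeGroup.of (.s i) * FreeGroup.of (.s j))⁻¹)
  | rot_pow : Relator l (FreeGroup.of .rot ^ (l + 1))
  | rot_s (i : ZMod (l + 1)) :
      Relator l ((FreeGroup.of .rot * FreeGroup.of (.s i)) *
        (FreeGroup.of (.s (i + 1)) * FreeGroup.of .rot)⁻¹)

/-- The extended affine Weyl group `W̃ = ⟨s_0, …, s_l, π⟩` of type `A_l^{(1)}`. -/
abbrev ExtAffineWeyl (l : ℕ) : Type := PresentedGroup {w | Relator l w}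

/-- The generator `s_i` of `W̃`. -/
def s {l : ℕ} (i : ZMod (l + 1)) : ExtAffineWeyl l := PresentedGroup.of (Gen.s i)

/-- The generator `π` of `W̃`. -/
def rot (l : ℕ) : ExtAffineWeyl l := PresentedGroup.of Gen.rot

/-- `ρ` is the action of `W̃` on `ℂ(α; f; τ)` by field automorphisms over `ℂ` that is given on
generators by the stated formulas. -/
structure IsWeylAction {l : ℕ} (ρ : ExtAffineWeyl l →* (RatField l ≃ₐ[ℂ] RatField l)) :
    Prop where
  s_alpha_self : ∀ i, ρ (s i) (α i) = -α i
  s_alpha_next : ∀ i, ρ (s i) (α (i + 1)) = α (i + 1) + α i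
  s_alpha_prev : ∀ i, ρ (s i) (α (i - 1)) = α (i - 1) + α i
  s_alpha_other : ∀ i j, j ≠ i → j ≠ i + 1 → j ≠ i - 1 → ρ (s i) (α j) = α j
  s_f_self : ∀ i, ρ (s i) (f i) = f i
  s_f_next : ∀ i, ρ (s i) (f (i + 1)) = f (i + 1) + α i / f i
  s_f_prev : ∀ i, ρ (s i) (f (i - 1)) = f (i - 1) - α i / f i
  s_f_other : ∀ i j, j ≠ i → j ≠ i + 1 → j ≠ i - 1 → ρ (s i) (f j) = f j
  s_tau_self : ∀ j, ρ (s j) (τ j) = f j * (τ (j - 1) * τ (j + 1) / τ j)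
  s_tau_other : ∀ i j, i ≠ j → ρ (s i) (τ j) = τ j
  rot_alpha : ∀ j, ρ (rot l) (α j) = α (j + 1)
  rot_f : ∀ j, ρ (rot l) (f j) = f (j + 1)
  rot_tau : ∀ j, ρ (rot l) (τ j) = τ (j + 1)

end NoumiYamada

end

/-!
# The affine Weyl group symmetry of the differential system of type `A_l^{(1)}`

*Existence and uniqueness.* A derivation of `ℂ(α; f; τ)` may be prescribed freely on the variables,
and is determined by its values there; an endomorphism may be prescribed on the variables if the
proposed images generate the field, because they are then algebraically independent. So the
derivation and the automorphisms `s_i`, `π` exist, and the relations of the group are checked on the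
variables. To bring all indices `j` under one formula, `s_i` is written as
`α_j ↦ α_j - a_{ij} α_i`, `f_j ↦ f_j + u_{ij} α_i / f_i` with the integers `cartan` and `orient`.

*Commutation.* An automorphism `φ` commutes with the derivation as soon as it transforms the
defining equations into themselves, because the derivation conjugated by `φ` satisfies these
equations then and there is only one which does (`comm_of_vars`). For `s_i` this requires
* for `f_j`: the value `s_i(F_j)` (`IsRefl.map_F`);
* for `τ_j` with `j ≠ i`: `s_i(h_j) = h_j` (`IsRefl.map_h`);
* for `τ_i`: `s_i(h_i) = h_{i-1} + h_{i+1} - h_i + k F_i / f_i` (`IsRefl.map_h_self`).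

*The Hamiltonians.* Give the edge from `j` to `j + 1` of the circle the weight
`c_j = ϖ_j - ϖ_{j+1}` (`edge`), and let `circ` be the trace of the product of the matrices with rows
`(X f_j, 1 + X² c_j)` and `(1, 0)` around the circle. Expanding the product, the nodes of a set `K`
contribute `X f_j` and the chains of the complement are tiled by dimers of weight `1 + X² c_j`. Since
the alternating sum of `ϖ` over a chain of even length is the sum of the weights of its dimers, the
coefficient of `X³` is `h_0` for even `l`, and for odd `l` the coefficient of `X⁴` is `h_0` up to
half the sum of the `c_j²` (`toField_h₀_of_even`, `toField_h₀_of_odd`). If `i ≠ 0`, the reflection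
`s_i` exchanges `c_{i-1}` and `c_i` and compensates by `f_{i-1}` and `f_{i+1}`; this leaves the
product of three consecutive matrices unchanged (`site_mul_site_mul_site`), so that `s_i(h_0) = h_0`.
The rotation `π` adds `k` to one edge weight and subtracts `k / (l + 1)` from all of them, which
yields `h_1 - h_0 = k (g_0 - casimir)` with an explicit `g_0` and an invariant element `casimir`
(`IsRot.map_h₀`). By rotation `h_{j+1} - h_j = k (g_j - casimir)` and `s_i(h_j) = h_j` for `i ≠ j`.

*The system.* The right-hand sides are `F_j = f_j (g_{j-1} - g_j) + α_j (E_j + p f_j)` with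
`E_j = eHat j` and `p = parity l` (`toField_F`). The invariance of the Hamiltonians implies that
`s_i` fixes `g_j` for `j ≠ i - 1, i` and fixes `g_{i-1} + g_i`; together with the value of
`s_i(g_i)` (`IsRefl.map_gHat_self`) and the identity
`g_{j-1} - g_{j+1} = f_{j+1} E_j - f_j E_{j+1}` (`gHat_sub_gHat`) this gives the values of
`s_i(F_j)` and `s_i(h_i)`.
-/

noncomputable section

namespace NoumiYamada

/-! ### Derivations and endomorphisms of a field of rational functions -/

section RationalFunctions

open MvPolynomial

variable {σ K : Type*} [Field K] [Algebra (MvPolynomial σ ℂ) K] [Algebra ℂ K]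
  [IsScalarTower ℂ (MvPolynomial σ ℂ) K] [IsFractionRing (MvPolynomial σ ℂ) K]

theorem derivation_ext_of_X {D₁ D₂ : Derivation ℂ K K}
    (hD : ∀ v, D₁ (algebraMap (MvPolynomial σ ℂ) K (X v)) =
      D₂ (algebraMap (MvPolynomial σ ℂ) K (X v))) : D₁ = D₂ := by
  have hp : ∀ p : MvPolynomial σ ℂ, D₁ (algebraMap _ K p) = D₂ (algebraMap _ K p) := by
    intro p
    have : D₁.compAlgebraMap (MvPolynomial σ ℂ) = D₂.compAlgebraMap (MvPolynomial σ ℂ) :=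
      MvPolynomial.derivation_ext hD
    exact congrArg (fun d => d p) this
  ext x
  obtain ⟨p, q, hq, rfl⟩ := IsFractionRing.div_surjective (A := MvPolynomial σ ℂ) x
  rw [Derivation.leibniz_div, Derivation.leibniz_div, hp, hp]

/-- A derivation of the field of rational functions may be prescribed freely on the variables:
it is the second component of a homomorphism to the dual numbers. -/
theorem exists_derivation_of_X (g : σ → K) :
    ∃ D : Derivation ℂ K K, ∀ v, D (algebraMap (MvPolynomial σ ℂ) K (X v)) = g v := by
  let φ : MvPolynomial σ ℂ →ₐ[ℂ] TrivSqZeroExt K K := aeval fun v =>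
    TrivSqZeroExt.inl (algebraMap (MvPolynomial σ ℂ) K (X v)) + TrivSqZeroExt.inr (g v)
  have hφ : ∀ p, (φ p).fst = algebraMap (MvPolynomial σ ℂ) K p := by
    have : (TrivSqZeroExt.fstHom ℂ K K).comp φ =
        IsScalarTower.toAlgHom ℂ (MvPolynomial σ ℂ) K := by
      ext v
      simp [φ]
    exact fun p => congrArg (fun d => d p) this
  have hu : ∀ y : nonZeroDivisors (MvPolynomial σ ℂ), IsUnit (φ y) := by
    intro y
    rw [TrivSqZeroExt.isUnit_iff_isUnit_fst, hφ]
    exact IsLocalization.map_units K y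
  let ψ : K →ₐ[ℂ] TrivSqZeroExt K K := IsLocalization.liftAlgHom hu
  have hψ : ∀ p, ψ (algebraMap (MvPolynomial σ ℂ) K p) = φ p := fun p => by
    simp only [ψ, IsLocalization.liftAlgHom_apply]
    exact IsLocalization.lift_eq (g := φ.toRingHom) hu p
  have hψ1 : ∀ x, (ψ x).fst = x := by
    intro x
    have : (TrivSqZeroExt.fstHom ℂ K K).comp ψ = AlgHom.id ℂ K := by
      apply IsLocalization.algHom_ext (nonZeroDivisors (MvPolynomial σ ℂ))
      ext v
      exact (congrArg TrivSqZeroExt.fst (hψ (X v))).trans (hφ _)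
    exact congrArg (fun d => d x) this
  refine ⟨Derivation.mk' ((TrivSqZeroExt.sndHom K K).restrictScalars ℂ ∘ₗ ψ.toLinearMap) ?_, ?_⟩
  · intro a b
    simp [hψ1, mul_comm]
  · intro v
    simpa [φ] using congrArg TrivSqZeroExt.snd (hψ (X v))

theorem algHom_ext_of_X {A : Type*} [Semiring A] [Algebra ℂ A] {φ ψ : K →ₐ[ℂ] A}
    (h : ∀ v, φ (algebraMap (MvPolynomial σ ℂ) K (X v)) =
      ψ (algebraMap (MvPolynomial σ ℂ) K (X v))) : φ = ψ := by
  apply IsLocalization.algHom_ext (nonZeroDivisors (MvPolynomial σ ℂ))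
  ext v
  exact h v

/-- If the proposed images of finitely many variables generate the field of rational functions,
they are algebraically independent (there are as many of them as the transcendence degree), so
that the substitution extends to the field. -/
theorem exists_algHom_of_X [Finite σ] (x : σ → K)
    (hx : ∀ v, algebraMap (MvPolynomial σ ℂ) K (X v) ∈
      IntermediateField.adjoin ℂ (Set.range x)) :
    ∃ φ : K →ₐ[ℂ] K, ∀ v, φ (algebraMap (MvPolynomial σ ℂ) K (X v)) = x v := by
  have : Algebra.IsAlgebraic (MvPolynomial σ ℂ) K :=
    IsLocalization.isAlgebraic K (nonZeroDivisors (MvPolynomial σ ℂ))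
  have hX : IsTranscendenceBasis ℂ (algebraMap (MvPolynomial σ ℂ) K ∘ X) :=
    (IsTranscendenceBasis.mvPolynomial σ ℂ).algebraMap_comp
  have alg : Algebra.IsAlgebraic (Algebra.adjoin ℂ (Set.range x)) K := by
    rw [hX.isAlgebraic_iff]
    intro v
    obtain ⟨r, hr, s, hs, h⟩ := (IntermediateField.mem_adjoin_iff_div ..).1 (hx v)
    rw [Function.comp_apply, h, div_eq_mul_inv]
    exact (isAlgebraic_algebraMap (⟨r, hr⟩ : Algebra.adjoin ℂ (Set.range x))).mul
      (isAlgebraic_algebraMap (⟨s, hs⟩ : Algebra.adjoin ℂ (Set.range x))).inv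
  have hxb : IsTranscendenceBasis ℂ x :=
    Algebra.IsAlgebraic.isTranscendenceBasis_of_lift_le_trdeg_of_finite ℂ x
      hX.lift_cardinalMk_eq_trdeg.le
  have hinj : Function.Injective (aeval x : MvPolynomial σ ℂ →ₐ[ℂ] K) := hxb.1
  refine ⟨IsFractionRing.liftAlgHom hinj, fun v => ?_⟩
  rw [IsFractionRing.liftAlgHom_apply]
  refine (IsFractionRing.lift_algebraMap
    (g := (aeval x : MvPolynomial σ ℂ →ₐ[ℂ] K).toRingHom) hinj _).trans ?_
  exact aeval_X x v

end RationalFunctions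

/-! ### The action of the extended affine Weyl group -/

section Action

variable {l : ℕ}

instance : Finite (Var l) := by
  refine Finite.of_injective
    (fun v : Var l => (match v with
      | .alpha j => (0, j)
      | .f j => (1, j)
      | .tau j => (2, j) : Fin 3 × ZMod (l + 1))) ?_
  rintro (a | a | a) (b | b | b) h <;> simp_all

theorem toField_injective : Function.Injective (toField (l := l)) :=
  IsFractionRing.injective _ _

theorem f_ne_zero (j : ZMod (l + 1)) : (f j : RatField l) ≠ 0 := fun h =>
  MvPolynomial.X_ne_zero (R := ℂ) (Var.f j) (toField_injective (h.trans (map_zero _).symm))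

theorem τ_ne_zero (j : ZMod (l + 1)) : (τ j : RatField l) ≠ 0 := fun h =>
  MvPolynomial.X_ne_zero (R := ℂ) (Var.tau j) (toField_injective (h.trans (map_zero _).symm))

theorem k_eq_sum : k l = ∑ j : ZMod (l + 1), α j := map_sum (algebraMap (Poly l) (RatField l)) _ _

theorem k_ne_zero : k l ≠ 0 := by
  intro h
  have h0 : pk l = 0 := toField_injective (h.trans (map_zero _).symm)
  have h1 := congrArg (MvPolynomial.aeval (R := ℂ)
    (fun v : Var l => match v with | .alpha j => if j = 0 then (1 : ℂ) else 0 | _ => 0)) h0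
  simp [pk, pα] at h1

/-- A homomorphism from `ℂ(α; f; τ)` is determined by its values on the variables. -/
theorem algHom_ext_vars {A : Type*} [Semiring A] [Algebra ℂ A] {φ ψ : RatField l →ₐ[ℂ] A}
    (hα : ∀ j, φ (α j) = ψ (α j)) (hf : ∀ j, φ (f j) = ψ (f j)) (hτ : ∀ j, φ (τ j) = ψ (τ j)) :
    φ = ψ := by
  refine algHom_ext_of_X (σ := Var l) ?_
  rintro (j | j | j)
  exacts [hα j, hf j, hτ j]

theorem algEquiv_ext_vars {φ ψ : RatField l ≃ₐ[ℂ] RatField l}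
    (hα : ∀ j, φ (α j) = ψ (α j)) (hf : ∀ j, φ (f j) = ψ (f j)) (hτ : ∀ j, φ (τ j) = ψ (τ j)) :
    φ = ψ := by
  have : (φ : RatField l →ₐ[ℂ] RatField l) = ψ := algHom_ext_vars hα hf hτ
  exact AlgEquiv.ext fun x => congrArg (fun g => g x) this

/-- The entries of the generalized Cartan matrix of type `A_l^{(1)}` (for `l ≥ 2`). -/
def cartan (i j : ZMod (l + 1)) : ℤ :=
  if j = i then 2 else if j = i + 1 ∨ j = i - 1 then -1 else 0

/-- The orientation of the Dynkin diagram: `s_i(f_j) = f_j + u_{ij} α_i / f_i` with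
`u_{ij} = ±1` for `j = i ± 1`, and `0` otherwise. -/
def orient (i j : ZMod (l + 1)) : ℤ :=
  if j = i + 1 then 1 else if j = i - 1 then -1 else 0

theorem natCast_ne_zero {m : ℕ} (h₀ : 0 < m) (h₁ : m < l + 1) : (m : ZMod (l + 1)) ≠ 0 := by
  rw [Ne, ZMod.natCast_eq_zero_iff]
  exact Nat.not_dvd_of_pos_of_lt h₀ h₁

theorem add_one_ne (hl : 2 ≤ l) (i : ZMod (l + 1)) : i + 1 ≠ i := by
  simpa using natCast_ne_zero (l := l) (m := 1) one_pos (by omega)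

theorem sub_one_ne (hl : 2 ≤ l) (i : ZMod (l + 1)) : i - 1 ≠ i := by
  simpa using natCast_ne_zero (l := l) (m := 1) one_pos (by omega)

theorem add_one_ne_sub_one (hl : 2 ≤ l) (i : ZMod (l + 1)) : i + 1 ≠ i - 1 := by
  intro h
  refine natCast_ne_zero (l := l) (m := 2) two_pos (by omega) ?_
  push_cast
  linear_combination h

@[simp] theorem cartan_self (i : ZMod (l + 1)) : cartan i i = 2 := by simp [cartan]

theorem cartan_add_one (hl : 2 ≤ l) (i : ZMod (l + 1)) : cartan i (i + 1) = -1 := by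
  simp [cartan, add_one_ne hl]

theorem cartan_sub_one (hl : 2 ≤ l) (i : ZMod (l + 1)) : cartan i (i - 1) = -1 := by
  simp [cartan, sub_one_ne hl]

theorem cartan_eq_zero {i j : ZMod (l + 1)} (h₀ : j ≠ i) (h₁ : j ≠ i + 1) (h₂ : j ≠ i - 1) :
    cartan i j = 0 := by simp [cartan, h₀, h₁, h₂]

theorem orient_self (hl : 2 ≤ l) (i : ZMod (l + 1)) : orient i i = 0 := by
  simp [orient, (add_one_ne hl i).symm, (sub_one_ne hl i).symm]

theorem orient_add_one (i : ZMod (l + 1)) : orient i (i + 1) = 1 := by simp [orient]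

theorem orient_sub_one (hl : 2 ≤ l) (i : ZMod (l + 1)) : orient i (i - 1) = -1 := by
  simp [orient, (add_one_ne_sub_one hl i).symm]

theorem orient_eq_zero {i j : ZMod (l + 1)} (h₁ : j ≠ i + 1) (h₂ : j ≠ i - 1) :
    orient i j = 0 := by simp [orient, h₁, h₂]

/-- The formulas for `s_i` on the variables, as a property of a map `φ`. -/
structure IsRefl (i : ZMod (l + 1)) (φ : RatField l → RatField l) : Prop where
  map_alpha : ∀ j, φ (α j) = α j - cartan i j * α i
  map_f : ∀ j, φ (f j) = f j + orient i j * (α i / f i)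
  map_tau_self : φ (τ i) = f i * (τ (i - 1) * τ (i + 1) / τ i)
  map_tau : ∀ j ≠ i, φ (τ j) = τ j

/-- The formulas for `π` on the variables, as a property of a map `φ`. -/
structure IsRot (φ : RatField l → RatField l) : Prop where
  map_alpha : ∀ j, φ (α j) = α (j + 1)
  map_f : ∀ j, φ (f j) = f (j + 1)
  map_tau : ∀ j, φ (τ j) = τ (j + 1)

/-- The images of the variables under `s_i`. -/
def reflVar (i : ZMod (l + 1)) : Var l → RatField l
  | .alpha j => α j - cartan i j * α i
  | .f j => f j + orient i j * (α i / f i)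
  | .tau j => if j = i then f i * (τ (i - 1) * τ (i + 1) / τ i) else τ j

/-- The images of the variables under `s_i` generate the field, because the variables can be
recovered from them by the same substitution; so the substitution extends to the field. -/
theorem exists_isRefl_algHom (hl : 2 ≤ l) (i : ZMod (l + 1)) :
    ∃ φ : RatField l →ₐ[ℂ] RatField l, IsRefl i φ := by
  set L := IntermediateField.adjoin ℂ (Set.range (reflVar i))
  have hv : ∀ v, reflVar i v ∈ L := fun v => IntermediateField.subset_adjoin _ _ ⟨v, rfl⟩
  have hαi : α i ∈ L := by
    have := neg_mem (hv (.alpha i))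
    simp only [reflVar, cartan_self] at this
    convert this using 1
    push_cast
    ring
  have hfi : f i ∈ L := by simpa [reflVar, orient_self hl] using hv (.f i)
  have hα : ∀ j, α j ∈ L := fun j => by
    simpa [reflVar] using add_mem (hv (.alpha j)) (mul_mem (intCast_mem L (cartan i j)) hαi)
  have hf : ∀ j, f j ∈ L := fun j => by
    simpa [reflVar] using
      sub_mem (hv (.f j)) (mul_mem (intCast_mem L (orient i j)) (div_mem hαi hfi))
  have hτ' : ∀ j, j ≠ i → τ j ∈ L := fun j hj => by simpa [reflVar, hj] using hv (.tau j)
  have hτ : ∀ j, τ j ∈ L := fun j => by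
    by_cases hj : j = i
    · subst hj
      have h := div_mem (mul_mem hfi (mul_mem (hτ' _ (sub_one_ne hl j)) (hτ' _ (add_one_ne hl j))))
        (hv (.tau j))
      convert h using 1
      simp only [reflVar, if_true]
      field_simp [f_ne_zero, τ_ne_zero]
    · exact hτ' j hj
  obtain ⟨φ, hφ⟩ := exists_algHom_of_X (K := RatField l) (reflVar i) (by
    rintro (j | j | j)
    exacts [hα j, hf j, hτ j])
  exact ⟨φ, fun j => hφ (.alpha j), fun j => hφ (.f j), (hφ (.tau i)).trans (by simp [reflVar]),
    fun j hj => (hφ (.tau j)).trans (by simp [reflVar, hj])⟩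

theorem IsRefl.map_alpha_self {i : ZMod (l + 1)} {φ : RatField l → RatField l} (h : IsRefl i φ) :
    φ (α i) = -α i := by
  rw [h.map_alpha, cartan_self]
  push_cast
  ring

theorem IsRefl.map_f_self (hl : 2 ≤ l) {i : ZMod (l + 1)} {φ : RatField l → RatField l}
    (h : IsRefl i φ) : φ (f i) = f i := by
  rw [h.map_f, orient_self hl]
  simp

theorem IsRefl.comp_self (hl : 2 ≤ l) {i : ZMod (l + 1)} {φ : RatField l →ₐ[ℂ] RatField l}
    (h : IsRefl i φ) : φ.comp φ = AlgHom.id ℂ _ := by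
  refine algHom_ext_vars (fun j => ?_) (fun j => ?_) (fun j => ?_)
  · simp only [AlgHom.comp_apply, h.map_alpha j, map_sub, map_mul, map_intCast, h.map_alpha_self,
      AlgHom.id_apply]
    ring
  · simp only [AlgHom.comp_apply, h.map_f j, map_add, map_mul, map_div₀, map_intCast,
      h.map_alpha_self, h.map_f_self hl, AlgHom.id_apply]
    ring
  · by_cases hj : j = i
    · subst hj
      simp only [AlgHom.comp_apply, h.map_tau_self, map_mul, map_div₀, h.map_f_self hl,
        h.map_tau _ (sub_one_ne hl j), h.map_tau _ (add_one_ne hl j), AlgHom.id_apply]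
      field_simp [f_ne_zero, τ_ne_zero]
    · simp [h.map_tau j hj]

theorem exists_isRefl (hl : 2 ≤ l) (i : ZMod (l + 1)) :
    ∃ φ : RatField l ≃ₐ[ℂ] RatField l, IsRefl i φ := by
  obtain ⟨φ, h⟩ := exists_isRefl_algHom hl i
  exact ⟨AlgEquiv.ofAlgHom φ φ (h.comp_self hl) (h.comp_self hl), h.map_alpha, h.map_f,
    h.map_tau_self, h.map_tau⟩

theorem IsRot.iterate {φ : RatField l →ₐ[ℂ] RatField l} (h : IsRot φ) (m : ℕ)
    (j : ZMod (l + 1)) : φ^[m] (α j) = α (j + (m : ZMod (l + 1))) ∧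
      φ^[m] (f j) = f (j + (m : ZMod (l + 1))) ∧ φ^[m] (τ j) = τ (j + (m : ZMod (l + 1))) := by
  induction m generalizing j with
  | zero => simp
  | succ m ih =>
    simp only [Function.iterate_succ_apply, h.map_alpha, h.map_f, h.map_tau, ih, Nat.cast_add_one,
      add_comm, add_left_comm, true_and]

theorem IsRot.pow_eq_one {φ : RatField l →ₐ[ℂ] RatField l} (h : IsRot φ) : φ ^ (l + 1) = 1 := by
  have key := fun j => h.iterate (l + 1) j
  simp only [ZMod.natCast_self, add_zero] at key
  refine algHom_ext_vars (fun j => ?_) (fun j => ?_) (fun j => ?_) <;>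
    rw [AlgHom.coe_pow, AlgHom.one_apply]
  exacts [(key j).1, (key j).2.1, (key j).2.2]

theorem exists_isRot : ∃ φ : RatField l ≃ₐ[ℂ] RatField l, IsRot φ := by
  obtain ⟨φ, hφ⟩ := exists_algHom_of_X (K := RatField l)
    (fun v : Var l => toField (MvPolynomial.X v.rotate)) (by
      have h : ∀ v : Var l, toField (MvPolynomial.X v.rotate) ∈ IntermediateField.adjoin ℂ
          (Set.range fun v : Var l => toField (MvPolynomial.X v.rotate)) :=
        fun v => IntermediateField.subset_adjoin _ _ ⟨v, rfl⟩
      rintro (j | j | j)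
      · simpa [Var.rotate] using! h (.alpha (j - 1))
      · simpa [Var.rotate] using! h (.f (j - 1))
      · simpa [Var.rotate] using! h (.tau (j - 1)))
  have hr : IsRot φ := ⟨fun j => hφ (.alpha j), fun j => hφ (.f j), fun j => hφ (.tau j)⟩
  have hp := hr.pow_eq_one
  exact ⟨AlgEquiv.ofAlgHom φ (φ ^ l) ((pow_succ' φ l).symm.trans hp) ((pow_succ φ l).symm.trans hp),
    hr.map_alpha, hr.map_f, hr.map_tau⟩

end Action

/-! ### The relations of the extended affine Weyl group -/

section Relations

variable {l : ℕ}

theorem IsRefl.mul_self (hl : 2 ≤ l) {i : ZMod (l + 1)} {φ : RatField l ≃ₐ[ℂ] RatField l}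
    (h : IsRefl i φ) : φ * φ = 1 :=
  AlgEquiv.ext fun x =>
    congrArg (fun g => g x) (IsRefl.comp_self (φ := (φ : RatField l →ₐ[ℂ] RatField l)) hl h)

theorem IsRefl.comm {i j : ZMod (l + 1)} {φ ψ : RatField l ≃ₐ[ℂ] RatField l}
    (hφ : IsRefl i φ) (hψ : IsRefl j ψ) (h₀ : j ≠ i) (h₁ : j ≠ i + 1) (h₂ : j ≠ i - 1) :
    φ * ψ = ψ * φ := by
  have h₁' : i ≠ j + 1 := fun h => h₂ (by rw [h]; ring)
  have h₂' : i ≠ j - 1 := fun h => h₁ (by rw [h]; ring)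
  have e₁ : φ (α j) = α j := by rw [hφ.map_alpha, cartan_eq_zero h₀ h₁ h₂]; simp
  have e₂ : φ (f j) = f j := by rw [hφ.map_f, orient_eq_zero h₁ h₂]; simp
  have e₃ : ψ (α i) = α i := by rw [hψ.map_alpha, cartan_eq_zero h₀.symm h₁' h₂']; simp
  have e₄ : ψ (f i) = f i := by rw [hψ.map_f, orient_eq_zero h₁' h₂']; simp
  refine algEquiv_ext_vars (fun m => ?_) (fun m => ?_) (fun m => ?_) <;>
    simp only [AlgEquiv.mul_apply]
  · simp only [hφ.map_alpha m, hψ.map_alpha m, map_sub, map_mul, map_intCast, e₁, e₃]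
    ring
  · simp only [hφ.map_f m, hψ.map_f m, map_add, map_mul, map_div₀, map_intCast, e₁, e₂, e₃, e₄]
    ring
  · by_cases hi : m = i
    · subst hi
      simp only [hψ.map_tau m h₀.symm, hφ.map_tau_self, map_mul, map_div₀, e₄,
        hψ.map_tau (m - 1) (fun h => h₂ h.symm), hψ.map_tau (m + 1) (fun h => h₁ h.symm)]
    by_cases hj : m = j
    · subst hj
      simp only [hφ.map_tau m h₀, hψ.map_tau_self, map_mul, map_div₀, e₂,
        hφ.map_tau (m - 1) (fun h => h₂' h.symm), hφ.map_tau (m + 1) (fun h => h₁' h.symm)]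
    · simp only [hφ.map_tau m hi, hψ.map_tau m hj]

theorem IsRefl.braid (hl : 2 ≤ l) {i : ZMod (l + 1)} {φ ψ : RatField l ≃ₐ[ℂ] RatField l}
    (hφ : IsRefl i φ) (hψ : IsRefl (i + 1) ψ) : φ * ψ * φ = ψ * φ * ψ := by
  have c₁ : cartan (i + 1) i = -1 := by simpa using cartan_sub_one hl (i + 1)
  have o₁ : orient (i + 1) i = -1 := by simpa using orient_sub_one hl (i + 1)
  have e₁ : φ (α (i + 1)) = α (i + 1) + α i := by
    rw [hφ.map_alpha, cartan_add_one hl]; push_cast; ring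
  have e₂ : φ (f (i + 1)) = f (i + 1) + α i / f i := by
    rw [hφ.map_f, orient_add_one]; push_cast; ring
  have e₃ : ψ (α i) = α i + α (i + 1) := by
    rw [hψ.map_alpha, c₁]; push_cast; ring
  have e₄ : ψ (f i) = f i - α (i + 1) / f (i + 1) := by
    rw [hψ.map_f, o₁]; push_cast; ring
  have hi0 := f_ne_zero i
  have hj0 := f_ne_zero (i + 1)
  have n₁ : f (i + 1) + α i / f i ≠ 0 := by
    rw [← e₂]; exact (map_ne_zero φ).2 hj0
  have n₂ : f i - α (i + 1) / f (i + 1) ≠ 0 := by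
    rw [← e₄]; exact (map_ne_zero ψ).2 hi0
  have n₁' : f i * f (i + 1) + α i ≠ 0 := by
    have := mul_ne_zero hi0 n₁
    rwa [mul_add, mul_div_cancel₀ _ hi0] at this
  have n₂' : f i * f (i + 1) - α (i + 1) ≠ 0 := by
    have := mul_ne_zero n₂ hj0
    rwa [sub_mul, div_mul_cancel₀ _ hj0] at this
  refine algEquiv_ext_vars (fun m => ?_) (fun m => ?_) (fun m => ?_) <;>
    simp only [AlgEquiv.mul_apply]
  · simp only [hφ.map_alpha m, hψ.map_alpha m, map_sub, map_add, map_mul, map_intCast,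
      e₁, e₃, hφ.map_alpha_self, hψ.map_alpha_self]
    ring
  · simp only [hφ.map_f m, hψ.map_f m, map_sub, map_add, map_mul, map_div₀, map_intCast,
      e₁, e₂, e₃, e₄, hφ.map_alpha_self, hψ.map_alpha_self, hφ.map_f_self hl, hψ.map_f_self hl]
    generalize f i = x at *
    generalize f (i + 1) = y at *
    generalize α i = a at *
    generalize α (i + 1) = b at *
    generalize (orient i m : RatField l) = p
    generalize (orient (i + 1) m : RatField l) = q
    -- Clearing the nested denominators by hand: those of `φ ψ φ` are `x` and `x y + a`, those of
    -- `ψ φ ψ` are `y` and `x y - b`.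
    have r₁ : y + a / x = (x * y + a) / x := by field_simp
    have r₂ : x - b / y = (x * y - b) / y := by field_simp
    have r₃ : x - (b + a) / ((x * y + a) / x) = x * (x * y - b) / (x * y + a) := by
      field_simp
      ring
    have r₄ : y + (a + b) / ((x * y - b) / y) = y * (x * y + a) / (x * y - b) := by
      rw [div_div_eq_mul_div, eq_div_iff n₂', add_mul, div_mul_cancel₀ _ n₂']
      ring
    simp only [r₁, r₂, r₃, r₄]
    field_simp
    ring
  · by_cases hmi : m = i
    · subst hmi
      have t₁ : ψ (τ (m - 1)) = τ (m - 1) :=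
        hψ.map_tau _ (add_one_ne_sub_one hl m).symm
      have t₂ : φ (τ (m - 1)) = τ (m - 1) := hφ.map_tau _ (sub_one_ne hl m)
      have t₃ : φ (τ (m + 1)) = τ (m + 1) := hφ.map_tau _ (add_one_ne hl m)
      have t₄ : ψ (τ m) = τ m := hψ.map_tau _ (add_one_ne hl m).symm
      have t₅ : φ (τ (m + 1 + 1)) = τ (m + 1 + 1) :=
        hφ.map_tau _ fun h => add_one_ne_sub_one hl (m + 1) (by rw [h]; ring)
      have t₆ := hψ.map_tau_self
      rw [add_sub_cancel_right] at t₆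
      have t₇ := hφ.map_tau_self
      have hτ := τ_ne_zero (l := l)
      simp only [map_mul, map_div₀, map_sub, t₁, t₂, t₃, t₄, t₅, t₆, t₇, e₁, e₂, e₄,
        hφ.map_f_self hl]
      field_simp [hτ m, hτ (m + 1), hτ (m - 1), hτ (m + 1 + 1)]
      ring
    by_cases hmj : m = i + 1
    · subst hmj
      have t₁ : φ (τ (i + 1 + 1)) = τ (i + 1 + 1) :=
        hφ.map_tau _ fun h => add_one_ne_sub_one hl (i + 1) (by rw [h]; ring)
      have t₂ : ψ (τ (i + 1 + 1)) = τ (i + 1 + 1) := hψ.map_tau _ (add_one_ne hl _)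
      have t₃ : φ (τ (i + 1)) = τ (i + 1) := hφ.map_tau _ (add_one_ne hl i)
      have t₄ : ψ (τ i) = τ i := hψ.map_tau _ (add_one_ne hl i).symm
      have t₅ : ψ (τ (i - 1)) = τ (i - 1) := hψ.map_tau _ (add_one_ne_sub_one hl i).symm
      have t₆ := hψ.map_tau_self
      rw [add_sub_cancel_right] at t₆
      have t₇ := hφ.map_tau_self
      have hτ := τ_ne_zero (l := l)
      simp only [map_mul, map_div₀, map_add, t₁, t₂, t₃, t₄, t₅, t₆, t₇, e₂, e₃, e₄,
        hψ.map_f_self hl]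
      have n₂c : f (i + 1) * f i - α (i + 1) ≠ 0 := by rwa [mul_comm]
      field_simp [hτ i, hτ (i + 1), hτ (i - 1), hτ (i + 1 + 1)]
      ring
    · simp only [hφ.map_tau m hmi, hψ.map_tau m hmj]

theorem IsRefl.rot {i : ZMod (l + 1)} {φ ψ ρ : RatField l ≃ₐ[ℂ] RatField l}
    (hφ : IsRefl i φ) (hψ : IsRefl (i + 1) ψ) (hρ : IsRot ρ) : ρ * φ = ψ * ρ := by
  refine algEquiv_ext_vars (fun m => ?_) (fun m => ?_) (fun m => ?_) <;>
    simp only [AlgEquiv.mul_apply]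
  · have : cartan (i + 1) (m + 1) = cartan i m := by
      simp [cartan, eq_sub_iff_add_eq]
    simp only [hφ.map_alpha, hρ.map_alpha, hψ.map_alpha, map_sub, map_mul, map_intCast, this]
  · have : orient (i + 1) (m + 1) = orient i m := by
      simp [orient, eq_sub_iff_add_eq]
    simp only [hφ.map_f, hρ.map_f, hρ.map_alpha, hψ.map_f, map_add, map_mul, map_div₀,
      map_intCast, this]
  · by_cases hm : m = i
    · subst hm
      simp only [hφ.map_tau_self, hρ.map_tau, hρ.map_f, hψ.map_tau_self, map_mul, map_div₀]
      rw [add_sub_cancel_right, sub_add_cancel]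
    · rw [hφ.map_tau _ hm, hρ.map_tau, hψ.map_tau _ (by simpa using hm)]

/-- The defining formulas of the action, restated with the help of `cartan` and `orient`. -/
theorem isWeylAction_iff (hl : 2 ≤ l)
    {ρ : ExtAffineWeyl l →* (RatField l ≃ₐ[ℂ] RatField l)} :
    IsWeylAction ρ ↔ (∀ i, IsRefl i (ρ (s i))) ∧ IsRot (ρ (rot l)) := by
  constructor
  · intro h
    refine ⟨fun i => ⟨fun j => ?_, fun j => ?_, h.s_tau_self i, fun j hj =>
      h.s_tau_other i j hj.symm⟩, h.rot_alpha, h.rot_f, h.rot_tau⟩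
    · by_cases h₀ : j = i
      · subst h₀
        rw [h.s_alpha_self, cartan_self]
        push_cast
        ring
      by_cases h₁ : j = i + 1
      · subst h₁
        rw [h.s_alpha_next, cartan_add_one hl]
        push_cast
        ring
      by_cases h₂ : j = i - 1
      · subst h₂
        rw [h.s_alpha_prev, cartan_sub_one hl]
        push_cast
        ring
      rw [h.s_alpha_other i j h₀ h₁ h₂, cartan_eq_zero h₀ h₁ h₂]
      simp
    · by_cases h₀ : j = i
      · subst h₀
        rw [h.s_f_self, orient_self hl]
        simp
      by_cases h₁ : j = i + 1
      · subst h₁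
        rw [h.s_f_next, orient_add_one]
        push_cast
        ring
      by_cases h₂ : j = i - 1
      · subst h₂
        rw [h.s_f_prev, orient_sub_one hl]
        push_cast
        ring
      rw [h.s_f_other i j h₀ h₁ h₂, orient_eq_zero h₁ h₂]
      simp
  · rintro ⟨h, hr⟩
    constructor
    · exact fun i => (h i).map_alpha_self
    · intro i
      rw [(h i).map_alpha, cartan_add_one hl]
      push_cast
      ring
    · intro i
      rw [(h i).map_alpha, cartan_sub_one hl]
      push_cast
      ring
    · intro i j h₀ h₁ h₂
      rw [(h i).map_alpha, cartan_eq_zero h₀ h₁ h₂]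
      simp
    · exact fun i => (h i).map_f_self hl
    · intro i
      rw [(h i).map_f, orient_add_one]
      push_cast
      ring
    · intro i
      rw [(h i).map_f, orient_sub_one hl]
      push_cast
      ring
    · intro i j h₀ h₁ h₂
      rw [(h i).map_f, orient_eq_zero h₁ h₂]
      simp
    · exact fun i => (h i).map_tau_self
    · exact fun i j hij => (h i).map_tau j hij.symm
    exacts [hr.map_alpha, hr.map_f, hr.map_tau]

theorem IsRefl.unique {i : ZMod (l + 1)} {φ ψ : RatField l ≃ₐ[ℂ] RatField l}
    (hφ : IsRefl i φ) (hψ : IsRefl i ψ) : φ = ψ := by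
  refine algEquiv_ext_vars (fun m => ?_) (fun m => ?_) (fun m => ?_)
  · rw [hφ.map_alpha, hψ.map_alpha]
  · rw [hφ.map_f, hψ.map_f]
  · by_cases hm : m = i
    · rw [hm, hφ.map_tau_self, hψ.map_tau_self]
    · rw [hφ.map_tau m hm, hψ.map_tau m hm]

theorem IsRot.unique {φ ψ : RatField l ≃ₐ[ℂ] RatField l} (hφ : IsRot φ) (hψ : IsRot ψ) :
    φ = ψ := by
  refine algEquiv_ext_vars (fun m => ?_) (fun m => ?_) (fun m => ?_)
  · rw [hφ.map_alpha, hψ.map_alpha]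
  · rw [hφ.map_f, hψ.map_f]
  · rw [hφ.map_tau, hψ.map_tau]

theorem existsUnique_isWeylAction (hl : 2 ≤ l) :
    ∃! ρ : ExtAffineWeyl l →* (RatField l ≃ₐ[ℂ] RatField l), IsWeylAction ρ := by
  choose σ hσ using exists_isRefl hl
  obtain ⟨π, hπ⟩ := exists_isRot (l := l)
  let g : Gen l → (RatField l ≃ₐ[ℂ] RatField l)
    | .s i => σ i
    | .rot => π
  have hg : ∀ r ∈ {w | Relator l w}, FreeGroup.lift g r = 1 := by
    rintro r (i | ⟨i, j, h₀, h₁, h₂⟩ | ⟨i, j, hij⟩ | _ | i)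
    · rw [map_pow, FreeGroup.lift_apply_of, pow_two]
      exact (hσ i).mul_self hl
    · simp only [map_mul, map_inv, FreeGroup.lift_apply_of]
      exact mul_inv_eq_one.2 ((hσ i).comm (hσ j) h₀ h₁ h₂)
    · simp only [map_mul, map_inv, FreeGroup.lift_apply_of]
      rw [mul_inv_eq_one]
      rcases hij with rfl | rfl
      · exact (hσ i).braid hl (hσ (i + 1))
      · have h := hσ i
        rw [← sub_add_cancel i 1] at h
        have := (hσ (i - 1)).braid hl h
        rw [sub_add_cancel] at this
        exact this.symm
    · simp only [map_pow, FreeGroup.lift_apply_of]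
      have := IsRot.pow_eq_one (φ := (π : RatField l →ₐ[ℂ] RatField l)) hπ
      refine AlgEquiv.ext fun x => ?_
      have hx := congrArg (fun g => g x) this
      simp only [AlgHom.coe_pow] at hx
      rw [AlgEquiv.coe_pow]
      exact hx
    · simp only [map_mul, map_inv, FreeGroup.lift_apply_of]
      exact mul_inv_eq_one.2 ((hσ i).rot (hσ (i + 1)) hπ)
  have hs : ∀ i, PresentedGroup.toGroup hg (s i) = σ i := fun i => PresentedGroup.toGroup.of hg
  have hr : PresentedGroup.toGroup hg (rot l) = π := PresentedGroup.toGroup.of hg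
  refine ⟨PresentedGroup.toGroup hg, (isWeylAction_iff hl).2 ⟨fun i => ?_, ?_⟩, fun ρ hρ => ?_⟩
  · rw [hs]
    exact hσ i
  · rw [hr]
    exact hπ
  · obtain ⟨h₁, h₂⟩ := (isWeylAction_iff hl).1 hρ
    refine PresentedGroup.ext ?_
    rintro (i | _)
    · exact ((h₁ i).unique (hσ i)).trans (hs i).symm
    · exact (h₂.unique hπ).trans hr.symm

end Relations

/-! ### The derivation -/

section DerivationOnField

variable {l : ℕ}

theorem derivation_ext_vars {D₁ D₂ : Derivation ℂ (RatField l) (RatField l)}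
    (hα : ∀ j, D₁ (α j) = D₂ (α j)) (hf : ∀ j, D₁ (f j) = D₂ (f j))
    (hτ : ∀ j, D₁ (τ j) = D₂ (τ j)) : D₁ = D₂ := by
  refine derivation_ext_of_X (σ := Var l) ?_
  rintro (j | j | j)
  exacts [hα j, hf j, hτ j]

theorem IsSystemDerivation.unique {D₁ D₂ : Derivation ℂ (RatField l) (RatField l)}
    (h₁ : IsSystemDerivation D₁) (h₂ : IsSystemDerivation D₂) : D₁ = D₂ := by
  refine derivation_ext_vars (fun j => ?_) (fun j => ?_) (fun j => ?_)
  · rw [h₁.alpha, h₂.alpha]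
  · rw [h₁.f, h₂.f]
  · exact mul_left_cancel₀ k_ne_zero ((h₁.tau j).trans (h₂.tau j).symm)

theorem existsUnique_isSystemDerivation :
    ∃! D : Derivation ℂ (RatField l) (RatField l), IsSystemDerivation D := by
  obtain ⟨D, hD⟩ := exists_derivation_of_X (K := RatField l) (fun v : Var l => match v with
    | .alpha _ => 0
    | .f j => toField (F j)
    | .tau j => toField (h j) * τ j / k l)
  have h : IsSystemDerivation D :=
    ⟨fun j => hD (.alpha j), fun j => hD (.f j), fun j => by
      rw [show D (τ j) = toField (h j) * τ j / k l from hD (.tau j)]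
      exact mul_div_cancel₀ _ k_ne_zero⟩
  exact ⟨D, h, fun D' hD' => hD'.unique h⟩

/-- The derivation `φ⁻¹ ∘ D ∘ φ`. -/
def conjDerivation (D : Derivation ℂ (RatField l) (RatField l)) (φ : RatField l ≃ₐ[ℂ] RatField l) :
    Derivation ℂ (RatField l) (RatField l) :=
  Derivation.mk' (φ.symm.toLinearMap ∘ₗ (D : RatField l →ₗ[ℂ] RatField l) ∘ₗ φ.toLinearMap)
    fun a b => by simp

theorem conjDerivation_apply (D : Derivation ℂ (RatField l) (RatField l))
    (φ : RatField l ≃ₐ[ℂ] RatField l) (x : RatField l) :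
    conjDerivation D φ x = φ.symm (D (φ x)) := rfl

/-- An automorphism commutes with the system derivation `D` as soon as it transforms the defining
equations into themselves: then `φ⁻¹ ∘ D ∘ φ` is a system derivation too, hence equals `D`. -/
theorem comm_of_vars {D : Derivation ℂ (RatField l) (RatField l)}
    (hD : IsSystemDerivation D) {φ : RatField l ≃ₐ[ℂ] RatField l} (hk : φ (k l) = k l)
    (hα : ∀ j, D (φ (α j)) = 0) (hf : ∀ j, D (φ (f j)) = φ (toField (F j)))
    (hτ : ∀ j, k l * D (φ (τ j)) = φ (toField (h j)) * φ (τ j)) (x : RatField l) :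
    φ (D x) = D (φ x) := by
  have : IsSystemDerivation (conjDerivation D φ) := by
    refine ⟨fun j => ?_, fun j => ?_, fun j => ?_⟩
    · rw [conjDerivation_apply, hα, map_zero]
    · rw [conjDerivation_apply, hf, AlgEquiv.symm_apply_apply]
    · apply φ.injective
      rw [conjDerivation_apply, map_mul, hk, AlgEquiv.apply_symm_apply, hτ, map_mul]
  have h := congrArg (fun D => φ (D x)) (this.unique hD)
  simp only [conjDerivation_apply, AlgEquiv.apply_symm_apply] at h
  exact h.symm

/-- Commutation with `D` needs to be checked for the generators of the group only. -/
theorem comm_of_generators {D : Derivation ℂ (RatField l) (RatField l)}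
    {ρ : ExtAffineWeyl l →* (RatField l ≃ₐ[ℂ] RatField l)}
    (hs : ∀ i x, ρ (s i) (D x) = D (ρ (s i) x)) (hr : ∀ x, ρ (rot l) (D x) = D (ρ (rot l) x))
    (w : ExtAffineWeyl l) (x : RatField l) : ρ w (D x) = D (ρ w x) := by
  let H : Subgroup (ExtAffineWeyl l) :=
    { carrier := {w | ∀ x, ρ w (D x) = D (ρ w x)}
      one_mem' := fun x => by simp
      mul_mem' := fun {a b} ha hb x => by
        rw [map_mul, AlgEquiv.mul_apply, AlgEquiv.mul_apply, hb, ha]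
      inv_mem' := fun {a} ha x => by
        apply (ρ a).injective
        rw [ha, map_inv]
        change ρ a ((ρ a).symm _) = D (ρ a ((ρ a).symm _))
        simp }
  refine PresentedGroup.generated_by _ H ?_ w x
  rintro (i | _)
  exacts [hs i, hr]

end DerivationOnField

/-! ### Continuants -/

section Continuants

open Polynomial Matrix

variable {R : Type*} [CommRing R]

/-- The transfer matrix of a node of weight `a` joined to the next node by an edge of weight `c`:
in products of such matrices a node left alone contributes `X a`, and an edge (a dimer) contributes
`1 + X² c`. -/
def site (a c : R) : Matrix (Fin 2) (Fin 2) R[X] := !![X * C a, 1 + X ^ 2 * C c; 1, 0]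

/-- The product of the transfer matrices of the nodes `0, …, m - 1`. -/
def chain (f c : ℕ → R) : ℕ → Matrix (Fin 2) (Fin 2) R[X]
  | 0 => 1
  | m + 1 => chain f c m * site (f m) (c m)

theorem chain_congr {f c f' c' : ℕ → R} {N : ℕ} (hf : ∀ m < N, f m = f' m)
    (hc : ∀ m < N, c m = c' m) : chain f c N = chain f' c' N := by
  induction N with
  | zero => rfl
  | succ N ih =>
    rw [chain, chain, ih (fun m hm => hf m (by omega)) fun m hm => hc m (by omega),
      hf N (by omega), hc N (by omega)]

theorem chain_succ_left (f c : ℕ → R) (m : ℕ) :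
    chain f c (m + 1) =
      site (f 0) (c 0) * chain (fun j => f (j + 1)) (fun j => c (j + 1)) m := by
  induction m with
  | zero => simp [chain]
  | succ m ih => rw [chain, ih, Matrix.mul_assoc, chain]

/-- The trace of the product around a circle does not depend on the node where it starts. -/
theorem trace_chain_shift {f c : ℕ → R} {N : ℕ} (hf : f N = f 0) (hc : c N = c 0) :
    (chain (fun j => f (j + 1)) (fun j => c (j + 1)) N).trace = (chain f c N).trace := by
  cases N with
  | zero => rfl
  | succ N => rw [chain_succ_left f c, Matrix.trace_mul_comm, chain, hf, hc]

theorem map_chain {S : Type*} [CommRing S] (φ : R →+* S) (f c : ℕ → R) (N : ℕ) :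
    (chain f c N).map (Polynomial.map φ) = chain (fun j => φ (f j)) (fun j => φ (c j)) N := by
  induction N with
  | zero =>
    rw [chain, chain]
    exact Matrix.map_one _ (Polynomial.map_zero φ) (Polynomial.map_one φ)
  | succ N ih =>
    rw [chain, chain, ← ih]
    refine (Matrix.map_mul (f := Polynomial.mapRingHom φ)).trans ?_
    congr 1
    ext i j
    fin_cases i <;> fin_cases j <;> simp [site]

theorem map_trace_chain {S : Type*} [CommRing S] (φ : R →+* S) (f c : ℕ → R) (N : ℕ) :
    ((chain f c N).trace).map φ = (chain (fun j => φ (f j)) (fun j => φ (c j)) N).trace := by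
  rw [← map_chain, Matrix.trace_fin_two, Matrix.trace_fin_two, Polynomial.map_add]
  rfl

/-- The local form of the reflection symmetry, for three consecutive nodes of weights `a, b, d`. -/
theorem site_mul_site_mul_site (a b d x p r : R) :
    site (a - x) (p + x * b) * site b p * site (d + x) r =
      site a p * site b (p + x * b) * site d r := by
  refine Matrix.ext fun i j => ?_
  fin_cases i <;> fin_cases j <;> simp [site, Matrix.mul_apply, Fin.sum_univ_two] <;> ring

/-- The reflection symmetry: exchange the weights of the two edges at the node `i + 1`, and
compensate by the weights of its two neighbours. -/
theorem chain_reflect {f c f' c' : ℕ → R} {i N : ℕ} {x : R} (hi : i + 3 ≤ N)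
    (hx : c (i + 1) - c i = x * f (i + 1))
    (h₀ : f' i = f i - x) (h₂ : f' (i + 2) = f (i + 2) + x)
    (hf : ∀ j < N, j ≠ i → j ≠ i + 2 → f' j = f j)
    (hc₀ : c' i = c (i + 1)) (hc₁ : c' (i + 1) = c i)
    (hc : ∀ j < N, j ≠ i → j ≠ i + 1 → c' j = c j) :
    chain f' c' N = chain f c N := by
  induction N, hi using Nat.le_induction with
  | base =>
    have e : chain f' c' i = chain f c i :=
      chain_congr (fun m hm => hf m (by omega) (by omega) (by omega))
        fun m hm => hc m (by omega) (by omega) (by omega)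
    have hx' : c (i + 1) = c i + x * f (i + 1) := by rw [← hx]; ring
    simp only [chain, e, h₀, h₂, hc₀, hc₁, hf (i + 1) (by omega) (by omega) (by omega),
      hc (i + 2) (by omega) (by omega) (by omega), Matrix.mul_assoc, hx']
    rw [← Matrix.mul_assoc (site (f i - x) _), site_mul_site_mul_site, Matrix.mul_assoc]
  | succ N hN ih =>
    rw [chain, chain, ih (fun j hj => hf j (by omega)) (fun j hj => hc j (by omega)),
      hf N (by omega) (by omega) (by omega), hc N (by omega) (by omega) (by omega)]

/-- The sequence `x` consists of the continuants of the nodes `ε, …, m - 1`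
(`m ≥ ε`): it satisfies the three-term recursion and starts with `1`, `X f_ε` at `m = ε, ε + 1`. -/
structure IsContinuant (f c : ℕ → R) (ε : ℕ) (x : ℕ → R[X]) : Prop where
  init₀ : x ε = 1
  init₁ : x (ε + 1) = X * C (f ε)
  step : ∀ m, x (m + 2) = X * C (f (m + 1)) * x (m + 1) + (1 + X ^ 2 * C (c m)) * x m

theorem chain_succ_zero (f c : ℕ → R) (m : ℕ) (i : Fin 2) :
    chain f c (m + 1) i 0 = chain f c m i 0 * (X * C (f m)) + chain f c m i 1 := by
  simp [chain, site, Matrix.mul_apply, Fin.sum_univ_two]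

theorem chain_succ_one (f c : ℕ → R) (m : ℕ) (i : Fin 2) :
    chain f c (m + 1) i 1 = chain f c m i 0 * (1 + X ^ 2 * C (c m)) := by
  simp [chain, site, Matrix.mul_apply, Fin.sum_univ_two]

theorem isContinuant_zero (f c : ℕ → R) : IsContinuant f c 0 fun m => chain f c m 0 0 where
  init₀ := by simp [chain]
  init₁ := by simp [chain, site]
  step m := by rw [chain_succ_zero, chain_succ_one]; ring

theorem isContinuant_one (f c : ℕ → R) : IsContinuant f c 1 fun m => chain f c m 1 0 where
  init₀ := by simp [chain, site]
  init₁ := by simp [chain, site, Matrix.mul_apply, Fin.sum_univ_two]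
  step m := by rw [chain_succ_zero, chain_succ_one]; ring

theorem trace_chain_succ (f c : ℕ → R) (m : ℕ) : (chain f c (m + 1)).trace =
    chain f c (m + 1) 0 0 + (1 + X ^ 2 * C (c m)) * chain f c m 1 0 := by
  rw [Matrix.trace_fin_two, chain_succ_one]
  ring

theorem coeff_one_add_mul_zero (c : R) (p : R[X]) :
    ((1 + X ^ 2 * C c) * p).coeff 0 = p.coeff 0 := by
  simp [add_mul, mul_assoc, Polynomial.mul_coeff_zero]

theorem coeff_one_add_mul_one (c : R) (p : R[X]) :
    ((1 + X ^ 2 * C c) * p).coeff 1 = p.coeff 1 := by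
  rw [add_mul, one_mul, mul_assoc, coeff_add, Polynomial.coeff_X_pow_mul']
  simp

theorem coeff_one_add_mul (c : R) (p : R[X]) (d : ℕ) :
    ((1 + X ^ 2 * C c) * p).coeff (d + 2) = p.coeff (d + 2) + c * p.coeff d := by
  rw [add_mul, one_mul, mul_assoc, coeff_add, Polynomial.coeff_X_pow_mul, coeff_C_mul]

section

variable {f c : ℕ → R} {ε : ℕ} {x : ℕ → R[X]}

theorem IsContinuant.coeff_zero_step (h : IsContinuant f c ε x) (m : ℕ) :
    (x (m + 2)).coeff 0 = (x m).coeff 0 := by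
  rw [h.step, coeff_add, coeff_one_add_mul_zero]
  simp [Polynomial.mul_coeff_zero]

theorem IsContinuant.coeff_one_step (h : IsContinuant f c ε x) (m : ℕ) :
    (x (m + 2)).coeff 1 = f (m + 1) * (x (m + 1)).coeff 0 + (x m).coeff 1 := by
  rw [h.step, coeff_add, coeff_one_add_mul_one, mul_assoc, Polynomial.coeff_X_mul, coeff_C_mul]

theorem IsContinuant.coeff_step (h : IsContinuant f c ε x) (m d : ℕ) :
    (x (m + 2)).coeff (d + 2) = f (m + 1) * (x (m + 1)).coeff (d + 1) +
      ((x m).coeff (d + 2) + c m * (x m).coeff d) := by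
  rw [h.step, coeff_add, coeff_one_add_mul, mul_assoc, Polynomial.coeff_X_mul, coeff_C_mul]

theorem IsContinuant.coeff_zero (h : IsContinuant f c ε x) (t : ℕ) :
    (x (ε + 2 * t)).coeff 0 = 1 := by
  induction t with
  | zero => simp [h.init₀]
  | succ t ih => rw [mul_add_one, ← add_assoc, h.coeff_zero_step, ih]

theorem IsContinuant.coeff_one (h : IsContinuant f c ε x) (t : ℕ) :
    (x (ε + 2 * t + 1)).coeff 1 = ∑ r ∈ Finset.range (t + 1), f (ε + 2 * r) := by
  induction t with
  | zero => simp [h.init₁]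
  | succ t ih =>
    rw [Finset.sum_range_succ, ← ih]
    refine (h.coeff_one_step (ε + 2 * t + 1)).trans ?_
    rw [show ε + 2 * t + 1 + 1 = ε + 2 * (t + 1) by ring, h.coeff_zero]
    ring

theorem IsContinuant.coeff_two (h : IsContinuant f c ε x) (t : ℕ) :
    (x (ε + 2 * t)).coeff 2 = (∑ s ∈ Finset.range t, ∑ r ∈ Finset.range (s + 1),
      f (ε + 2 * r) * f (ε + 2 * s + 1)) + ∑ r ∈ Finset.range t, c (ε + 2 * r) := by
  induction t with
  | zero => simp [h.init₀, Polynomial.coeff_one]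
  | succ t ih =>
    rw [Finset.sum_range_succ, Finset.sum_range_succ (fun r => c _) t, ← Finset.sum_mul]
    refine (h.coeff_step (ε + 2 * t) 0).trans ?_
    rw [zero_add, zero_add, ih, h.coeff_zero, h.coeff_one]
    ring

/-- The effect on the coefficients of adding a constant to all edge weights. -/
theorem IsContinuant.coeff_shift {c' : ℕ → R} {x' : ℕ → R[X]} {δ : R} (h : IsContinuant f c ε x)
    (h' : IsContinuant f c' ε x') (hc : ∀ m, c' m = c m + δ) (t : ℕ) :
    (x' (ε + 2 * t)).coeff 2 = (x (ε + 2 * t)).coeff 2 + t * δ ∧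
    (x' (ε + 2 * t + 1)).coeff 3 =
      (x (ε + 2 * t + 1)).coeff 3 + t * δ * (x (ε + 2 * t + 1)).coeff 1 ∧
    2 * (x' (ε + 2 * t)).coeff 4 = 2 * (x (ε + 2 * t)).coeff 4 +
      2 * (t - 1) * δ * (x (ε + 2 * t)).coeff 2 + t * (t - 1) * δ ^ 2 := by
  have e1 : ∀ t, (x' (ε + 2 * t + 1)).coeff 1 = (x (ε + 2 * t + 1)).coeff 1 := fun t => by
    rw [h.coeff_one, h'.coeff_one]
  induction t with
  | zero => simp [h.init₀, h.init₁, h'.init₀, h'.init₁, Polynomial.coeff_one]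
  | succ t ih =>
    obtain ⟨i2, i3, i4⟩ := ih
    have e2 : (x' (ε + 2 * (t + 1))).coeff 2 =
        (x (ε + 2 * (t + 1))).coeff 2 + (t + 1 : ℕ) * δ := by
      rw [mul_add_one, ← add_assoc, h.coeff_step, h'.coeff_step, hc, i2, zero_add, zero_add, e1,
        h.coeff_zero, h'.coeff_zero]
      push_cast
      ring
    refine ⟨e2, ?_, ?_⟩
    · rw [mul_add_one, ← add_assoc] at e2 ⊢
      have o := h.coeff_one_step (ε + 2 * t + 1)
      have z := h.coeff_zero (t + 1)
      rw [mul_add_one, ← add_assoc] at z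
      have s := h.coeff_step (ε + 2 * t + 1) 1
      have s' := h'.coeff_step (ε + 2 * t + 1) 1
      norm_num only [add_assoc] at s s' e2 e1 i3 o z ⊢
      rw [s, s', e2, i3, hc, e1, o, z]
      push_cast
      ring
    · rw [mul_add_one, ← add_assoc]
      have s := h.coeff_step (ε + 2 * t) 2
      have s' := h'.coeff_step (ε + 2 * t) 2
      have s₂ := h.coeff_step (ε + 2 * t) 0
      norm_num only at s s' s₂
      rw [s, s', i3, i2, hc, s₂, h.coeff_zero]
      push_cast
      linear_combination i4

end

end Continuants

/-! ### Alternating sets -/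

section Alternating

/-- The number of elements of `K` below `v`. -/
def rank (K : Finset ℕ) (v : ℕ) : ℕ := (K.filter (· < v)).card

/-- The elements of `K` have alternating parities, the smallest one having the parity of `ε`: the
element of rank `r` is congruent to `r + ε` modulo `2`. -/
def IsAlt (ε : ℕ) (K : Finset ℕ) : Prop := ∀ v ∈ K, Even (v + rank K v + ε)

instance (ε : ℕ) : DecidablePred (IsAlt ε) := fun _ => by unfold IsAlt; infer_instance

/-- The alternating subsets of `{0, …, m - 1}` with `d` elements, the smallest one having the
parity of `ε`. -/
def altSets (ε d m : ℕ) : Finset (Finset ℕ) :=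
  (Finset.powersetCard d (Finset.range m)).filter (IsAlt ε)

theorem rank_insert_of_le {K : Finset ℕ} {m v : ℕ} (hv : v ≤ m) :
    rank (insert m K) v = rank K v := by
  rw [rank, rank, Finset.filter_insert, if_neg (by omega)]

theorem rank_of_subset_range {K : Finset ℕ} {m : ℕ} (hK : K ⊆ Finset.range m) :
    rank K m = K.card := by
  rw [rank, Finset.filter_true_of_mem fun v hv => Finset.mem_range.1 (hK hv)]

theorem isAlt_insert {K : Finset ℕ} {ε m : ℕ} (hK : K ⊆ Finset.range m) :
    IsAlt ε (insert m K) ↔ Even (m + K.card + ε) ∧ IsAlt ε K := by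
  rw [IsAlt, Finset.forall_mem_insert, rank_insert_of_le le_rfl, rank_of_subset_range hK]
  refine and_congr_right fun _ => forall₂_congr fun v hv => ?_
  rw [rank_insert_of_le (Finset.mem_range.1 (hK hv)).le]

theorem altSets_zero (ε m : ℕ) : altSets ε 0 m = {∅} := by
  rw [altSets, Finset.powersetCard_zero, Finset.filter_true_of_mem]
  simp [IsAlt]

theorem altSets_succ_zero (ε d : ℕ) : altSets ε (d + 1) 0 = ∅ := by
  simp [altSets]

variable {R : Type*} [CommRing R]

theorem sum_altSets_succ (g : Finset ℕ → R) (ε d m : ℕ) :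
    ∑ K ∈ altSets ε (d + 1) (m + 1), g K = ∑ K ∈ altSets ε (d + 1) m, g K +
      if Even (m + d + ε) then ∑ K ∈ altSets ε d m, g (insert m K) else 0 := by
  have hm : ∀ {e : ℕ} {K}, K ∈ Finset.powersetCard e (Finset.range m) → m ∉ K := fun hK h =>
    absurd ((Finset.mem_powersetCard.1 hK).1 h) (by simp)
  rw [altSets, Finset.sum_filter, Finset.range_add_one,
    Finset.powersetCard_succ_insert (by simp), Finset.sum_union, altSets, Finset.sum_filter,
    Finset.sum_image]
  · congr 1
    split_ifs with h
    · rw [altSets, Finset.sum_filter]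
      refine Finset.sum_congr rfl fun K hK => if_congr ?_ rfl rfl
      obtain ⟨hK, hd⟩ := Finset.mem_powersetCard.1 hK
      rw [isAlt_insert hK, hd]
      exact and_iff_right h
    · refine Finset.sum_eq_zero fun K hK => if_neg ?_
      obtain ⟨hK, hd⟩ := Finset.mem_powersetCard.1 hK
      rw [isAlt_insert hK, hd]
      exact fun h' => h h'.1
  · intro K hK K' hK' h
    rw [← Finset.erase_insert (hm hK), ← Finset.erase_insert (hm hK')]
    exact congrArg (fun K => K.erase m) h
  · rw [Finset.disjoint_left]
    intro K hK hK'
    obtain ⟨K', -, rfl⟩ := Finset.mem_image.1 hK'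
    exact hm hK (Finset.mem_insert_self _ _)

/-- The sum of the products `f_K` over the alternating sets `K`. -/
def altSum (f : ℕ → R) (ε d m : ℕ) : R := ∑ K ∈ altSets ε d m, ∏ v ∈ K, f v

/-- The sum of the products `f_K`, weighted by the alternating sums of `ϖ` over the complement
of `K`, over the alternating sets `K`. -/
def altWeightSum (f ϖ : ℕ → R) (ε d m : ℕ) : R :=
  ∑ K ∈ altSets ε d m,
    (∑ v ∈ Finset.range m \ K, (-1) ^ (v + rank K v + ε) * ϖ v) * ∏ v ∈ K, f v

theorem altSum_zero (f : ℕ → R) (ε m : ℕ) : altSum f ε 0 m = 1 := by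
  simp [altSum, altSets_zero]

theorem altSum_succ_zero (f : ℕ → R) (ε d : ℕ) : altSum f ε (d + 1) 0 = 0 := by
  simp [altSum, altSets_succ_zero]

theorem altSum_succ (f : ℕ → R) (ε d m : ℕ) : altSum f ε (d + 1) (m + 1) =
    altSum f ε (d + 1) m + if Even (m + d + ε) then f m * altSum f ε d m else 0 := by
  rw [altSum, sum_altSets_succ, altSum, altSum, Finset.mul_sum]
  congr 2
  refine Finset.sum_congr rfl fun K hK => ?_
  have hK' := (Finset.mem_powersetCard.1 (Finset.mem_filter.1 hK).1).1
  exact Finset.prod_insert fun h => absurd (hK' h) (by simp)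

theorem altSum_succ_of_even (f : ℕ → R) {ε d m : ℕ} (h : Even (m + d + ε)) :
    altSum f ε (d + 1) (m + 1) = altSum f ε (d + 1) m + f m * altSum f ε d m := by
  rw [altSum_succ, if_pos h]

theorem altSum_succ_of_odd (f : ℕ → R) {ε d m : ℕ} (h : Odd (m + d + ε)) :
    altSum f ε (d + 1) (m + 1) = altSum f ε (d + 1) m := by
  rw [altSum_succ, if_neg (Nat.not_even_iff_odd.2 h), add_zero]

theorem altWeightSum_at_zero (f ϖ : ℕ → R) (ε d : ℕ) : altWeightSum f ϖ ε d 0 = 0 := by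
  simp [altWeightSum]

theorem sum_compl_of_subset {ϖ : ℕ → R} {ε m : ℕ} {K : Finset ℕ} (hK : K ⊆ Finset.range m) :
    ∑ v ∈ Finset.range (m + 1) \ K, (-1) ^ (v + rank K v + ε) * ϖ v =
      (∑ v ∈ Finset.range m \ K, (-1) ^ (v + rank K v + ε) * ϖ v) +
        (-1) ^ (m + K.card + ε) * ϖ m := by
  have hm : m ∉ K := fun h => absurd (hK h) (by simp)
  rw [Finset.range_add_one, Finset.insert_sdiff_of_notMem _ hm, Finset.sum_insert (by simp),
    rank_of_subset_range hK, add_comm]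

theorem altWeightSum_zero_succ (f ϖ : ℕ → R) (ε m : ℕ) : altWeightSum f ϖ ε 0 (m + 1) =
    altWeightSum f ϖ ε 0 m + (-1) ^ (m + ε) * ϖ m := by
  simp only [altWeightSum, altSets_zero, Finset.sum_singleton]
  rw [sum_compl_of_subset (ϖ := ϖ) (Finset.empty_subset _)]
  simp

theorem altWeightSum_succ (f ϖ : ℕ → R) (ε d m : ℕ) : altWeightSum f ϖ ε (d + 1) (m + 1) =
    altWeightSum f ϖ ε (d + 1) m + (-1) ^ (m + (d + 1) + ε) * ϖ m * altSum f ε (d + 1) m +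
      if Even (m + d + ε) then f m * altWeightSum f ϖ ε d m else 0 := by
  rw [altWeightSum, sum_altSets_succ, altWeightSum, altWeightSum, altSum, Finset.mul_sum,
    Finset.mul_sum, ← Finset.sum_add_distrib]
  refine congrArg₂ _ (Finset.sum_congr rfl fun K hK => ?_)
    (if_congr Iff.rfl (Finset.sum_congr rfl fun K hK => ?_) rfl)
  · obtain ⟨hK, hd⟩ := Finset.mem_powersetCard.1 (Finset.mem_filter.1 hK).1
    rw [sum_compl_of_subset hK, hd]
    ring
  · obtain ⟨hK, hd⟩ := Finset.mem_powersetCard.1 (Finset.mem_filter.1 hK).1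
    have hm : m ∉ K := fun h => absurd (hK h) (by simp)
    have e : Finset.range (m + 1) \ insert m K = Finset.range m \ K := by
      rw [Finset.range_add_one, Finset.insert_sdiff_insert,
        Finset.sdiff_insert_of_notMem (by simp)]
    have e' : ∀ v ∈ Finset.range m \ K, (-1) ^ (v + rank (insert m K) v + ε) * ϖ v =
        (-1) ^ (v + rank K v + ε) * ϖ v := fun v hv => by
      rw [rank_insert_of_le (Finset.mem_range.1 (Finset.mem_sdiff.1 hv).1).le]
    rw [Finset.prod_insert hm, e, Finset.sum_congr rfl e']
    ring

theorem altWeightSum_zero_succ_of_even (f ϖ : ℕ → R) {ε m : ℕ} (h : Even (m + ε)) :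
    altWeightSum f ϖ ε 0 (m + 1) = altWeightSum f ϖ ε 0 m + ϖ m := by
  rw [altWeightSum_zero_succ, h.neg_one_pow, one_mul]

theorem altWeightSum_zero_succ_of_odd (f ϖ : ℕ → R) {ε m : ℕ} (h : Odd (m + ε)) :
    altWeightSum f ϖ ε 0 (m + 1) = altWeightSum f ϖ ε 0 m - ϖ m := by
  rw [altWeightSum_zero_succ, h.neg_one_pow]
  ring

theorem altWeightSum_succ_of_even (f ϖ : ℕ → R) {ε d m : ℕ} (h : Even (m + d + ε)) :
    altWeightSum f ϖ ε (d + 1) (m + 1) = altWeightSum f ϖ ε (d + 1) m -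
      ϖ m * altSum f ε (d + 1) m + f m * altWeightSum f ϖ ε d m := by
  rw [altWeightSum_succ, if_pos h, Odd.neg_one_pow (by
    rw [← add_assoc, add_right_comm]; exact h.add_one)]
  ring

theorem altWeightSum_succ_of_odd (f ϖ : ℕ → R) {ε d m : ℕ} (h : Odd (m + d + ε)) :
    altWeightSum f ϖ ε (d + 1) (m + 1) =
      altWeightSum f ϖ ε (d + 1) m + ϖ m * altSum f ε (d + 1) m := by
  rw [altWeightSum_succ, if_neg (Nat.not_even_iff_odd.2 h), Even.neg_one_pow (by
    rw [← add_assoc, add_right_comm]; exact h.add_one)]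
  ring

end Alternating

section Coefficients

open Polynomial

variable {R : Type*} [CommRing R] {f ϖ : ℕ → R} {ε : ℕ} {x : ℕ → R[X]}

/-- If the edge weights are differences `c_j = ϖ_j - ϖ_{j+1}`, the alternating sum of `ϖ` over a
chain with an even number of nodes is the sum of the edge weights of its tiling by dimers; so the
coefficients of the continuants are sums over alternating sets. The last coefficient contains the
products of the weights of two different dimers, whence half the difference of a square and a sum of
squares. -/
theorem IsContinuant.coeff_eq_altSum (h : IsContinuant f (fun j => ϖ j - ϖ (j + 1)) ε x)
    (hε : ε ≤ 1) (h0 : ϖ 0 = 0) (t : ℕ) :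
    (x (ε + 2 * t + 1)).coeff 1 = altSum f ε 1 (ε + 2 * t + 1) ∧
    (x (ε + 2 * t)).coeff 2 =
      altSum f ε 2 (ε + 2 * t) + altWeightSum f ϖ ε 0 (ε + 2 * t) ∧
    (x (ε + 2 * t + 1)).coeff 3 =
      altSum f ε 3 (ε + 2 * t + 1) + altWeightSum f ϖ ε 1 (ε + 2 * t + 1) ∧
    2 * (x (ε + 2 * t)).coeff 4 =
      2 * (altSum f ε 4 (ε + 2 * t) + altWeightSum f ϖ ε 2 (ε + 2 * t)) +
        altWeightSum f ϖ ε 0 (ε + 2 * t) ^ 2 -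
        ∑ j ∈ Finset.range t, (ϖ (ε + 2 * j) - ϖ (ε + 2 * j + 1)) ^ 2 := by
  induction t with
  | zero =>
    obtain rfl | rfl : ε = 0 ∨ ε = 1 := by omega
    all_goals
      have e0 := h.init₀
      have e1 := h.init₁
      simp only [Nat.zero_add, Nat.reduceAdd] at e0 e1
      simp [e0, e1, altSum_succ, altSum_zero, altSum_succ_zero, altWeightSum_at_zero,
        altWeightSum_zero_succ, altWeightSum_succ, h0, Polynomial.coeff_one, Nat.even_add_one]
  | succ t ih =>
    obtain ⟨i1, i2, i3, i4⟩ := ih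
    have z := h.coeff_zero t
    have z' := h.coeff_zero (t + 1)
    rw [Finset.sum_range_succ, show ε + 2 * (t + 1) = ε + 2 * t + 2 by ring] at *
    obtain ⟨m, hm⟩ : ∃ m, m = ε + 2 * t := ⟨_, rfl⟩
    rw [← hm] at i1 i2 i3 i4 z z' ⊢
    have hp : Even (m + ε) := by rw [Nat.even_iff]; omega
    have j2 : (x (m + 2)).coeff 2 =
        altSum f ε 2 (m + 2) + altWeightSum f ϖ ε 0 (m + 2) := by
      rw [h.coeff_step, altSum_succ_of_even f (by grind), altSum_succ_of_odd f (by grind),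
        altWeightSum_zero_succ_of_odd _ _ (by grind), altWeightSum_zero_succ_of_even _ _ hp,
        zero_add, i1, i2, z]
      ring
    refine ⟨?_, j2, ?_, ?_⟩
    · rw [h.coeff_one_step, altSum_succ_of_even f (by grind), altSum_succ_of_odd f (by grind),
        i1, z', altSum_zero]
      ring
    · rw [h.coeff_step (m + 1) 1, altSum_succ_of_even f (by grind),
        altSum_succ_of_odd f (by grind), altWeightSum_succ_of_even _ _ (by grind),
        altWeightSum_succ_of_odd _ _ (by grind),
        altSum_succ_of_odd f (d := 0) (m := m + 1) (by grind), j2, i3, i1]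
      ring
    · rw [h.coeff_step m 2, altSum_succ_of_even f (by grind),
        altSum_succ_of_odd f (by grind), altWeightSum_succ_of_even _ _ (by grind),
        altWeightSum_succ_of_odd _ _ (by grind), altSum_succ_of_odd f (d := 1) (m := m) (by grind),
        altWeightSum_zero_succ_of_odd _ _ (by grind), altWeightSum_zero_succ_of_even _ _ hp,
        i3, i2]
      linear_combination i4

end Coefficients

/-! ### The sets `S_d` and alternating sets -/

section Circle

variable {l : ℕ}

/-- The image of a set of natural numbers in the circle. -/
def onCircle (l : ℕ) (K : Finset ℕ) : Finset (ZMod (l + 1)) :=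
  K.image fun n : ℕ => (n : ZMod (l + 1))

theorem natCast_inj_of_lt {a b : ℕ} (ha : a < l + 1) (hb : b < l + 1)
    (h : (a : ZMod (l + 1)) = b) : a = b := by
  rw [← ZMod.val_cast_of_lt ha, ← ZMod.val_cast_of_lt hb, h]

theorem mem_onCircle {K : Finset ℕ} (hK : K ⊆ Finset.range (l + 1)) {n : ℕ} (hn : n < l + 1) :
    (n : ZMod (l + 1)) ∈ onCircle l K ↔ n ∈ K := by
  refine ⟨fun h => ?_, fun h => Finset.mem_image_of_mem _ h⟩
  obtain ⟨m, hm, e⟩ := Finset.mem_image.1 h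
  rwa [← natCast_inj_of_lt (Finset.mem_range.1 (hK hm)) hn e]

theorem rank_of_next {K : Finset ℕ} {v w : ℕ} (hv : v ∈ K) (hvw : v < w)
    (h : ∀ u ∈ K, v < u → w ≤ u) : rank K w = rank K v + 1 := by
  rw [rank, rank, ← Finset.card_insert_of_notMem (a := v) (by simp)]
  congr 1
  ext u
  simp only [Finset.mem_filter, Finset.mem_insert]
  constructor
  · rintro ⟨hu, huw⟩
    by_contra! hc
    have := h u hu (lt_of_le_of_ne (hc.2 hu) (Ne.symm hc.1))
    omega
  · rintro (rfl | ⟨hu, huv⟩)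
    exacts [⟨hv, hvw⟩, ⟨hu, huv.trans hvw⟩]

theorem rank_of_first {K : Finset ℕ} {v : ℕ} (h : ∀ u ∈ K, v ≤ u) : rank K v = 0 := by
  rw [rank, Finset.card_eq_zero, Finset.filter_eq_empty_iff]
  exact fun u hu => not_lt.2 (h u hu)

theorem rank_of_last {K : Finset ℕ} {v : ℕ} (hv : v ∈ K) (h : ∀ u ∈ K, u ≤ v) :
    rank K v + 1 = K.card := by
  rw [rank, ← Finset.card_insert_of_notMem (a := v) (by simp)]
  congr 1
  ext u
  simp only [Finset.mem_filter, Finset.mem_insert]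
  constructor
  · rintro (rfl | h)
    exacts [hv, h.1]
  · intro hu
    have := h u hu
    by_cases e : u = v
    exacts [Or.inl e, Or.inr ⟨hu, lt_of_le_of_ne this e⟩]

theorem stepsForward_of_next {K : Finset ℕ} (hK : K ⊆ Finset.range (l + 1)) {v w : ℕ}
    (hw : w ∈ K) (hvw : v < w) (h : ∀ u ∈ K, v < u → w ≤ u) :
    stepsForward (onCircle l K) (v : ZMod (l + 1)) = w - v := by
  have hwl := Finset.mem_range.1 (hK hw)
  refine IsLeast.csInf_eq ⟨⟨by omega, ?_⟩, ?_⟩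
  · rw [← Nat.cast_add, Nat.add_sub_cancel' hvw.le, mem_onCircle hK hwl]
    exact hw
  · rintro j ⟨hj, hj'⟩
    by_contra hlt
    rw [← Nat.cast_add, mem_onCircle hK (by omega)] at hj'
    have := h _ hj' (by omega)
    omega

/-- From the last element the next one is reached after passing through the node `0`. -/
theorem stepsForward_of_last {K : Finset ℕ} (hK : K ⊆ Finset.range (l + 1)) {v w : ℕ}
    (hv : v ∈ K) (hvl : ∀ u ∈ K, u ≤ v) (hw : w ∈ K) (hwf : ∀ u ∈ K, w ≤ u) :
    stepsForward (onCircle l K) (v : ZMod (l + 1)) = l + 1 + w - v := by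
  have hwl := Finset.mem_range.1 (hK hw)
  have hvl' := Finset.mem_range.1 (hK hv)
  refine IsLeast.csInf_eq ⟨⟨by omega, ?_⟩, ?_⟩
  · rw [← Nat.cast_add, show v + (l + 1 + w - v) = (l + 1) + w by omega, Nat.cast_add,
      ZMod.natCast_self, zero_add, mem_onCircle hK hwl]
    exact hw
  · rintro j ⟨hj, hj'⟩
    by_contra hlt
    rw [← Nat.cast_add] at hj'
    by_cases hjl : v + j < l + 1
    · rw [mem_onCircle hK hjl] at hj'
      have := hvl _ hj'
      omega
    · rw [show v + j = (l + 1) + (v + j - (l + 1)) by omega, Nat.cast_add, ZMod.natCast_self,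
        zero_add, mem_onCircle hK (by omega)] at hj'
      have := hwf _ hj'
      omega

theorem stepsBack_of_prev {K : Finset ℕ} (hK : K ⊆ Finset.range (l + 1)) {p v : ℕ}
    (hv : v < l + 1) (hp : p ∈ K) (hpv : p < v) (h : ∀ u ∈ K, p < u → v ≤ u) :
    stepsBack (onCircle l K) (v : ZMod (l + 1)) = v - p := by
  refine IsLeast.csInf_eq ⟨⟨by omega, ?_⟩, ?_⟩
  · rw [← Nat.cast_sub (by omega), Nat.sub_sub_self hpv.le, mem_onCircle hK (by omega)]
    exact hp
  · rintro j ⟨hj, hj'⟩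
    by_contra hlt
    rw [← Nat.cast_sub (by omega), mem_onCircle hK (by omega)] at hj'
    have := h _ hj' (by omega)
    omega

theorem stepsBack_of_first {K : Finset ℕ} (hK : K ⊆ Finset.range (l + 1)) {p v : ℕ}
    (hv : v < l + 1) (hp : p ∈ K) (hpl : ∀ u ∈ K, u ≤ p) (h : ∀ u ∈ K, v < u) :
    stepsBack (onCircle l K) (v : ZMod (l + 1)) = l + 1 + v - p := by
  have hpl' := Finset.mem_range.1 (hK hp)
  have wrap : ∀ j ≤ l + 1, (v : ZMod (l + 1)) - j = ((l + 1 + v - j : ℕ) : ZMod (l + 1)) := by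
    intro j hj
    rw [Nat.cast_sub (by omega), Nat.cast_add (l + 1), ZMod.natCast_self, zero_add]
  have hvp := h p hp
  refine IsLeast.csInf_eq ⟨⟨by omega, ?_⟩, ?_⟩
  · rw [wrap _ (by omega), show l + 1 + v - (l + 1 + v - p) = p by omega, mem_onCircle hK hpl']
    exact hp
  · rintro j ⟨hj, hj'⟩
    by_contra hlt
    by_cases hjv : j ≤ v
    · rw [← Nat.cast_sub hjv, mem_onCircle hK (by omega)] at hj'
      have := h _ hj'
      omega
    · rw [wrap _ (by omega), mem_onCircle hK (by omega)] at hj'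
      have := hpl _ hj'
      omega

/-- The gaps around the circle are all odd if and only if the parities alternate; the gap that
contains the node `0` is taken care of by the parity of the number of elements. -/
theorem forall_odd_stepsForward_iff {K : Finset ℕ} (hK : K ⊆ Finset.range (l + 1))
    (hne : K.Nonempty) (hpar : Even (K.card + (l + 1))) :
    (∀ v ∈ onCircle l K, Odd (stepsForward (onCircle l K) v)) ↔ IsAlt 0 K ∨ IsAlt 1 K := by
  have key : (∀ v ∈ onCircle l K, Odd (stepsForward (onCircle l K) v)) ↔
      ∀ v ∈ K, Odd (stepsForward (onCircle l K) (v : ZMod (l + 1))) := by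
    simp [onCircle]
  rw [key]
  obtain ⟨a, ha, hal⟩ : ∃ a ∈ K, ∀ u ∈ K, a ≤ u := K.exists_min_image id hne
  obtain ⟨b, hb, hbl⟩ : ∃ b ∈ K, ∀ u ∈ K, u ≤ b := K.exists_max_image id hne
  have next : ∀ v ∈ K, v ≠ b → ∃ w ∈ K, v < w ∧ ∀ u ∈ K, v < u → w ≤ u := by
    intro v hv hvb
    obtain ⟨w, hw, hw'⟩ := (K.filter (v < ·)).exists_min_image id
      ⟨b, Finset.mem_filter.2 ⟨hb, lt_of_le_of_ne (hbl v hv) hvb⟩⟩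
    obtain ⟨hw, hvw⟩ := Finset.mem_filter.1 hw
    exact ⟨w, hw, hvw, fun u hu h => hw' u (Finset.mem_filter.2 ⟨hu, h⟩)⟩
  constructor
  · intro h
    have hall : ∀ v ∈ K, Even (v + rank K v + a) := by
      intro v
      induction v using Nat.strong_induction_on with
      | _ v ih =>
        intro hv
        by_cases hva : v = a
        · rw [hva, rank_of_first hal]
          exact ⟨a, by ring⟩
        obtain ⟨p, hp, hp'⟩ := (K.filter (· < v)).exists_max_image id
          ⟨a, Finset.mem_filter.2 ⟨ha, lt_of_le_of_ne (hal v hv) (Ne.symm hva)⟩⟩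
        obtain ⟨hp, hpv⟩ := Finset.mem_filter.1 hp
        have hn : ∀ u ∈ K, p < u → v ≤ u := fun u hu hpu => by
          by_contra! hlt
          have : u ≤ p := hp' u (Finset.mem_filter.2 ⟨hu, hlt⟩)
          omega
        have h₁ := ih p hpv hp
        have h₂ := h p hp
        rw [stepsForward_of_next hK hv hpv hn, Nat.odd_iff] at h₂
        rw [rank_of_next hp hpv hn, Nat.even_iff]
        rw [Nat.even_iff] at h₁
        omega
    rcases Nat.even_or_odd a with hae | hae
    · refine Or.inl fun v hv => ?_
      have := hall v hv
      rw [Nat.even_iff] at this hae ⊢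
      omega
    · refine Or.inr fun v hv => ?_
      have := hall v hv
      rw [Nat.odd_iff] at hae
      rw [Nat.even_iff] at this ⊢
      omega
  · intro h v hv
    have h' : ∃ ε, IsAlt ε K := h.elim (fun h => ⟨0, h⟩) fun h => ⟨1, h⟩
    obtain ⟨ε, h'⟩ := h'
    by_cases hvb : v = b
    · subst hvb
      rw [stepsForward_of_last hK hv hbl ha hal, Nat.odd_iff]
      have h₁ := h' v hv
      have h₂ := h' a ha
      have h₃ := rank_of_last hv hbl
      have h₄ := Finset.mem_range.1 (hK hv)
      rw [rank_of_first hal, Nat.even_iff] at h₂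
      rw [Nat.even_iff] at h₁ hpar
      omega
    · obtain ⟨w, hw, hvw, hn⟩ := next v hv hvb
      have h₁ := h' v hv
      have h₂ := h' w hw
      rw [rank_of_next hv hvw hn, Nat.even_iff] at h₂
      rw [Nat.even_iff] at h₁
      rw [stepsForward_of_next hK hw hvw hn, Nat.odd_iff]
      omega

theorem neg_one_pow_stepsBack {K : Finset ℕ} (hK : K ⊆ Finset.range (l + 1)) {ε v : ℕ}
    (hne : K.Nonempty) (hpar : Even (K.card + (l + 1)))
    (h : IsAlt ε K) (hv : v < l + 1) (hvK : v ∉ K) :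
    (-1 : Poly l) ^ (stepsBack (onCircle l K) (v : ZMod (l + 1)) - 1) =
      (-1) ^ (v + rank K v + ε) := by
  obtain ⟨b, hb, hbl⟩ : ∃ b ∈ K, ∀ u ∈ K, u ≤ b := K.exists_max_image id hne
  refine neg_one_pow_congr ?_
  by_cases hf : ∀ u ∈ K, v < u
  · rw [stepsBack_of_first hK hv hb hbl hf, rank_of_first fun u hu => (hf u hu).le]
    have h₁ := h b hb
    have h₂ := rank_of_last hb hbl
    have h₃ := Finset.mem_range.1 (hK hb)
    have h₄ := hf b hb
    simp only [Nat.even_iff] at *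
    omega
  · push Not at hf
    obtain ⟨u, hu, huv⟩ := hf
    obtain ⟨p, hp, hp'⟩ := (K.filter (· ≤ v)).exists_max_image id
      ⟨u, Finset.mem_filter.2 ⟨hu, huv⟩⟩
    obtain ⟨hp, hpv⟩ := Finset.mem_filter.1 hp
    have hpv : p < v := lt_of_le_of_ne hpv fun e => hvK (e ▸ hp)
    have hn : ∀ u ∈ K, p < u → v ≤ u := fun u hu hpu => by
      by_contra! hlt
      have : u ≤ p := hp' u (Finset.mem_filter.2 ⟨hu, hlt.le⟩)
      omega
    have h₁ := h p hp
    rw [stepsBack_of_prev hK hv hp hpv hn, rank_of_next hp hpv hn]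
    simp only [Nat.even_iff] at *
    omega

theorem fProd_onCircle {K : Finset ℕ} (hK : K ⊆ Finset.range (l + 1)) :
    fProd (onCircle l K) = ∏ v ∈ K, pf (v : ZMod (l + 1)) := by
  rw [fProd, onCircle, Finset.prod_image fun a ha b hb h => natCast_inj_of_lt
    (Finset.mem_range.1 (hK ha)) (Finset.mem_range.1 (hK hb)) h]

theorem χCompl_onCircle {K : Finset ℕ} (hK : K ⊆ Finset.range (l + 1)) {ε : ℕ}
    (hne : K.Nonempty) (hpar : Even (K.card + (l + 1)))
    (h : IsAlt ε K) : χCompl (onCircle l K) = ∑ v ∈ Finset.range (l + 1) \ K,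
      (-1) ^ (v + rank K v + ε) * ϖ (v : ZMod (l + 1)) := by
  have e : (onCircle l K)ᶜ = onCircle l (Finset.range (l + 1) \ K) := by
    ext x
    obtain ⟨n, hn, rfl⟩ : ∃ n < l + 1, (n : ZMod (l + 1)) = x :=
      ⟨x.val, ZMod.val_lt x, ZMod.natCast_zmod_val x⟩
    rw [Finset.mem_compl, mem_onCircle hK hn, mem_onCircle Finset.sdiff_subset hn,
      Finset.mem_sdiff, Finset.mem_range]
    exact (and_iff_right hn).symm
  rw [χCompl, e]
  conv_lhs => rw [onCircle]
  rw [Finset.sum_image fun a ha b hb h => natCast_inj_of_lt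
    (Finset.mem_range.1 (Finset.mem_sdiff.1 ha).1) (Finset.mem_range.1 (Finset.mem_sdiff.1 hb).1) h]
  refine Finset.sum_congr rfl fun v hv => ?_
  obtain ⟨h₁, h₂⟩ := Finset.mem_sdiff.1 hv
  rw [neg_one_pow_stepsBack hK hne hpar h (Finset.mem_range.1 h₁) h₂]

theorem card_onCircle {K : Finset ℕ} (hK : K ⊆ Finset.range (l + 1)) :
    (onCircle l K).card = K.card :=
  Finset.card_image_of_injOn fun _ ha _ hb h => natCast_inj_of_lt
    (Finset.mem_range.1 (hK ha)) (Finset.mem_range.1 (hK hb)) h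

/-- A sum over `S_d`, with the sets sorted by the parity of their smallest element. -/
theorem sum_S (G : Finset (ZMod (l + 1)) → Poly l) {d : ℕ} (hd : 0 < d)
    (hpar : Even (d + (l + 1))) : ∑ K ∈ S l d, G K =
      (∑ K ∈ altSets 0 d (l + 1), G (onCircle l K)) +
        ∑ K ∈ altSets 1 d (l + 1), G (onCircle l K) := by
  have hdisj : Disjoint (altSets 0 d (l + 1)) (altSets 1 d (l + 1)) := by
    rw [Finset.disjoint_left]
    intro K h₀ h₁
    obtain ⟨h, h₀⟩ := Finset.mem_filter.1 h₀
    obtain ⟨v, hv⟩ := Finset.card_pos.1 (hd.trans_eq (Finset.mem_powersetCard.1 h).2.symm)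
    have e₀ := h₀ v hv
    have e₁ := (Finset.mem_filter.1 h₁).2 v hv
    rw [Nat.even_iff] at e₀ e₁
    omega
  rw [← Finset.sum_union hdisj]
  symm
  have mem : ∀ K, K ∈ altSets 0 d (l + 1) ∪ altSets 1 d (l + 1) ↔
      (K ⊆ Finset.range (l + 1) ∧ K.card = d) ∧ (IsAlt 0 K ∨ IsAlt 1 K) := fun K => by
    simp only [altSets, Finset.mem_union, Finset.mem_filter, Finset.mem_powersetCard, ← and_or_left]
  have memS : ∀ K, K ⊆ Finset.range (l + 1) → K.card = d →
      (onCircle l K ∈ S l d ↔ IsAlt 0 K ∨ IsAlt 1 K) := fun K hK hc => by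
    rw [S, Finset.mem_filter, Finset.mem_powersetCard, card_onCircle hK,
      forall_odd_stepsForward_iff hK (Finset.card_pos.1 (by omega)) (by rwa [hc])]
    simp [hc]
  refine Finset.sum_bij (fun K _ => onCircle l K) ?_ ?_ ?_ fun _ _ => rfl
  · intro K hK
    obtain ⟨⟨h₁, h₂⟩, h₃⟩ := (mem K).1 hK
    exact (memS K h₁ h₂).2 h₃
  · intro K hK K' hK' h
    have h₁ := ((mem K).1 hK).1.1
    have h₂ := ((mem K').1 hK').1.1
    ext n
    by_cases hn : n < l + 1
    · rw [← mem_onCircle h₁ hn, ← mem_onCircle h₂ hn]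
      exact iff_of_eq (congrArg (_ ∈ ·) h)
    · exact iff_of_false (fun h => hn (Finset.mem_range.1 (h₁ h)))
        fun h => hn (Finset.mem_range.1 (h₂ h))
  · intro K hK
    have e : onCircle l (K.image fun x : ZMod (l + 1) => x.val) = K := by
      rw [onCircle, Finset.image_image]
      simp [Function.comp_def]
    have h₁ : (K.image fun x : ZMod (l + 1) => x.val) ⊆ Finset.range (l + 1) := by
      intro n hn
      obtain ⟨x, -, rfl⟩ := Finset.mem_image.1 hn
      exact Finset.mem_range.2 (ZMod.val_lt x)
    have h₂ : (K.image fun x : ZMod (l + 1) => x.val).card = d := by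
      rw [← card_onCircle h₁, e]
      exact (Finset.mem_powersetCard.1 (Finset.mem_filter.1 hK).1).2
    refine ⟨K.image (fun x : ZMod (l + 1) => x.val), (mem _).2 ⟨⟨h₁, h₂⟩, (memS _ h₁ h₂).1 ?_⟩, e⟩
    rwa [e]

theorem sum_S_fProd {d : ℕ} (hd : 0 < d) (hpar : Even (d + (l + 1))) :
    ∑ K ∈ S l d, fProd K = altSum (fun j => pf (j : ZMod (l + 1))) 0 d (l + 1) +
      altSum (fun j => pf (j : ZMod (l + 1))) 1 d (l + 1) := by
  rw [sum_S _ hd hpar]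
  refine congrArg₂ _ (Finset.sum_congr rfl fun K hK => ?_) (Finset.sum_congr rfl fun K hK => ?_) <;>
    exact fProd_onCircle (Finset.mem_powersetCard.1 (Finset.mem_filter.1 hK).1).1

theorem sum_S_χCompl {d : ℕ} (hd : 0 < d) (hpar : Even (d + (l + 1))) :
    ∑ K ∈ S l d, χCompl K * fProd K =
      altWeightSum (fun j => pf (j : ZMod (l + 1))) (fun j => ϖ (j : ZMod (l + 1))) 0 d (l + 1) +
      altWeightSum (fun j => pf (j : ZMod (l + 1))) (fun j => ϖ (j : ZMod (l + 1)))
        1 d (l + 1) := by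
  rw [sum_S _ hd hpar]
  refine congrArg₂ _ (Finset.sum_congr rfl fun K hK => ?_) (Finset.sum_congr rfl fun K hK => ?_)
  all_goals
    obtain ⟨hK, halt⟩ := Finset.mem_filter.1 hK
    obtain ⟨hK, hc⟩ := Finset.mem_powersetCard.1 hK
    rw [fProd_onCircle hK, χCompl_onCircle hK (Finset.card_pos.1 (by omega)) (by rwa [hc]) halt]

end Circle

/-! ### Cyclic continuants -/

section CyclicContinuants

open Polynomial

variable {R : Type*} [CommRing R] {l : ℕ}

/-- The cyclic continuant: the trace of the product of the transfer matrices around the circle. -/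
def cycTrace (u w : ZMod (l + 1) → R) : R[X] :=
  (chain (fun m => u (m : ZMod (l + 1))) (fun m => w (m : ZMod (l + 1))) (l + 1)).trace

theorem cycTrace_shift (u w : ZMod (l + 1) → R) (b : ZMod (l + 1)) :
    cycTrace (fun j => u (j + b)) (fun j => w (j + b)) = cycTrace u w := by
  obtain ⟨n, rfl⟩ : ∃ n : ℕ, (n : ZMod (l + 1)) = b := ⟨b.val, ZMod.natCast_zmod_val b⟩
  induction n with
  | zero => simp
  | succ n ih =>
    rw [← ih]
    refine Eq.trans ?_ (trace_chain_shift ?_ ?_)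
    · have e : ∀ j : ℕ, (j : ZMod (l + 1)) + ((n + 1 : ℕ) : ZMod (l + 1)) =
          ((j + 1 : ℕ) : ZMod (l + 1)) + n := fun j => by push_cast; ring
      simp only [cycTrace, e]
    · simp
    · simp

theorem map_cycTrace {S : Type*} [CommRing S] (φ : R →+* S) (u w : ZMod (l + 1) → R) :
    (cycTrace u w).map φ = cycTrace (fun j => φ (u j)) (fun j => φ (w j)) :=
  map_trace_chain φ _ _ _

/-- The reflection symmetry at the node `i` of the circle. -/
theorem cycTrace_reflect (hl : 2 ≤ l) {u w u' w' : ZMod (l + 1) → R} {i : ZMod (l + 1)} {x : R}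
    (hx : w i - w (i - 1) = x * u i)
    (hu₀ : u' (i - 1) = u (i - 1) - x) (hu₁ : u' (i + 1) = u (i + 1) + x)
    (hu : ∀ j, j ≠ i - 1 → j ≠ i + 1 → u' j = u j)
    (hw₀ : w' (i - 1) = w i) (hw₁ : w' i = w (i - 1))
    (hw : ∀ j, j ≠ i - 1 → j ≠ i → w' j = w j) : cycTrace u' w' = cycTrace u w := by
  rw [← cycTrace_shift u' w' (i - 1), ← cycTrace_shift u w (i - 1), cycTrace, cycTrace]
  have e₀ : ((0 : ℕ) : ZMod (l + 1)) + (i - 1) = i - 1 := by simp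
  have e₁ : ((0 + 1 : ℕ) : ZMod (l + 1)) + (i - 1) = i := by simp
  have e₂ : ((0 + 2 : ℕ) : ZMod (l + 1)) + (i - 1) = i + 1 := by push_cast; ring
  have ne : ∀ m < l + 1, ∀ n < l + 1, m ≠ n →
      (m : ZMod (l + 1)) + (i - 1) ≠ (n : ZMod (l + 1)) + (i - 1) := fun m hm n hn h h' =>
    h (natCast_inj_of_lt hm hn (add_right_cancel h'))
  congr 1
  refine chain_reflect (i := 0) (x := x) (by omega) ?_ ?_ ?_ ?_ ?_ ?_ ?_
  · rw [e₀, e₁, hx]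
  · rw [e₀, hu₀]
  · rw [e₂, hu₁]
  · intro j hj h₀ h₂
    refine hu _ ?_ ?_
    · exact fun h => ne _ hj _ (by omega) h₀ (h.trans e₀.symm)
    · exact fun h => ne _ hj _ (by omega) h₂ (h.trans e₂.symm)
  · rw [e₀, e₁, hw₀]
  · rw [e₀, e₁, hw₁]
  · intro j hj h₀ h₁
    refine hw _ ?_ ?_
    · exact fun h => ne _ hj _ (by omega) h₀ (h.trans e₀.symm)
    · exact fun h => ne _ hj _ (by omega) h₁ (h.trans e₁.symm)

/-- The cyclic continuant is affine in the weight of the last edge. -/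
theorem cycTrace_update (u w : ZMod (l + 1) → R) (a : R) :
    cycTrace u (fun j => w j + if j = (l : ZMod (l + 1)) then a else 0) = cycTrace u w +
      X ^ 2 * C a *
        chain (fun m => u (m : ZMod (l + 1))) (fun m => w (m : ZMod (l + 1))) l 1 0 := by
  have e : chain (fun m => u (m : ZMod (l + 1)))
      (fun m => w (m : ZMod (l + 1)) + if (m : ZMod (l + 1)) = (l : ZMod (l + 1)) then a else 0) l =
      chain (fun m => u (m : ZMod (l + 1))) (fun m => w (m : ZMod (l + 1))) l := by
    refine chain_congr (fun _ _ => rfl) fun m hm => ?_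
    rw [if_neg fun h => hm.ne (natCast_inj_of_lt (by omega) (by omega) h), add_zero]
  rw [cycTrace, cycTrace, trace_chain_succ, trace_chain_succ, chain_succ_zero, chain_succ_zero, e]
  simp only [if_true, C_add]
  ring

/-- The effect on the coefficients of a trace of adding a constant to all edge weights, for an odd
number of nodes. -/
theorem coeff_trace_add_of_odd (n : ℕ) (f c : ℕ → R) (δ : R) :
    (chain f (fun m => c m + δ) (2 * n + 3)).trace.coeff 1 =
      (chain f c (2 * n + 3)).trace.coeff 1 ∧
    (chain f (fun m => c m + δ) (2 * n + 3)).trace.coeff 3 =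
      (chain f c (2 * n + 3)).trace.coeff 3 +
        (n + 1) * δ * (chain f c (2 * n + 3)).trace.coeff 1 := by
  have hp := isContinuant_zero f c
  have hq := isContinuant_one f c
  have hp' := isContinuant_zero f (fun m => c m + δ)
  have hq' := isContinuant_one f (fun m => c m + δ)
  have p₁ := (hp'.coeff_one (n + 1)).trans (hp.coeff_one (n + 1)).symm
  have q₁ := (hq'.coeff_one n).trans (hq.coeff_one n).symm
  have p₃ := (hp.coeff_shift hp' (fun _ => rfl) (n + 1)).2.1
  have q₃ := (hq.coeff_shift hq' (fun _ => rfl) n).2.1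
  rw [show 0 + 2 * (n + 1) + 1 = 2 * n + 3 by ring] at p₁ p₃
  rw [show 1 + 2 * n + 1 = 2 * n + 2 by ring] at q₁ q₃
  constructor
  · rw [trace_chain_succ, trace_chain_succ, coeff_add, coeff_add,
      coeff_one_add_mul_one, coeff_one_add_mul_one, p₁, q₁]
  · rw [trace_chain_succ, trace_chain_succ, coeff_add, coeff_add,
      coeff_add, coeff_one_add_mul _ _ 1, coeff_one_add_mul _ _ 1, coeff_one_add_mul_one,
      p₃, q₃, q₁]
    push_cast
    ring

/-- The effect on the coefficients of a trace of adding a constant to all edge weights, for an even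
number of nodes. -/
theorem coeff_trace_add_of_even (n : ℕ) (f c : ℕ → R) (δ : R) :
    (chain f (fun m => c m + δ) (2 * n + 2)).trace.coeff 2 =
      (chain f c (2 * n + 2)).trace.coeff 2 + 2 * (n + 1) * δ ∧
    2 * (chain f (fun m => c m + δ) (2 * n + 2)).trace.coeff 4 =
      2 * (chain f c (2 * n + 2)).trace.coeff 4 +
        2 * n * δ * (chain f c (2 * n + 2)).trace.coeff 2 + 2 * n * (n + 1) * δ ^ 2 := by
  have hp := isContinuant_zero f c
  have hq := isContinuant_one f c
  have hp' := isContinuant_zero f (fun m => c m + δ)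
  have hq' := isContinuant_one f (fun m => c m + δ)
  have q₀ := hq.coeff_zero n
  have q₀' := hq'.coeff_zero n
  obtain ⟨p₂, -, p₄⟩ := hp.coeff_shift hp' (fun _ => rfl) (n + 1)
  obtain ⟨q₂, -, q₄⟩ := hq.coeff_shift hq' (fun _ => rfl) n
  rw [show 0 + 2 * (n + 1) = 2 * n + 2 by ring] at p₂ p₄
  rw [show 1 + 2 * n = 2 * n + 1 by ring] at q₀ q₀' q₂ q₄
  constructor
  · rw [trace_chain_succ, trace_chain_succ, coeff_add, coeff_add,
      coeff_one_add_mul _ _ 0, coeff_one_add_mul _ _ 0, q₀, q₀', p₂, q₂]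
    push_cast
    ring
  · rw [trace_chain_succ, trace_chain_succ, coeff_add, coeff_add, coeff_add,
      coeff_one_add_mul _ _ 2, coeff_one_add_mul _ _ 2, coeff_one_add_mul _ _ 0, q₀, q₂]
    push_cast at p₄
    linear_combination p₄ + q₄

/-- The number of nodes being odd, the third coefficient is the Hamiltonian. -/
theorem coeff_three_trace {n : ℕ} (f ϖ : ℕ → R) (h0 : ϖ 0 = 0) (hN : ϖ (2 * n + 3) = 0) :
    (chain f (fun j => ϖ j - ϖ (j + 1)) (2 * n + 3)).trace.coeff 3 =
      (altSum f 0 3 (2 * n + 3) + altSum f 1 3 (2 * n + 3)) +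
        (altWeightSum f ϖ 0 1 (2 * n + 3) + altWeightSum f ϖ 1 1 (2 * n + 3)) := by
  have p := (isContinuant_zero f _).coeff_eq_altSum zero_le_one h0 (n + 1)
  have q := (isContinuant_one f _).coeff_eq_altSum le_rfl h0 n
  rw [show 0 + 2 * (n + 1) + 1 = 2 * n + 3 by ring] at p
  rw [show 1 + 2 * n + 1 = 2 * n + 2 by ring] at q
  rw [trace_chain_succ, coeff_add, coeff_one_add_mul _ _ 1, p.2.2.1, q.2.2.1, q.1, hN,
    altSum_succ_of_odd f (ε := 1) (d := 2) (m := 2 * n + 2) (by grind),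
    altWeightSum_succ_of_odd f ϖ (ε := 1) (d := 0) (m := 2 * n + 2) (by grind)]
  ring

theorem sum_range_even_add_odd {M : Type*} [AddCommMonoid M] (g : ℕ → M) (n : ℕ) :
    ∑ j ∈ Finset.range (2 * n), g j =
      ∑ j ∈ Finset.range n, g (2 * j) + ∑ j ∈ Finset.range n, g (2 * j + 1) := by
  induction n with
  | zero => simp
  | succ n ih =>
    rw [mul_add_one, Finset.sum_range_succ, Finset.sum_range_succ, ih, Finset.sum_range_succ,
      Finset.sum_range_succ]
    abel

theorem altWeightSum_one_zero (f ϖ : ℕ → R) (m : ℕ) :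
    altWeightSum f ϖ 1 0 m = -altWeightSum f ϖ 0 0 m := by
  induction m with
  | zero => simp [altWeightSum_at_zero]
  | succ m ih =>
    rw [altWeightSum_zero_succ, altWeightSum_zero_succ, ih]
    ring

/-- The number of nodes being even, the fourth coefficient is the Hamiltonian, up to the sum of the
squares of the edge weights. -/
theorem coeff_four_trace {n : ℕ} (f ϖ : ℕ → R) (h0 : ϖ 0 = 0) (hN : ϖ (2 * n + 2) = 0) :
    2 * (chain f (fun j => ϖ j - ϖ (j + 1)) (2 * n + 2)).trace.coeff 4 +
        ∑ j ∈ Finset.range (2 * n + 2), (ϖ j - ϖ (j + 1)) ^ 2 =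
      2 * ((altSum f 0 4 (2 * n + 2) + altSum f 1 4 (2 * n + 2)) +
        (altWeightSum f ϖ 0 2 (2 * n + 2) + altWeightSum f ϖ 1 2 (2 * n + 2)) +
          altWeightSum f ϖ 0 0 (2 * n + 2) ^ 2) := by
  have p := ((isContinuant_zero f _).coeff_eq_altSum zero_le_one h0 (n + 1)).2.2.2
  have q := (isContinuant_one f _).coeff_eq_altSum le_rfl h0 n
  have hw : altWeightSum f ϖ 0 0 (2 * n + 2) =
      -(altWeightSum f ϖ 1 0 (2 * n + 1) + ϖ (2 * n + 1)) := by
    rw [← altWeightSum_zero_succ_of_even _ _ (by grind), altWeightSum_one_zero, neg_neg]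
  rw [show 2 * n + 2 = 2 * (n + 1) by ring, sum_range_even_add_odd,
    Finset.sum_range_succ (fun j => (ϖ (2 * j + 1) - ϖ (2 * j + 1 + 1)) ^ 2) n,
    ← show 2 * n + 2 = 2 * (n + 1) by ring]
  simp only [zero_add] at p
  rw [← show 2 * n + 2 = 2 * (n + 1) by ring] at p
  rw [show 1 + 2 * n = 2 * n + 1 by ring] at q
  have q₄ := q.2.2.2
  rw [trace_chain_succ, coeff_add, coeff_one_add_mul _ _ 2, mul_add, p, q.2.1, hN,
    altSum_succ_of_odd f (ε := 1) (d := 3) (m := 2 * n + 1) (by grind),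
    altWeightSum_succ_of_odd f ϖ (ε := 1) (d := 1) (m := 2 * n + 1) (by grind), hw]
  simp only [add_comm 1] at q₄ ⊢
  linear_combination q₄

end CyclicContinuants

/-! ### The edge weights `ϖ_j - ϖ_{j+1}` -/

section EdgeWeights

variable {l : ℕ}

/-- The weight `c_j = ϖ_j - ϖ_{j+1}` of the edge from `j` to `j + 1`. -/
def edge (j : ZMod (l + 1)) : RatField l := toField (ϖ j - ϖ (j + 1))

theorem toField_add (p q : Poly l) : toField (p + q) = toField p + toField q := map_add _ _ _

theorem toField_sub (p q : Poly l) : toField (p - q) = toField p - toField q := map_sub _ _ _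

theorem toField_mul (p q : Poly l) : toField (p * q) = toField p * toField q := map_mul _ _ _

theorem toField_sum {ι : Type*} (s : Finset ι) (p : ι → Poly l) :
    toField (∑ i ∈ s, p i) = ∑ i ∈ s, toField (p i) :=
  map_sum (algebraMap (Poly l) (RatField l)) _ _

/-- The formula for `ϖ_i` gives zero at `i = l + 1` too, so it may be used for `i ≤ l + 1`. -/
theorem ϖ_natCast {i : ℕ} (hi : i ≤ l + 1) : (ϖ (i : ZMod (l + 1)) : Poly l) =
    ∑ r ∈ Finset.Icc 1 l, MvPolynomial.C (((min i r : ℕ) : ℂ) - (i : ℂ) * (r : ℂ) / ((l : ℂ) + 1))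
      * pα (r : ZMod (l + 1)) := by
  rcases hi.lt_or_eq with h | rfl
  · rw [ϖ, ZMod.val_cast_of_lt h]
  · rw [ϖ, ZMod.natCast_self, ZMod.val_zero]
    refine Finset.sum_congr rfl fun r hr => ?_
    have hr' : r ≤ l + 1 := by have := (Finset.mem_Icc.1 hr).2; omega
    have hl : (l : ℂ) + 1 ≠ 0 := Nat.cast_add_one_ne_zero l
    rw [min_eq_left (Nat.zero_le r), min_eq_right hr']
    congr 2
    push_cast
    field_simp
    ring

theorem ϖ_zero : (ϖ 0 : Poly l) = 0 := by
  rw [ϖ, ZMod.val_zero]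
  exact Finset.sum_eq_zero fun r _ => by simp

theorem ϖ_second_difference {i : ℕ} (hi : i < l) :
    2 * ϖ ((i + 1 : ℕ) : ZMod (l + 1)) - ϖ (i : ZMod (l + 1)) - ϖ ((i + 2 : ℕ) : ZMod (l + 1)) =
      (pα ((i + 1 : ℕ) : ZMod (l + 1)) : Poly l) := by
  rw [ϖ_natCast (by omega), ϖ_natCast (by omega), ϖ_natCast (by omega), Finset.mul_sum,
    ← Finset.sum_sub_distrib, ← Finset.sum_sub_distrib,
    Finset.sum_eq_single_of_mem (i + 1) (by simp; omega)]
  · rw [min_self, min_eq_left (by omega), min_eq_right (by omega)]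
    rw [show (2 : Poly l) = MvPolynomial.C 2 from (map_ofNat _ 2).symm, ← mul_assoc, ← map_mul,
      ← sub_mul, ← sub_mul, ← map_sub, ← map_sub]
    convert one_mul _
    rw [← map_one MvPolynomial.C]
    congr 1
    push_cast
    ring
  · intro r _ hr
    have hmin : 2 * ((min (i + 1) r : ℕ) : ℂ) - ((min i r : ℕ) : ℂ) -
        ((min (i + 2) r : ℕ) : ℂ) = 0 := by
      have : 2 * min (i + 1) r = min i r + min (i + 2) r := by omega
      have := congrArg (Nat.cast : ℕ → ℂ) this
      push_cast at this ⊢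
      linear_combination this
    rw [show (2 : Poly l) = MvPolynomial.C 2 from (map_ofNat _ 2).symm, ← mul_assoc, ← map_mul,
      ← sub_mul, ← sub_mul, ← map_sub, ← map_sub]
    convert zero_mul _
    rw [← map_zero MvPolynomial.C]
    congr 1
    push_cast at hmin ⊢
    linear_combination hmin

theorem edge_sub_edge {j : ZMod (l + 1)} (hj : j ≠ 0) : edge j - edge (j - 1) = α j := by
  obtain ⟨n, hn, rfl⟩ : ∃ n < l + 1, (n : ZMod (l + 1)) = j :=
    ⟨j.val, ZMod.val_lt j, ZMod.natCast_zmod_val j⟩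
  obtain ⟨i, rfl⟩ : ∃ i, n = i + 1 := Nat.exists_eq_succ_of_ne_zero (by rintro rfl; simp at hj)
  have h := ϖ_second_difference (l := l) (i := i) (by omega)
  have e₁ : ((i + 1 : ℕ) : ZMod (l + 1)) - 1 = i := by push_cast; ring
  have e₂ : ((i + 1 : ℕ) : ZMod (l + 1)) + 1 = ((i + 2 : ℕ) : ZMod (l + 1)) := by push_cast; ring
  have e₃ : (i : ZMod (l + 1)) + 1 = ((i + 1 : ℕ) : ZMod (l + 1)) := by push_cast; ring
  rw [edge, edge, α, e₁, e₂, e₃, ← h, ← toField_sub, two_mul]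
  refine congrArg toField ?_
  abel

theorem sum_comp_add_one {M : Type*} [AddCommMonoid M] (u : ZMod (l + 1) → M) :
    ∑ j, u (j + 1) = ∑ j, u j := Equiv.sum_comp (Equiv.addRight 1) u

theorem sum_edge : ∑ j : ZMod (l + 1), edge j = 0 := by
  have h : ∑ j : ZMod (l + 1), (ϖ j - ϖ (j + 1) : Poly l) = 0 := by
    rw [Finset.sum_sub_distrib, sum_comp_add_one, sub_self]
  exact (toField_sum _ _).symm.trans ((congrArg toField h).trans (map_zero _))

/-- Functions on the circle are determined by their differences away from `0` and their sum. -/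
theorem eq_of_differences {M : Type*} [Field M] [CharZero M] {u v : ZMod (l + 1) → M}
    (hd : ∀ j, j ≠ 0 → u j - u (j - 1) = v j - v (j - 1)) (hs : ∑ j, u j = ∑ j, v j) : u = v := by
  have key : ∀ n : ℕ, n < l + 1 → u n - v n = u 0 - v 0 := by
    intro n
    induction n with
    | zero => simp
    | succ n ih =>
      intro hn
      have h := hd ((n + 1 : ℕ) : ZMod (l + 1)) (natCast_ne_zero (by omega) hn)
      rw [show ((n + 1 : ℕ) : ZMod (l + 1)) - 1 = n by push_cast; ring] at h
      rw [← ih (by omega)]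
      linear_combination h
  have key' : ∀ j, u j - v j = u 0 - v 0 := fun j => by
    simpa using key j.val (ZMod.val_lt j)
  have h0 : ((l + 1 : ℕ) : M) * (u 0 - v 0) = 0 := by
    rw [← sub_eq_zero, ← Finset.sum_sub_distrib, Finset.sum_congr rfl fun j _ => key' j] at hs
    rw [Finset.sum_const, Finset.card_univ, ZMod.card, nsmul_eq_mul] at hs
    exact hs
  have h1 : u 0 - v 0 = 0 := by
    rcases mul_eq_zero.1 h0 with h | h
    · exact absurd h (Nat.cast_ne_zero.2 l.succ_ne_zero)
    · exact h
  funext j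
  have := key' j
  rw [h1] at this
  exact sub_eq_zero.1 this

/-- At the node `0` the second difference of `ϖ` is `α_0 - k`, as all of them sum up to zero. -/
theorem edge_zero_sub : edge (0 : ZMod (l + 1)) - edge (-1) = α 0 - k l := by
  have h : ∑ j : ZMod (l + 1), (edge j - edge (j - 1) - α j) = -k l := by
    rw [Finset.sum_sub_distrib, Finset.sum_sub_distrib,
      show ∑ j : ZMod (l + 1), edge (j - 1) = ∑ j : ZMod (l + 1), edge j from
        Equiv.sum_comp (Equiv.subRight 1) edge, sub_self, zero_sub, k_eq_sum]
  rw [Finset.sum_eq_single_of_mem 0 (Finset.mem_univ _) fun j _ hj => by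
    rw [edge_sub_edge hj, sub_self], zero_sub] at h
  linear_combination h

theorem edge_increment_eq_neg_cartan (hl : 2 ≤ l) (i j : ZMod (l + 1)) :
    ((if j = i - 1 then 1 else 0) - (if j = i then 1 else 0) -
      ((if j - 1 = i - 1 then 1 else 0) - if j - 1 = i then 1 else 0) : ℤ) = -cartan i j := by
  have h₁ := add_one_ne hl i
  have h₂ := sub_one_ne hl i
  have h₃ := add_one_ne_sub_one hl i
  simp only [sub_eq_iff_eq_add, cartan]
  by_cases e₀ : j = i
  · subst e₀
    simp [h₁.symm, h₂.symm]
  by_cases e₁ : j = i + 1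
  · simp [e₁, h₃, h₁]
  by_cases e₂ : j = i - 1
  · simp [e₂, h₂, h₃.symm]
  · simp [e₀, e₁, e₂]

theorem IsRefl.map_k (hl : 2 ≤ l) {i : ZMod (l + 1)} {φ : RatField l ≃ₐ[ℂ] RatField l}
    (h : IsRefl i φ) : φ (k l) = k l := by
  have hs : ∑ j : ZMod (l + 1), cartan i j = 0 := by
    rw [← neg_eq_zero, ← Finset.sum_neg_distrib,
      ← Finset.sum_congr rfl fun j _ => edge_increment_eq_neg_cartan hl i j,
      Finset.sum_sub_distrib, sub_eq_zero]
    exact (Equiv.sum_comp (Equiv.subRight (1 : ZMod (l + 1)))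
      fun j => (if j = i - 1 then 1 else 0) - (if j = i then 1 else 0 : ℤ)).symm
  rw [k_eq_sum, map_sum, Finset.sum_congr rfl fun j _ => h.map_alpha j, Finset.sum_sub_distrib,
    ← Finset.sum_mul, ← Int.cast_sum, hs]
  simp

/-- The reflection `s_i` moves `α_i` from the edge `i` to the edge `i - 1`. For `i ≠ 0` it thus
exchanges the weights of the two edges at `i`. -/
theorem IsRefl.map_edge (hl : 2 ≤ l) {i : ZMod (l + 1)} {φ : RatField l ≃ₐ[ℂ] RatField l}
    (h : IsRefl i φ) (j : ZMod (l + 1)) : φ (edge j) =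
      edge j + ((if j = i - 1 then 1 else 0) - (if j = i then 1 else 0) : ℤ) * α i := by
  refine congrFun (eq_of_differences (u := fun j => φ (edge j)) (v := fun j =>
    edge j + ((if j = i - 1 then 1 else 0) - (if j = i then 1 else 0) : ℤ) * α i) ?_ ?_) j
  · intro j hj
    rw [← map_sub, edge_sub_edge hj, h.map_alpha]
    have e := congrArg (Int.cast : ℤ → RatField l) (edge_increment_eq_neg_cartan hl i j)
    rw [Int.cast_sub, Int.cast_neg] at e
    linear_combination -α i * e - edge_sub_edge hj
  · rw [← map_sum, Finset.sum_add_distrib, sum_edge, map_zero, ← Finset.sum_mul, ← Int.cast_sum,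
      Finset.sum_sub_distrib]
    simp

theorem IsRot.map_k {φ : RatField l ≃ₐ[ℂ] RatField l} (h : IsRot φ) : φ (k l) = k l := by
  rw [k_eq_sum, map_sum, Finset.sum_congr rfl fun j _ => h.map_alpha j, sum_comp_add_one]

/-- The edge weights are rotated up to the defect `k` at the edge between `l` and `0`, and a
constant which keeps their sum zero. -/
theorem IsRot.map_edge {φ : RatField l ≃ₐ[ℂ] RatField l} (h : IsRot φ) (j : ZMod (l + 1)) :
    φ (edge j) = (edge (j + 1) + if j = (l : ZMod (l + 1)) then k l else 0) +
      -k l / ((l + 1 : ℕ) : RatField l) := by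
  have hl1 : ((l : ℕ) : ZMod (l + 1)) = -1 := by
    rw [eq_neg_iff_add_eq_zero, ← Nat.cast_add_one, ZMod.natCast_self]
  refine congrFun (eq_of_differences (u := fun j => φ (edge j)) (v := fun j =>
    (edge (j + 1) + if j = (l : ZMod (l + 1)) then k l else 0) +
      -k l / ((l + 1 : ℕ) : RatField l)) ?_ ?_) j
  · intro j hj
    rw [← map_sub, edge_sub_edge hj, h.map_alpha, hl1, sub_add_cancel,
      if_neg (show ¬j - 1 = -1 from fun e => hj (by rw [← sub_add_cancel j 1, e, neg_add_cancel]))]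
    by_cases e : j = -1
    · subst e
      have := edge_zero_sub (l := l)
      rw [neg_add_cancel, if_pos rfl]
      linear_combination -this
    · have := edge_sub_edge (l := l) (j := j + 1) fun e' => e (eq_neg_of_add_eq_zero_left e')
      rw [add_sub_cancel_right] at this
      rw [if_neg e]
      linear_combination -this
  · have hN : ((l + 1 : ℕ) : RatField l) ≠ 0 := Nat.cast_ne_zero.2 l.succ_ne_zero
    rw [← map_sum, Finset.sum_add_distrib, Finset.sum_add_distrib, sum_comp_add_one, sum_edge,
      map_zero, Finset.sum_const, Finset.card_univ, ZMod.card, nsmul_eq_mul, mul_div_cancel₀ _ hN]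
    simp

end EdgeWeights

/-! ### The system in terms of the differences of the Hamiltonians -/

section Differences

variable {l : ℕ}

theorem natCast_self_eq_neg_one : ((l : ℕ) : ZMod (l + 1)) = -1 := by
  rw [eq_neg_iff_add_eq_zero, ← Nat.cast_add_one, ZMod.natCast_self]

theorem orient_add_natCast (hl : 2 ≤ l) (i : ZMod (l + 1)) {m : ℕ} (hm : m < l + 1) :
    orient i (i + (m : ZMod (l + 1))) = if m = 1 then 1 else if m = l then -1 else 0 := by
  have h₁ : i + (m : ZMod (l + 1)) = i + 1 ↔ m = 1 := by
    rw [add_right_inj]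
    exact ⟨fun h => natCast_inj_of_lt hm (by omega) (h.trans Nat.cast_one.symm),
      by rintro rfl; simp⟩
  have h₂ : i + (m : ZMod (l + 1)) = i - 1 ↔ m = l := by
    rw [sub_eq_add_neg, add_right_inj, ← natCast_self_eq_neg_one]
    exact ⟨fun h => natCast_inj_of_lt hm (by omega) h, by rintro rfl; rfl⟩
  simp only [orient, h₁, h₂]

theorem cartan_add_natCast (hl : 2 ≤ l) (i : ZMod (l + 1)) {m : ℕ} (hm : m < l + 1) :
    cartan i (i + (m : ZMod (l + 1))) = if m = 0 then 2 else if m = 1 ∨ m = l then -1 else 0 := by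
  have h₀ : i + (m : ZMod (l + 1)) = i ↔ m = 0 := by
    rw [add_eq_left]
    exact ⟨fun h => natCast_inj_of_lt hm (by omega) (h.trans Nat.cast_zero.symm),
      by rintro rfl; simp⟩
  have h₁ : i + (m : ZMod (l + 1)) = i + 1 ↔ m = 1 := by
    rw [add_right_inj]
    exact ⟨fun h => natCast_inj_of_lt hm (by omega) (h.trans Nat.cast_one.symm),
      by rintro rfl; simp⟩
  have h₂ : i + (m : ZMod (l + 1)) = i - 1 ↔ m = l := by
    rw [sub_eq_add_neg, add_right_inj, ← natCast_self_eq_neg_one]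
    exact ⟨fun h => natCast_inj_of_lt hm (by omega) h, by rintro rfl; rfl⟩
  simp only [cartan, h₀, h₁, h₂]

theorem sum_Icc_one {M : Type*} [AddCommMonoid M] (g : ℕ → M) (n : ℕ) :
    ∑ r ∈ Finset.Icc 1 n, g r = ∑ r ∈ Finset.range n, g (r + 1) := by
  induction n with
  | zero => simp
  | succ n ih => rw [Finset.sum_Icc_succ_top (by omega), ih, Finset.sum_range_succ]

/-- The terms `1 ≤ r ≤ s ≤ m` and `2 ≤ r ≤ s ≤ m + 1` of a double sum differ by a row and a
column. -/
theorem sum_triangle_sub {R : Type*} [CommRing R] (a b : ℕ → R) (m : ℕ) :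
    ∑ s ∈ Finset.Icc 1 m, ∑ r ∈ Finset.Icc 1 s, a r * b s -
        ∑ s ∈ Finset.Icc 1 m, ∑ r ∈ Finset.Icc 1 s, a (r + 1) * b (s + 1) =
      a 1 * ∑ s ∈ Finset.Icc 1 m, b s - b (m + 1) * ∑ r ∈ Finset.Icc 1 m, a (r + 1) := by
  simp only [← Finset.sum_mul, sum_Icc_one]
  induction m with
  | zero => simp
  | succ m ih =>
    have ha := Finset.sum_range_succ' (fun r => a (r + 1)) m
    have hb := Finset.sum_range_succ (fun r => b (r + 1)) m
    rw [zero_add] at ha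
    rw [Finset.sum_range_succ (fun s => (∑ r ∈ Finset.range (s + 1), a (r + 1)) * b (s + 1)),
      Finset.sum_range_succ
        (fun s => (∑ r ∈ Finset.range (s + 1), a (r + 1 + 1)) * b (s + 1 + 1))]
    linear_combination ih + b (m + 1) * ha - a 1 * hb

/-- The alternating sum `α_j - α_{j+1} + α_{j+2} - ⋯` around a circle with an even number of
nodes. -/
def altα (j : ZMod (l + 1)) : RatField l :=
  ∑ r ∈ Finset.range (l / 2 + 1),
    (α (j + 2 * (r : ZMod (l + 1))) - α (j + 2 * (r : ZMod (l + 1)) + 1))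

/-- The polynomials `g_j` for which `(h_{j+1} - h_j) / k - g_j` does not depend on `j`. -/
def gHat (j : ZMod (l + 1)) : RatField l :=
  if Even l then ∑ r ∈ Finset.Icc 1 (l / 2), f (j + 2 * (r : ZMod (l + 1)))
  else (∑ s ∈ Finset.Icc 1 (l / 2), ∑ r ∈ Finset.Icc 1 s,
      f (j + 2 * (r : ZMod (l + 1))) * f (j + 2 * (s : ZMod (l + 1)) + 1)) + 1 / 4 * altα j

/-- The factor of `α_j` in the equation for `f_j'`: it is `1` for even `l` and
`f_{j+2} + f_{j+4} + ⋯` for odd `l`. -/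
def eHat (j : ZMod (l + 1)) : RatField l :=
  if Even l then 1 else ∑ r ∈ Finset.Icc 1 (l / 2), f (j + 2 * (r : ZMod (l + 1)))

/-- The constant `0` for even `l` and `1` for odd `l`. -/
def parity (l : ℕ) : RatField l := if Even l then 0 else 1

theorem gHat_of_even {n : ℕ} (h : l = 2 * n) (j : ZMod (l + 1)) :
    gHat j = ∑ r ∈ Finset.Icc 1 n, f (j + 2 * (r : ZMod (l + 1))) := by
  rw [gHat, if_pos (by rw [h]; simp), show l / 2 = n by omega]

theorem gHat_of_odd {n : ℕ} (h : l = 2 * n + 1) (j : ZMod (l + 1)) :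
    gHat j = (∑ s ∈ Finset.Icc 1 n, ∑ r ∈ Finset.Icc 1 s,
      f (j + 2 * (r : ZMod (l + 1))) * f (j + 2 * (s : ZMod (l + 1)) + 1)) + 1 / 4 * altα j := by
  rw [gHat, if_neg (by rw [h]; simp), show l / 2 = n by omega]

theorem eHat_of_even {n : ℕ} (h : l = 2 * n) (j : ZMod (l + 1)) : eHat j = 1 := by
  rw [eHat, if_pos (by rw [h]; simp)]

theorem eHat_of_odd {n : ℕ} (h : l = 2 * n + 1) (j : ZMod (l + 1)) :
    eHat j = ∑ r ∈ Finset.Icc 1 n, f (j + 2 * (r : ZMod (l + 1))) := by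
  rw [eHat, if_neg (by rw [h]; simp), show l / 2 = n by omega]

theorem parity_of_even {n : ℕ} (h : l = 2 * n) : parity l = 0 := by
  rw [parity, if_pos (by rw [h]; simp)]

theorem parity_of_odd {n : ℕ} (h : l = 2 * n + 1) : parity l = 1 := by
  rw [parity, if_neg (by rw [h]; simp)]

theorem altα_of_odd {n : ℕ} (h : l = 2 * n + 1) (j : ZMod (l + 1)) :
    altα j = ∑ r ∈ Finset.range (n + 1),
      (α (j + 2 * (r : ZMod (l + 1))) - α (j + 2 * (r : ZMod (l + 1)) + 1)) := by
  rw [altα, show l / 2 = n by omega]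

theorem two_mul_add_one_cast {n : ℕ} (h : l = 2 * n + 1) :
    2 * ((n : ZMod (l + 1)) + 1) = 0 := by
  have : ((2 * n + 1 + 1 : ℕ) : ZMod (l + 1)) = 0 := by rw [← h, ZMod.natCast_self]
  push_cast at this
  linear_combination this

theorem altα_sub_one {n : ℕ} (h : l = 2 * n + 1) (j : ZMod (l + 1)) :
    altα (j - 1) = -altα j := by
  rw [altα_of_odd h, altα_of_odd h, Finset.sum_sub_distrib, Finset.sum_sub_distrib, neg_sub]
  congr 1
  · rw [Finset.sum_range_succ', Finset.sum_range_succ]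
    congr 1
    · refine Finset.sum_congr rfl fun r _ => congrArg α ?_
      push_cast
      ring
    · refine congrArg α ?_
      push_cast
      linear_combination -two_mul_add_one_cast h
  · refine Finset.sum_congr rfl fun r _ => congrArg α ?_
    ring

theorem sum_zmod_eq_sum_range {M : Type*} [AddCommMonoid M] (u : ZMod (l + 1) → M)
    (j : ZMod (l + 1)) : ∑ i, u i = ∑ m ∈ Finset.range (l + 1), u (j + (m : ZMod (l + 1))) := by
  rw [← Equiv.sum_comp (Equiv.addLeft j) u]
  refine (Finset.sum_bij (fun (m : ℕ) _ => (m : ZMod (l + 1))) (fun _ _ => Finset.mem_univ _)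
    (fun a ha b hb e => natCast_inj_of_lt (Finset.mem_range.1 ha) (Finset.mem_range.1 hb) e)
    (fun i _ => ⟨i.val, Finset.mem_range.2 (ZMod.val_lt i), ZMod.natCast_zmod_val i⟩)
    fun _ _ => rfl).symm

theorem k_eq_of_odd {n : ℕ} (h : l = 2 * n + 1) (j : ZMod (l + 1)) :
    k l = ∑ r ∈ Finset.range (n + 1),
      (α (j + 2 * (r : ZMod (l + 1))) + α (j + 2 * (r : ZMod (l + 1)) + 1)) := by
  rw [k_eq_sum, sum_zmod_eq_sum_range α j,
    show Finset.range (l + 1) = Finset.range (2 * (n + 1)) by rw [h]; rfl,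
    sum_range_even_add_odd, Finset.sum_add_distrib]
  push_cast
  simp only [add_assoc]

theorem toField_sysEven (n : ℕ) (j : ZMod (l + 1)) : toField (sysEven l n j) =
    f j * ((∑ r ∈ Finset.Icc 1 n, f (j + 2 * (r : ZMod (l + 1)) - 1))
      - ∑ r ∈ Finset.Icc 1 n, f (j + 2 * (r : ZMod (l + 1)))) + α j := by
  simp only [sysEven, toField_add, toField_sub, toField_mul, toField_sum]
  rfl

theorem toField_sysOdd (n : ℕ) (j : ZMod (l + 1)) : toField (sysOdd l n j) =
    f j * ((∑ s ∈ Finset.Icc 1 n, ∑ r ∈ Finset.Icc 1 s,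
        f (j + 2 * (r : ZMod (l + 1)) - 1) * f (j + 2 * (s : ZMod (l + 1))))
      - ∑ s ∈ Finset.Icc 1 n, ∑ r ∈ Finset.Icc 1 s,
        f (j + 2 * (r : ZMod (l + 1))) * f (j + 2 * (s : ZMod (l + 1)) + 1))
    + (1 / 2 * k l - ∑ r ∈ Finset.Icc 1 n, α (j + 2 * (r : ZMod (l + 1)))) * f j
    + α j * ∑ r ∈ Finset.Icc 1 n, f (j + 2 * (r : ZMod (l + 1))) := by
  have h2 : toField (MvPolynomial.C (1 / 2 : ℂ) : Poly l) = 1 / 2 := by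
    have : (2 : Poly l) * MvPolynomial.C (1 / 2 : ℂ) = 1 := by
      rw [← map_ofNat MvPolynomial.C 2, ← map_mul]
      norm_num
    have h := congrArg toField this
    rw [toField_mul, show toField (2 : Poly l) = 2 from map_ofNat _ 2,
      show toField (1 : Poly l) = 1 from map_one _] at h
    linear_combination h / 2
  simp only [sysOdd, toField_add, toField_sub, toField_mul, toField_sum, h2]
  rfl

/-- The system reads `f_j' = f_j (g_{j-1} - g_j) + α_j (E_j + p f_j)` with `E_j = eHat j` and
`p = parity l`, for both parities of `l`. -/
theorem toField_F (j : ZMod (l + 1)) : toField (F j) =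
    f j * (gHat (j - 1) - gHat j) + α j * (eHat j + parity l * f j) := by
  rcases Nat.even_or_odd' l with ⟨n, h | h⟩
  · rw [F, if_pos (by rw [h]; simp), show l / 2 = n by omega, toField_sysEven, gHat_of_even h,
      gHat_of_even h, eHat_of_even h, parity_of_even h]
    simp only [sub_add_eq_add_sub]
    ring
  · have hA : ∑ r ∈ Finset.Icc 1 n, α (j + 2 * (r : ZMod (l + 1))) =
        ∑ r ∈ Finset.range (n + 1), α (j + 2 * (r : ZMod (l + 1))) - α j := by
      rw [sum_Icc_one fun r => α (j + 2 * (r : ZMod (l + 1))), Finset.sum_range_succ']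
      simp
    have hk := k_eq_of_odd h j
    have ha := altα_of_odd h j
    rw [Finset.sum_add_distrib] at hk
    rw [Finset.sum_sub_distrib] at ha
    have e₁ : ∀ r : ℕ, j - 1 + 2 * (r : ZMod (l + 1)) = j + 2 * (r : ZMod (l + 1)) - 1 :=
      fun r => by ring
    rw [F, if_neg (by rw [h]; simp), show l / 2 = n by omega, toField_sysOdd, gHat_of_odd h,
      gHat_of_odd h, eHat_of_odd h, parity_of_odd h, altα_sub_one h, hA, hk, ha]
    simp only [e₁, sub_add_cancel]
    ring

/-- A telescoping identity; the compatibility of the system with `s_j` at `f_{j+1}` and with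
`s_{j+1}` at `f_j` amounts to it. -/
theorem gHat_sub_gHat (j : ZMod (l + 1)) :
    gHat (j - 1) - gHat (j + 1) = f (j + 1) * eHat j - f j * eHat (j + 1) := by
  rcases Nat.even_or_odd' l with ⟨n, h | h⟩
  · have key : ∀ m : ℕ, ∑ r ∈ Finset.Icc 1 m, f (j - 1 + 2 * (r : ZMod (l + 1))) -
        ∑ r ∈ Finset.Icc 1 m, f (j + 1 + 2 * (r : ZMod (l + 1))) =
          f (j + 1) - f (j + 1 + 2 * (m : ZMod (l + 1))) := by
      intro m
      induction m with
      | zero => simp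
      | succ m ih =>
        rw [Finset.sum_Icc_succ_top (by omega), Finset.sum_Icc_succ_top (by omega),
          show j - 1 + 2 * ((m + 1 : ℕ) : ZMod (l + 1)) = j + 1 + 2 * (m : ZMod (l + 1)) by
            push_cast; ring]
        linear_combination ih
    have hn : (2 * n + 1 : ZMod (l + 1)) = 0 := by
      have : ((2 * n + 1 : ℕ) : ZMod (l + 1)) = 0 := by rw [← h, ZMod.natCast_self]
      exact_mod_cast this
    rw [gHat_of_even h, gHat_of_even h, eHat_of_even h, eHat_of_even h, key,
      show j + 1 + 2 * (n : ZMod (l + 1)) = j by linear_combination hn]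
    ring
  · have key := sum_triangle_sub (fun r => f (j - 1 + 2 * (r : ZMod (l + 1))))
      (fun r => f (j + 2 * (r : ZMod (l + 1)))) n
    have e₁ : ∀ r : ℕ, j - 1 + 2 * ((r + 1 : ℕ) : ZMod (l + 1)) = j + 1 + 2 * (r : ZMod (l + 1)) :=
      fun r => by push_cast; ring
    have e₂ : ∀ r : ℕ, j + 2 * ((r + 1 : ℕ) : ZMod (l + 1)) =
        j + 1 + 2 * (r : ZMod (l + 1)) + 1 := fun r => by push_cast; ring
    have e₃ : ∀ r : ℕ, j + 2 * (r : ZMod (l + 1)) = j - 1 + 2 * (r : ZMod (l + 1)) + 1 :=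
      fun r => by ring
    have e₅ : j + 2 * ((n + 1 : ℕ) : ZMod (l + 1)) = j := by
      push_cast
      linear_combination two_mul_add_one_cast h
    simp only [e₁, e₅] at key
    simp only [e₂, Nat.cast_zero, mul_zero, add_zero] at key
    rw [gHat_of_odd h, gHat_of_odd h, eHat_of_odd h, eHat_of_odd h]
    have ha : altα (j + 1) = -altα j := by
      have := altα_sub_one h (j + 1)
      rw [add_sub_cancel_right] at this
      rw [this, neg_neg]
    rw [altα_sub_one h, ha]
    simp only [← e₃]
    linear_combination key

end Differences

/-! ### The Hamiltonians as coefficients of the cyclic continuant -/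

section Hamiltonians

variable {l : ℕ}

/-- The cyclic continuant of the `f_j` and the edge weights. -/
def circ (l : ℕ) : Polynomial (RatField l) := cycTrace f edge

/-- The cyclic continuant has its coefficients in the polynomial ring. -/
theorem circ_eq_map : circ l = ((chain (fun m => pf (m : ZMod (l + 1)))
    (fun m => (ϖ (m : ZMod (l + 1)) : Poly l) - ϖ ((m + 1 : ℕ) : ZMod (l + 1)))
      (l + 1)).trace).map (algebraMap (Poly l) (RatField l)) := by
  rw [map_trace_chain, circ, cycTrace]
  simp only [Nat.cast_add_one]
  rfl

theorem toField_h₀_of_even {n : ℕ} (h : l = 2 * n) (hn : 1 ≤ n) :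
    toField (h₀ l) = (circ l).coeff 3 := by
  obtain ⟨t, rfl⟩ := Nat.exists_eq_add_of_le' hn
  have e : l + 1 = 2 * t + 3 := by omega
  have hN : (ϖ ((2 * t + 3 : ℕ) : ZMod (l + 1)) : Poly l) = 0 := by
    rw [← e, ZMod.natCast_self, ϖ_zero]
  have key := coeff_three_trace (n := t) (fun m => pf (m : ZMod (l + 1)))
    (fun m => (ϖ (m : ZMod (l + 1)) : Poly l)) (by rw [Nat.cast_zero, ϖ_zero]) hN
  rw [circ_eq_map, Polynomial.coeff_map, h₀, if_pos (by rw [h]; simp),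
    sum_S_fProd (by omega) (by grind), sum_S_χCompl (by omega) (by grind)]
  rw [← e] at key
  rw [key]
  rfl

/-- The square in the Hamiltonian accounts for the sum of the squares of the edge weights. -/
theorem toField_h₀_of_odd {n : ℕ} (h : l = 2 * n + 1) :
    2 * toField (h₀ l) = 2 * (circ l).coeff 4 + ∑ j : ZMod (l + 1), edge j ^ 2 := by
  have e : l + 1 = 2 * n + 2 := by omega
  have hN : (ϖ ((2 * n + 2 : ℕ) : ZMod (l + 1)) : Poly l) = 0 := by
    rw [← e, ZMod.natCast_self, ϖ_zero]
  have key := coeff_four_trace (n := n) (fun m => pf (m : ZMod (l + 1)))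
    (fun m => (ϖ (m : ZMod (l + 1)) : Poly l)) (by rw [Nat.cast_zero, ϖ_zero]) hN
  rw [← e] at key
  have hsq : ∀ m : ℕ, altWeightSum (fun m => (pf (m : ZMod (l + 1)) : Poly l))
      (fun m => (ϖ (m : ZMod (l + 1)) : Poly l)) 0 0 (m + 1) =
        -∑ i ∈ Finset.Icc 1 m, (-1) ^ (i - 1) * ϖ (i : ZMod (l + 1)) := by
    intro m
    induction m with
    | zero => simp [altWeightSum_zero_succ, altWeightSum_at_zero, ϖ_zero]
    | succ m ih =>
      rw [altWeightSum_zero_succ, ih, Finset.sum_Icc_succ_top (by omega), Nat.add_sub_cancel]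
      ring
  rw [hsq] at key
  have key' := congrArg (algebraMap (Poly l) (RatField l)) key
  rw [map_add, map_mul, map_mul, ← Polynomial.coeff_map, ← circ_eq_map, map_ofNat, map_sum] at key'
  rw [sum_zmod_eq_sum_range (fun j => edge j ^ 2) 0, h₀, if_neg (by rw [h]; simp),
    sum_S_fProd (by omega) (by grind), sum_S_χCompl (by omega) (by grind)]
  rw [neg_sq] at key'
  refine key'.symm.trans (congrArg₂ _ rfl (Finset.sum_congr rfl fun j _ => ?_))
  rw [map_pow, zero_add, edge, Nat.cast_add_one]
  rfl

/-- The element that appears in `h_{j+1} - h_j = k (g_j - casimir)`. It is a constant multiple of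
the lowest coefficient of the cyclic continuant which involves the `f_j`, and it is invariant
under the group. -/
def casimir (l : ℕ) : RatField l :=
  ((l / 2 : ℕ) : RatField l) / ((l + 1 : ℕ) : RatField l) *
    if Even l then (circ l).coeff 1 else (circ l).coeff 2

/-- For `i ≠ 0`, the action of `s_i` on the `f_j` and the edge weights is the reflection symmetry of
the continuant with `x = α_i / f_i`. At `i = 0` the difference of the edge weights is
`α_0 - k` and the symmetry breaks. -/
theorem IsRefl.map_circ (hl : 2 ≤ l) {i : ZMod (l + 1)} (hi : i ≠ 0)
    {φ : RatField l ≃ₐ[ℂ] RatField l} (h : IsRefl i φ) :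
    (circ l).map (φ : RatField l →+* RatField l) = circ l := by
  rw [circ, map_cycTrace]
  have hc := edge_sub_edge hi
  have hs := sub_one_ne hl i
  refine cycTrace_reflect hl (i := i) (x := α i / f i) ?_ ?_ ?_ ?_ ?_ ?_ ?_
  · rw [hc, div_mul_cancel₀ _ (f_ne_zero i)]
  · refine (h.map_f _).trans ?_
    rw [orient_sub_one hl]
    push_cast
    ring
  · refine (h.map_f _).trans ?_
    rw [orient_add_one]
    push_cast
    ring
  · intro j h₀ h₁
    refine (h.map_f _).trans ?_
    rw [orient_eq_zero h₁ h₀]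
    push_cast
    ring
  · refine (h.map_edge hl _).trans ?_
    rw [if_pos rfl, if_neg hs]
    push_cast
    linear_combination -hc
  · refine (h.map_edge hl _).trans ?_
    rw [if_pos rfl, if_neg hs.symm]
    push_cast
    linear_combination hc
  · intro j h₀ h₁
    refine (h.map_edge hl _).trans ?_
    rw [if_neg h₀, if_neg h₁]
    push_cast
    ring

theorem IsRefl.map_sum_edge_sq (hl : 2 ≤ l) {i : ZMod (l + 1)} (hi : i ≠ 0)
    {φ : RatField l ≃ₐ[ℂ] RatField l} (h : IsRefl i φ) :
    φ (∑ j : ZMod (l + 1), edge j ^ 2) = ∑ j : ZMod (l + 1), edge j ^ 2 := by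
  rw [map_sum, ← Equiv.sum_comp (Equiv.swap (i - 1) i) fun j => edge j ^ 2]
  have hc := edge_sub_edge hi
  have hs := sub_one_ne hl i
  refine Finset.sum_congr rfl fun j _ => ?_
  rw [map_pow, h.map_edge hl]
  congr 1
  by_cases h₀ : j = i - 1
  · subst h₀
    rw [if_pos rfl, if_neg hs, Equiv.swap_apply_left]
    push_cast
    linear_combination -hc
  by_cases h₁ : j = i
  · subst h₁
    rw [if_pos rfl, if_neg h₀, Equiv.swap_apply_right]
    push_cast
    linear_combination hc
  · rw [if_neg h₀, if_neg h₁, Equiv.swap_apply_of_ne_of_ne h₀ h₁]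
    push_cast
    ring

theorem IsRefl.map_coeff_circ (hl : 2 ≤ l) {i : ZMod (l + 1)} (hi : i ≠ 0)
    {φ : RatField l ≃ₐ[ℂ] RatField l} (h : IsRefl i φ) (d : ℕ) :
    φ ((circ l).coeff d) = (circ l).coeff d := by
  conv_rhs => rw [← h.map_circ hl hi, Polynomial.coeff_map]
  rfl

theorem IsRefl.map_h₀ (hl : 2 ≤ l) {i : ZMod (l + 1)} (hi : i ≠ 0)
    {φ : RatField l ≃ₐ[ℂ] RatField l} (h : IsRefl i φ) :
    φ (toField (h₀ l)) = toField (h₀ l) := by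
  rcases Nat.even_or_odd' l with ⟨n, hn | hn⟩
  · rw [toField_h₀_of_even hn (by omega), h.map_coeff_circ hl hi]
  · refine mul_left_cancel₀ (two_ne_zero (α := RatField l)) ?_
    have e := congrArg φ (toField_h₀_of_odd hn)
    rw [map_add, map_mul, map_mul, map_ofNat, h.map_coeff_circ hl hi, h.map_sum_edge_sq hl hi] at e
    rw [e, toField_h₀_of_odd hn]

theorem IsRefl.map_casimir_of_ne_zero (hl : 2 ≤ l) {i : ZMod (l + 1)} (hi : i ≠ 0)
    {φ : RatField l ≃ₐ[ℂ] RatField l} (h : IsRefl i φ) : φ (casimir l) = casimir l := by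
  rw [casimir, map_mul, map_div₀, map_natCast, map_natCast, apply_ite φ, h.map_coeff_circ hl hi,
    h.map_coeff_circ hl hi]

theorem IsRot.map_circ {φ : RatField l ≃ₐ[ℂ] RatField l} (h : IsRot φ) :
    (circ l).map (φ : RatField l →+* RatField l) = (chain (fun m => f ((m : ZMod (l + 1)) + 1))
      (fun m => (edge ((m : ZMod (l + 1)) + 1) +
        if (m : ZMod (l + 1)) = (l : ZMod (l + 1)) then k l else 0) +
          -k l / ((l + 1 : ℕ) : RatField l)) (l + 1)).trace := by
  rw [circ, map_cycTrace, cycTrace]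
  refine congrArg Matrix.trace (chain_congr (fun m _ => ?_) fun m _ => ?_)
  · exact h.map_f _
  · exact h.map_edge _

/-- The continuant of the nodes `2, …, l`: up to the factor `X ^ 2`, the coefficient of the weight
of the edge from `0` to `1` in the cyclic continuant. -/
def openChain (l : ℕ) : Polynomial (RatField l) :=
  chain (fun m => f ((m : ZMod (l + 1)) + 1)) (fun m => edge ((m : ZMod (l + 1)) + 1)) l 1 0

theorem trace_chain_update : (chain (fun m => f ((m : ZMod (l + 1)) + 1))
      (fun m => edge ((m : ZMod (l + 1)) + 1) +
        if (m : ZMod (l + 1)) = (l : ZMod (l + 1)) then k l else 0) (l + 1)).trace =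
    circ l + Polynomial.X ^ 2 * Polynomial.C (k l) * openChain l := by
  have e := cycTrace_update (fun j : ZMod (l + 1) => f (j + 1)) (fun j => edge (j + 1)) (k l)
  rw [cycTrace_shift f edge 1] at e
  exact e

theorem IsRot.map_coeff_of_even {n : ℕ} (hn : l = 2 * n) (h1 : 1 ≤ n)
    {φ : RatField l ≃ₐ[ℂ] RatField l} (h : IsRot φ) :
    φ ((circ l).coeff 1) = (circ l).coeff 1 ∧
    φ ((circ l).coeff 3) = (circ l).coeff 3 + k l * gHat 0 -
      k l * ((n : RatField l) / ((l + 1 : ℕ) : RatField l) * (circ l).coeff 1) := by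
  obtain ⟨t, rfl⟩ := Nat.exists_eq_add_of_le' h1
  have e : l + 1 = 2 * t + 3 := by omega
  have key := coeff_trace_add_of_odd t (fun m => f ((m : ZMod (l + 1)) + 1))
    (fun m => edge ((m : ZMod (l + 1)) + 1) +
        if (m : ZMod (l + 1)) = (l : ZMod (l + 1)) then k l else 0)
          (-k l / ((l + 1 : ℕ) : RatField l))
  have q := (isContinuant_one (fun m => f ((m : ZMod (l + 1)) + 1))
    (fun m => edge ((m : ZMod (l + 1)) + 1))).coeff_one t
  simp only [← show l = 1 + 2 * t + 1 by omega] at q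
  have hq : (openChain l).coeff 1 = gHat 0 := by
    rw [openChain, q, gHat_of_even hn, sum_Icc_one fun r => f (0 + 2 * (r : ZMod (l + 1)))]
    refine Finset.sum_congr rfl fun r _ => congrArg f ?_
    push_cast
    ring
  simp only [← e] at key
  rw [← h.map_circ, trace_chain_update] at key
  simp only [Polynomial.coeff_map, mul_assoc, Polynomial.coeff_add, Polynomial.coeff_X_pow_mul',
    Polynomial.coeff_C_mul] at key
  norm_num at key
  rw [hq] at key
  refine ⟨key.1, key.2.trans ?_⟩
  push_cast
  ring

/-- The sum of the weights of every other edge, from the differences and the sum of all. -/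
theorem sum_edge_even {n : ℕ} (hn : l = 2 * n + 1) :
    ∑ r ∈ Finset.range (n + 1), edge (2 * (r : ZMod (l + 1))) + 1 / 4 * k l = 1 / 4 * altα 0 := by
  have hs := sum_edge (l := l)
  have hr : Finset.range (l + 1) = Finset.range (2 * (n + 1)) := by rw [hn]; rfl
  rw [sum_zmod_eq_sum_range edge 0, hr, sum_range_even_add_odd] at hs
  have hd : ∑ r ∈ Finset.range (n + 1), edge (2 * (r : ZMod (l + 1))) -
      ∑ r ∈ Finset.range (n + 1), edge (2 * (r : ZMod (l + 1)) + 1) =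
        ∑ r ∈ Finset.range (n + 1), α (2 * (r : ZMod (l + 1))) - k l := by
    have h₁ : ∑ r ∈ Finset.range n, edge (2 * ((r + 1 : ℕ) : ZMod (l + 1))) -
        ∑ r ∈ Finset.range n, edge (2 * (r : ZMod (l + 1)) + 1) =
          ∑ r ∈ Finset.range n, α (2 * ((r + 1 : ℕ) : ZMod (l + 1))) := by
      rw [← Finset.sum_sub_distrib]
      refine Finset.sum_congr rfl fun r hr => ?_
      have hr' := Finset.mem_range.1 hr
      have hne : 2 * ((r + 1 : ℕ) : ZMod (l + 1)) ≠ 0 := by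
        have := natCast_ne_zero (l := l) (m := 2 * (r + 1)) (by omega) (by omega)
        push_cast at this ⊢
        exact this
      rw [← edge_sub_edge hne]
      congr 2
      push_cast
      ring
    have h₂ := edge_zero_sub (l := l)
    rw [Finset.sum_range_succ' _ n, Finset.sum_range_succ _ n, Finset.sum_range_succ' _ n,
      show 2 * (n : ZMod (l + 1)) + 1 = -1 by linear_combination two_mul_add_one_cast hn]
    rw [Nat.cast_zero, mul_zero]
    linear_combination h₁ + h₂
  have hk := k_eq_of_odd hn 0
  rw [altα_of_odd hn, Finset.sum_sub_distrib]
  rw [Finset.sum_add_distrib] at hk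
  push_cast at hs
  simp only [zero_add] at hs hk ⊢
  linear_combination 1 / 2 * hs + 1 / 2 * hd - 1 / 4 * hk

theorem IsRot.map_coeff_of_odd {n : ℕ} (hn : l = 2 * n + 1)
    {φ : RatField l ≃ₐ[ℂ] RatField l} (h : IsRot φ) :
    φ ((circ l).coeff 2) = (circ l).coeff 2 ∧
    φ (2 * (circ l).coeff 4 + ∑ j : ZMod (l + 1), edge j ^ 2) =
      2 * (circ l).coeff 4 + ∑ j : ZMod (l + 1), edge j ^ 2 + 2 * (k l * gHat 0 -
        k l * ((n : RatField l) / ((l + 1 : ℕ) : RatField l) * (circ l).coeff 2)) := by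
  have e : l + 1 = 2 * n + 2 := by omega
  have hN : ((l + 1 : ℕ) : RatField l) = 2 * (n + 1) := by
    rw [e]
    push_cast
    ring
  have hN0 : (n + 1 : RatField l) ≠ 0 := Nat.cast_add_one_ne_zero n
  have key := coeff_trace_add_of_even n (fun m => f ((m : ZMod (l + 1)) + 1))
    (fun m => edge ((m : ZMod (l + 1)) + 1) +
        if (m : ZMod (l + 1)) = (l : ZMod (l + 1)) then k l else 0)
          (-k l / ((l + 1 : ℕ) : RatField l))
  have hC := isContinuant_one (fun m => f ((m : ZMod (l + 1)) + 1))
    (fun m => edge ((m : ZMod (l + 1)) + 1))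
  have q := hC.coeff_two n
  have q₀ := hC.coeff_zero n
  simp only [← show l = 1 + 2 * n by omega] at q q₀
  have hq₀ : (openChain l).coeff 0 = 1 := q₀
  have hq : (openChain l).coeff 2 + edge 0 + 1 / 4 * k l = gHat 0 := by
    rw [openChain, q, gHat_of_odd hn, ← sum_edge_even hn, Finset.sum_range_succ' _ n,
      sum_Icc_one fun s => ∑ r ∈ Finset.Icc 1 s,
        f (0 + 2 * (r : ZMod (l + 1))) * f (0 + 2 * (s : ZMod (l + 1)) + 1)]
    simp only [sum_Icc_one]
    have e₁ : ∀ r : ℕ, ((1 + 2 * r : ℕ) : ZMod (l + 1)) + 1 = 2 * ((r + 1 : ℕ) : ZMod (l + 1)) :=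
      fun r => by push_cast; ring
    have e₂ : ∀ r : ℕ, ((1 + 2 * r + 1 : ℕ) : ZMod (l + 1)) + 1 =
        2 * ((r + 1 : ℕ) : ZMod (l + 1)) + 1 := fun r => by push_cast; ring
    simp only [e₁, e₂, zero_add, Nat.cast_zero, mul_zero]
    ring
  simp only [← e] at key
  rw [← h.map_circ, trace_chain_update] at key
  simp only [Polynomial.coeff_map, mul_assoc, Polynomial.coeff_add, Polynomial.coeff_X_pow_mul',
    Polynomial.coeff_C_mul] at key
  norm_num at key
  -- The defect `k` sits at the edge `0`; the constant shift only sees the sum of all weights.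
  have hsq : φ (∑ j : ZMod (l + 1), edge j ^ 2) = ∑ j : ZMod (l + 1), edge j ^ 2 +
      2 * k l * edge 0 + k l ^ 2 + 2 * (-k l / ((l + 1 : ℕ) : RatField l)) * k l +
        ((l + 1 : ℕ) : RatField l) * (-k l / ((l + 1 : ℕ) : RatField l)) ^ 2 := by
    have e0 : (l : ZMod (l + 1)) + 1 = 0 := by rw [natCast_self_eq_neg_one, neg_add_cancel]
    have s₁ : ∀ j : ZMod (l + 1), φ (edge j ^ 2) = edge (j + 1) ^ 2 +
        (if j = (l : ZMod (l + 1)) then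
          2 * k l * edge 0 + k l ^ 2 + 2 * (-k l / ((l + 1 : ℕ) : RatField l)) * k l else 0) +
        2 * (-k l / ((l + 1 : ℕ) : RatField l)) * edge (j + 1) +
          (-k l / ((l + 1 : ℕ) : RatField l)) ^ 2 := by
      intro j
      rw [map_pow, h.map_edge]
      by_cases hj : j = (l : ZMod (l + 1))
      · subst hj
        rw [if_pos rfl, if_pos rfl, e0]
        ring
      · rw [if_neg hj, if_neg hj]
        ring
    rw [map_sum, Finset.sum_congr rfl fun j _ => s₁ j, Finset.sum_add_distrib,
      Finset.sum_add_distrib, Finset.sum_add_distrib, sum_comp_add_one fun j => edge j ^ 2,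
      ← Finset.mul_sum, sum_comp_add_one, sum_edge, Finset.sum_const, Finset.card_univ, ZMod.card,
      nsmul_eq_mul]
    simp
    ring
  have hN' : (l : RatField l) + 1 = 2 * (n + 1) := by exact_mod_cast hN
  rw [hq₀, hN'] at key
  rw [hN] at hsq ⊢
  constructor
  · rw [key.1]
    field_simp
    ring
  · rw [map_add, map_mul, map_ofNat, key.2, hsq, ← hq]
    field_simp
    ring

/-- The rotated Hamiltonian `π(h_0)` is `h_1`, so this is the difference of the first two
Hamiltonians. -/
theorem IsRot.map_h₀ (hl : 2 ≤ l) {φ : RatField l ≃ₐ[ℂ] RatField l} (h : IsRot φ) :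
    φ (toField (h₀ l)) = toField (h₀ l) + k l * (gHat 0 - casimir l) := by
  rcases Nat.even_or_odd' l with ⟨n, hn | hn⟩
  · rw [casimir, if_pos (by rw [hn]; simp), show l / 2 = n by omega,
      toField_h₀_of_even hn (by omega), (h.map_coeff_of_even hn (by omega)).2]
    ring
  · refine mul_left_cancel₀ (two_ne_zero (α := RatField l)) ?_
    have e := congrArg φ (toField_h₀_of_odd hn)
    rw [map_mul, map_ofNat, (h.map_coeff_of_odd hn).2, ← toField_h₀_of_odd hn] at e
    rw [e, casimir, if_neg (by rw [hn]; simp), show l / 2 = n by omega]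
    ring

theorem IsRot.map_casimir (hl : 2 ≤ l) {φ : RatField l ≃ₐ[ℂ] RatField l} (h : IsRot φ) :
    φ (casimir l) = casimir l := by
  rw [casimir, map_mul, map_div₀, map_natCast, map_natCast]
  rcases Nat.even_or_odd' l with ⟨n, hn | hn⟩
  · rw [if_pos (by rw [hn]; simp), (h.map_coeff_of_even hn (by omega)).1]
  · rw [if_neg (by rw [hn]; simp), (h.map_coeff_of_odd hn).1]

end Hamiltonians

/-! ### Invariance of the Hamiltonians -/

section DifferencesInvariant

variable {l : ℕ}

theorem IsRot.iterate_toField {φ : RatField l ≃ₐ[ℂ] RatField l} (h : IsRot φ) (m : ℕ) (p : Poly l) :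
    φ^[m] (toField p) = toField ((fun p => MvPolynomial.rename Var.rotate p)^[m] p) := by
  induction m generalizing p with
  | zero => rfl
  | succ m ih =>
    rw [Function.iterate_succ_apply, Function.iterate_succ_apply, ← ih]
    congr 1
    have e : ((φ : RatField l →ₐ[ℂ] RatField l).comp (Algebra.algHom ℂ (Poly l) (RatField l))) =
        (Algebra.algHom ℂ (Poly l) (RatField l)).comp (MvPolynomial.rename Var.rotate) := by
      refine MvPolynomial.algHom_ext fun v => ?_
      rw [AlgHom.comp_apply, AlgHom.comp_apply, MvPolynomial.rename_X]
      rcases v with j | j | j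
      exacts [h.map_alpha j, h.map_f j, h.map_tau j]
    exact congrArg (fun g => g p) e

theorem IsRot.map_h {φ : RatField l ≃ₐ[ℂ] RatField l} (hφ : IsRot φ) (j : ZMod (l + 1)) :
    φ (toField (h j)) = toField (h (j + 1)) := by
  rw [h, h, ← hφ.iterate_toField, ← hφ.iterate_toField, ← Function.iterate_succ_apply' φ]
  rcases (Nat.lt_succ_iff.1 (ZMod.val_lt j)).lt_or_eq with hj | hj
  · have e : (j + 1).val = j.val + 1 := by
      conv_lhs => rw [← ZMod.natCast_zmod_val j, ← Nat.cast_add_one]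
      exact ZMod.val_cast_of_lt (by omega)
    rw [e]
  · have e : j + 1 = 0 := by
      rw [← ZMod.natCast_zmod_val j, hj, natCast_self_eq_neg_one, neg_add_cancel]
    have hp := (show IsRot (φ : RatField l →ₐ[ℂ] RatField l) from
      ⟨hφ.map_alpha, hφ.map_f, hφ.map_tau⟩).pow_eq_one
    have := congrArg (fun g => g (toField (h₀ l))) hp
    rw [hj, e, ZMod.val_zero]
    simp only [AlgHom.coe_pow, AlgHom.one_apply] at this
    exact this

theorem IsRot.map_gHat {φ : RatField l ≃ₐ[ℂ] RatField l} (hφ : IsRot φ) (j : ZMod (l + 1)) :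
    φ (gHat j) = gHat (j + 1) := by
  rw [gHat, gHat, apply_ite φ]
  simp only [altα, map_add, map_mul, map_sum, map_sub, map_div₀, map_one, map_ofNat, hφ.map_f,
    hφ.map_alpha, add_right_comm]

theorem toField_h_add_one (hl : 2 ≤ l) (j : ZMod (l + 1)) :
    toField (h (j + 1)) = toField (h j) + k l * (gHat j - casimir l) := by
  obtain ⟨φ, hφ⟩ := exists_isRot (l := l)
  obtain ⟨n, rfl⟩ : ∃ n : ℕ, (n : ZMod (l + 1)) = j := ⟨j.val, ZMod.natCast_zmod_val j⟩
  induction n with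
  | zero =>
    rw [← hφ.map_h, Nat.cast_zero, h, ZMod.val_zero]
    exact hφ.map_h₀ hl
  | succ n ih =>
    have := congrArg φ ih
    rwa [map_add, map_mul, map_sub, hφ.map_h, hφ.map_h, hφ.map_k, hφ.map_gHat,
      hφ.map_casimir hl, ← Nat.cast_add_one] at this

/-- By rotation, `s_i(h_j) = h_j` for `i ≠ j` follows from the case `j = 0`. -/
theorem IsRefl.map_h (hl : 2 ≤ l) {i j : ZMod (l + 1)} (hij : i ≠ j)
    {φ : RatField l ≃ₐ[ℂ] RatField l} (hφ : IsRefl i φ) : φ (toField (h j)) = toField (h j) := by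
  obtain ⟨ρ, hρ⟩ := exists_isRot (l := l)
  obtain ⟨n, rfl⟩ : ∃ n : ℕ, (n : ZMod (l + 1)) = j := ⟨j.val, ZMod.natCast_zmod_val j⟩
  induction n generalizing i φ with
  | zero =>
    rw [Nat.cast_zero] at hij ⊢
    rw [h, ZMod.val_zero]
    exact hφ.map_h₀ hl hij
  | succ n ih =>
    obtain ⟨ψ, hψ⟩ := exists_isRefl hl (i - 1)
    have e := hψ.rot (by rwa [sub_add_cancel]) hρ
    have h₁ := ih hψ fun e => hij (by rw [Nat.cast_add_one, ← e, sub_add_cancel])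
    have h₂ := congrArg (fun g => g (toField (h (n : ZMod (l + 1))))) e
    simp only [AlgEquiv.mul_apply, h₁, hρ.map_h] at h₂
    rw [Nat.cast_add_one]
    exact h₂.symm

theorem IsRefl.map_casimir (hl : 2 ≤ l) {i : ZMod (l + 1)} {φ : RatField l ≃ₐ[ℂ] RatField l}
    (hφ : IsRefl i φ) : φ (casimir l) = casimir l := by
  by_cases hi : i = 0
  · obtain ⟨ρ, hρ⟩ := exists_isRot (l := l)
    obtain ⟨ψ, hψ⟩ := exists_isRefl hl (i - 1)
    have e := hψ.rot (by rwa [sub_add_cancel]) hρ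
    have h₂ := congrArg (fun g => g (casimir l)) e
    have hne : i - 1 ≠ 0 := by
      have := sub_one_ne hl i
      rwa [hi] at this ⊢
    simp only [AlgEquiv.mul_apply, hψ.map_casimir_of_ne_zero hl hne, hρ.map_casimir hl] at h₂
    exact h₂.symm
  · exact hφ.map_casimir_of_ne_zero hl hi

/-- Here `s_i` fixes both `h_j` and `h_{j+1}`, hence their difference. -/
theorem IsRefl.map_gHat_of_ne (hl : 2 ≤ l) {i j : ZMod (l + 1)} (h₀ : i ≠ j) (h₁ : i ≠ j + 1)
    {φ : RatField l ≃ₐ[ℂ] RatField l} (hφ : IsRefl i φ) : φ (gHat j) = gHat j := by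
  have e := congrArg φ (toField_h_add_one hl j)
  rw [map_add, map_mul, map_sub, hφ.map_h hl h₀, hφ.map_h hl h₁, hφ.map_k hl,
    hφ.map_casimir hl, toField_h_add_one hl] at e
  refine mul_left_cancel₀ (k_ne_zero (l := l)) ?_
  linear_combination -e

/-- The sum is, up to constants, the difference of `h_{i-1}` and `h_{i+1}`, which are fixed. -/
theorem IsRefl.map_gHat_add_gHat (hl : 2 ≤ l) {i : ZMod (l + 1)}
    {φ : RatField l ≃ₐ[ℂ] RatField l} (hφ : IsRefl i φ) :
    φ (gHat (i - 1)) + φ (gHat i) = gHat (i - 1) + gHat i := by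
  have d₁ := toField_h_add_one hl (i - 1)
  have d₂ := toField_h_add_one hl i
  rw [sub_add_cancel] at d₁
  have e₁ := congrArg φ d₁
  have e₂ := congrArg φ d₂
  rw [map_add, map_mul, map_sub, hφ.map_k hl, hφ.map_casimir hl] at e₁ e₂
  rw [hφ.map_h hl (sub_one_ne hl i).symm] at e₁
  rw [hφ.map_h hl (add_one_ne hl i).symm] at e₂
  refine mul_left_cancel₀ (k_ne_zero (l := l)) ?_
  linear_combination d₁ + d₂ - e₁ - e₂

/-- Of the two changed elements `f_{i±1}` only `f_{i-1} = f_{i+l}` occurs in `g_i`, with the last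
index. -/
theorem IsRefl.map_gHat_self (hl : 2 ≤ l) {i : ZMod (l + 1)}
    {φ : RatField l ≃ₐ[ℂ] RatField l} (hφ : IsRefl i φ) :
    φ (gHat i) = gHat i - α i * (eHat i / f i + parity l) := by
  rcases Nat.even_or_odd' l with ⟨n, hn | hn⟩
  · have ho : ∀ r ∈ Finset.Icc 1 n, φ (f (i + 2 * (r : ZMod (l + 1)))) =
        f (i + 2 * (r : ZMod (l + 1))) - if r = n then α i / f i else 0 := by
      intro r hr
      have hr' := Finset.mem_Icc.1 hr
      have e := orient_add_natCast hl i (m := 2 * r) (by omega)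
      rw [if_neg (by omega), Nat.cast_mul, Nat.cast_ofNat] at e
      rw [hφ.map_f, e]
      by_cases hrn : r = n
      · rw [if_pos (by omega), if_pos hrn]
        push_cast
        ring
      · rw [if_neg (by omega), if_neg hrn]
        push_cast
        ring
    rw [gHat_of_even hn, eHat_of_even hn, parity_of_even hn, map_sum, Finset.sum_congr rfl ho,
      Finset.sum_sub_distrib, Finset.sum_ite_eq', if_pos (by simp; omega)]
    ring
  · have h₁ : ∀ r, 1 ≤ r → r ≤ n → φ (f (i + 2 * (r : ZMod (l + 1)))) =
        f (i + 2 * (r : ZMod (l + 1))) := by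
      intro r hr hr'
      have e := orient_add_natCast hl i (m := 2 * r) (by omega)
      rw [if_neg (by omega), if_neg (by omega), Nat.cast_mul, Nat.cast_ofNat] at e
      rw [hφ.map_f, e]
      simp
    have h₂ : ∀ s, 1 ≤ s → s ≤ n → φ (f (i + 2 * (s : ZMod (l + 1)) + 1)) =
        f (i + 2 * (s : ZMod (l + 1)) + 1) - if s = n then α i / f i else 0 := by
      intro s hs hs'
      have e := orient_add_natCast hl i (m := 2 * s + 1) (by omega)
      rw [if_neg (by omega), Nat.cast_add_one, Nat.cast_mul, Nat.cast_ofNat, ← add_assoc] at e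
      rw [hφ.map_f, e]
      by_cases hsn : s = n
      · rw [if_pos (by omega), if_pos hsn]
        push_cast
        ring
      · rw [if_neg (by omega), if_neg hsn]
        push_cast
        ring
    have hq : φ (∑ s ∈ Finset.Icc 1 n, ∑ r ∈ Finset.Icc 1 s,
        f (i + 2 * (r : ZMod (l + 1))) * f (i + 2 * (s : ZMod (l + 1)) + 1)) =
        (∑ s ∈ Finset.Icc 1 n, ∑ r ∈ Finset.Icc 1 s,
          f (i + 2 * (r : ZMod (l + 1))) * f (i + 2 * (s : ZMod (l + 1)) + 1)) -
          eHat i * (α i / f i) := by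
      have : ∀ s ∈ Finset.Icc 1 n, φ (∑ r ∈ Finset.Icc 1 s,
          f (i + 2 * (r : ZMod (l + 1))) * f (i + 2 * (s : ZMod (l + 1)) + 1)) =
          (∑ r ∈ Finset.Icc 1 s,
            f (i + 2 * (r : ZMod (l + 1))) * f (i + 2 * (s : ZMod (l + 1)) + 1)) -
            if s = n then eHat i * (α i / f i) else 0 := by
        intro s hs
        have hs' := Finset.mem_Icc.1 hs
        rw [map_sum, Finset.sum_congr rfl fun r hr => by
          have hr' := Finset.mem_Icc.1 hr
          rw [map_mul, h₁ r hr'.1 (by omega), h₂ s hs'.1 hs'.2, mul_sub],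
          Finset.sum_sub_distrib, ← Finset.sum_mul, ← Finset.sum_mul, eHat_of_odd hn]
        by_cases hsn : s = n
        · rw [if_pos hsn, if_pos hsn, hsn]
        · rw [if_neg hsn, if_neg hsn, mul_zero]
      rw [map_sum, Finset.sum_congr rfl this, Finset.sum_sub_distrib, Finset.sum_ite_eq',
        if_pos (by simp; omega)]
    have c₁ : ∑ r ∈ Finset.range (n + 1), (cartan i (i + 2 * (r : ZMod (l + 1))) : RatField l) =
        2 := by
      rw [Finset.sum_eq_single_of_mem 0 (by simp)]
      · simp
      · intro r hr hr0
        have hr' := Finset.mem_range.1 hr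
        have e := cartan_add_natCast hl i (m := 2 * r) (by omega)
        rw [if_neg (by omega), if_neg (by omega), Nat.cast_mul, Nat.cast_ofNat] at e
        rw [e, Int.cast_zero]
    have c₂ : ∑ r ∈ Finset.range (n + 1),
        (cartan i (i + 2 * (r : ZMod (l + 1)) + 1) : RatField l) = -2 := by
      have : ∀ r ∈ Finset.range (n + 1), (cartan i (i + 2 * (r : ZMod (l + 1)) + 1) : RatField l) =
          (if r = 0 then -1 else 0) + if r = n then -1 else 0 := by
        intro r hr
        have hr' := Finset.mem_range.1 hr
        have e := cartan_add_natCast hl i (m := 2 * r + 1) (by omega)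
        rw [if_neg (by omega), Nat.cast_add_one, Nat.cast_mul, Nat.cast_ofNat, ← add_assoc] at e
        rw [e]
        by_cases r0 : r = 0
        · rw [if_pos (by omega), if_pos r0, if_neg (by omega)]
          simp
        by_cases hrn : r = n
        · rw [if_pos (by omega), if_neg r0, if_pos hrn]
          simp
        · rw [if_neg (by omega), if_neg r0, if_neg hrn]
          simp
      rw [Finset.sum_congr rfl this, Finset.sum_add_distrib, Finset.sum_ite_eq',
        Finset.sum_ite_eq', if_pos (by simp), if_pos (by simp)]
      norm_num
    have ha : φ (altα i) = altα i - 4 * α i := by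
      rw [altα_of_odd hn, map_sum, Finset.sum_congr rfl fun r _ => by
        rw [map_sub, hφ.map_alpha, hφ.map_alpha], Finset.sum_sub_distrib, Finset.sum_sub_distrib,
        Finset.sum_sub_distrib, Finset.sum_sub_distrib, ← Finset.sum_mul, ← Finset.sum_mul, c₁, c₂]
      ring
    rw [gHat_of_odd hn, parity_of_odd hn, map_add, hq, map_mul, ha, map_div₀, map_one, map_ofNat]
    ring

theorem IsRefl.map_eHat_self (hl : 2 ≤ l) {i : ZMod (l + 1)}
    {φ : RatField l ≃ₐ[ℂ] RatField l} (hφ : IsRefl i φ) : φ (eHat i) = eHat i := by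
  rcases Nat.even_or_odd' l with ⟨n, hn | hn⟩
  · rw [eHat_of_even hn, map_one]
  · rw [eHat_of_odd hn, map_sum]
    refine Finset.sum_congr rfl fun r hr => ?_
    have hr' := Finset.mem_Icc.1 hr
    have e := orient_add_natCast hl i (m := 2 * r) (by omega)
    rw [if_neg (by omega), if_neg (by omega), Nat.cast_mul, Nat.cast_ofNat] at e
    rw [hφ.map_f, e]
    simp

theorem IsRefl.map_eHat_add_one (hl : 2 ≤ l) {i : ZMod (l + 1)}
    {φ : RatField l ≃ₐ[ℂ] RatField l} (hφ : IsRefl i φ) :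
    φ (eHat (i + 1)) = eHat (i + 1) - parity l * (α i / f i) := by
  rcases Nat.even_or_odd' l with ⟨n, hn | hn⟩
  · rw [eHat_of_even hn, parity_of_even hn, map_one]
    ring
  · have : ∀ r ∈ Finset.Icc 1 n, φ (f (i + 1 + 2 * (r : ZMod (l + 1)))) =
        f (i + 1 + 2 * (r : ZMod (l + 1))) - if r = n then α i / f i else 0 := by
      intro r hr
      have hr' := Finset.mem_Icc.1 hr
      have e := orient_add_natCast hl i (m := 2 * r + 1) (by omega)
      rw [if_neg (by omega), Nat.cast_add_one, Nat.cast_mul, Nat.cast_ofNat,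
        add_comm (2 * (r : ZMod (l + 1))) 1, ← add_assoc] at e
      rw [hφ.map_f, e]
      by_cases hrn : r = n
      · rw [if_pos (by omega), if_pos hrn]
        push_cast
        ring
      · rw [if_neg (by omega), if_neg hrn]
        push_cast
        ring
    rw [eHat_of_odd hn, parity_of_odd hn, map_sum, Finset.sum_congr rfl this,
      Finset.sum_sub_distrib, Finset.sum_ite_eq', if_pos (by simp; omega), one_mul]

theorem IsRefl.map_eHat_sub_one (hl : 2 ≤ l) {i : ZMod (l + 1)}
    {φ : RatField l ≃ₐ[ℂ] RatField l} (hφ : IsRefl i φ) :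
    φ (eHat (i - 1)) = eHat (i - 1) + parity l * (α i / f i) := by
  rcases Nat.even_or_odd' l with ⟨n, hn | hn⟩
  · rw [eHat_of_even hn, parity_of_even hn, map_one]
    ring
  · have : ∀ r ∈ Finset.Icc 1 n, φ (f (i - 1 + 2 * (r : ZMod (l + 1)))) =
        f (i - 1 + 2 * (r : ZMod (l + 1))) + if r = 1 then α i / f i else 0 := by
      intro r hr
      have hr' := Finset.mem_Icc.1 hr
      have e := orient_add_natCast hl i (m := 2 * r - 1) (by omega)
      rw [if_neg (c := 2 * r - 1 = l) (by omega), Nat.cast_sub (by omega), Nat.cast_mul,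
        Nat.cast_ofNat, Nat.cast_one, ← add_sub_assoc, ← sub_add_eq_add_sub] at e
      rw [hφ.map_f, e]
      by_cases hrn : r = 1
      · rw [if_pos (by omega), if_pos hrn]
        push_cast
        ring
      · rw [if_neg (by omega), if_neg hrn]
        push_cast
        ring
    rw [eHat_of_odd hn, parity_of_odd hn, map_sum, Finset.sum_congr rfl this,
      Finset.sum_add_distrib, Finset.sum_ite_eq', if_pos (by simp; omega), one_mul]

theorem α_ne_zero (j : ZMod (l + 1)) : (α j : RatField l) ≠ 0 := fun h =>
  MvPolynomial.X_ne_zero (R := ℂ) (Var.alpha j) (toField_injective (h.trans (map_zero _).symm))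

theorem IsRefl.map_alpha_of_ne {i j : ZMod (l + 1)} (h₀ : j ≠ i) (h₁ : j ≠ i + 1)
    (h₂ : j ≠ i - 1) {φ : RatField l ≃ₐ[ℂ] RatField l} (hφ : IsRefl i φ) : φ (α j) = α j := by
  rw [hφ.map_alpha, cartan_eq_zero h₀ h₁ h₂]
  simp

theorem IsRefl.map_f_of_ne {i j : ZMod (l + 1)} (h₁ : j ≠ i + 1)
    (h₂ : j ≠ i - 1) {φ : RatField l ≃ₐ[ℂ] RatField l} (hφ : IsRefl i φ) : φ (f j) = f j := by
  rw [hφ.map_f, orient_eq_zero h₁ h₂]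
  simp

theorem map_parity (φ : RatField l ≃ₐ[ℂ] RatField l) : φ (parity l) = parity l := by
  rw [parity, apply_ite φ, map_zero, map_one]

/-- As `s_i` and `s_j` commute, `s_i` fixes `g_j - s_j(g_j)`, of which `eHat j` is the essential
part. -/
theorem IsRefl.map_eHat_of_ne (hl : 2 ≤ l) {i j : ZMod (l + 1)} (h₀ : j ≠ i) (h₁ : j ≠ i + 1)
    (h₂ : j ≠ i - 1) {φ : RatField l ≃ₐ[ℂ] RatField l} (hφ : IsRefl i φ) :
    φ (eHat j) = eHat j := by
  obtain ⟨ψ, hψ⟩ := exists_isRefl hl j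
  have hg : φ (gHat j) = gHat j := hφ.map_gHat_of_ne hl h₀.symm fun e => h₂ (by rw [e]; ring)
  have e := congrArg (fun g => g (gHat j)) (hφ.comm hψ h₀ h₁ h₂)
  simp only [AlgEquiv.mul_apply, hg, hψ.map_gHat_self hl, map_sub, map_mul, map_add, map_div₀,
    hφ.map_alpha_of_ne h₀ h₁ h₂, hφ.map_f_of_ne h₁ h₂, map_parity] at e
  have h : φ (eHat j) / f j = eHat j / f j := by
    refine mul_left_cancel₀ (α_ne_zero j) ?_
    linear_combination -e
  exact (div_left_inj' (f_ne_zero j)).1 h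

end DifferencesInvariant

/-! ### Commutation with the derivation -/

section Commutation

variable {l : ℕ}

/-- Since `(α_i / f_i)' = -α_i F_i / f_i²`, this says that `s_i(F_j)` is the derivative of
`s_i(f_j)`. -/
theorem IsRefl.map_F (hl : 2 ≤ l) {i : ZMod (l + 1)} {φ : RatField l ≃ₐ[ℂ] RatField l}
    (hφ : IsRefl i φ) (j : ZMod (l + 1)) : φ (toField (F j)) =
      toField (F j) - orient i j * (α i / f i ^ 2) * toField (F i) := by
  have hf := f_ne_zero i
  have hg := hφ.map_gHat_self hl
  have hg' : φ (gHat (i - 1)) = gHat (i - 1) + α i * (eHat i / f i + parity l) := by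
    linear_combination hφ.map_gHat_add_gHat hl - hg
  rw [toField_F, map_add, map_mul, map_mul, map_add, map_mul, map_sub, map_parity, toField_F,
    hφ.map_f, hφ.map_alpha]
  by_cases h₀ : j = i
  · subst h₀
    rw [orient_self hl, cartan_self, hg, hg', hφ.map_eHat_self hl]
    push_cast
    field_simp
    ring
  by_cases h₁ : j = i + 1
  · subst h₁
    have key := gHat_sub_gHat i
    rw [add_sub_cancel_right, hg, hφ.map_gHat_of_ne hl (add_one_ne hl i).symm (fun e => by
      have := natCast_ne_zero (l := l) (m := 2) two_pos (by omega)
      push_cast at this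
      exact this (by linear_combination -e)), hφ.map_eHat_add_one hl, orient_add_one,
      cartan_add_one hl]
    push_cast
    field_simp
    linear_combination α i * f i * key
  by_cases h₂ : j = i - 1
  · subst h₂
    have key := gHat_sub_gHat (i - 1)
    rw [sub_add_cancel] at key
    rw [hg', hφ.map_gHat_of_ne hl (fun e => by
      have := natCast_ne_zero (l := l) (m := 2) two_pos (by omega)
      push_cast at this
      exact this (by linear_combination e)) (by rw [sub_add_cancel]; exact (sub_one_ne hl i).symm),
      hφ.map_eHat_sub_one hl, orient_sub_one hl, cartan_sub_one hl]
    push_cast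
    field_simp
    linear_combination -α i * f i * key
  · rw [hφ.map_gHat_of_ne (j := j) hl (Ne.symm h₀) (fun e => h₂ (by rw [e]; ring)),
      hφ.map_gHat_of_ne (j := j - 1) hl (fun e => h₁ (by rw [e]; ring))
        (by rw [sub_add_cancel]; exact Ne.symm h₀), hφ.map_eHat_of_ne hl h₀ h₁ h₂,
      orient_eq_zero h₁ h₂, cartan_eq_zero h₀ h₁ h₂]
    push_cast
    ring

/-- Since `s_i(τ_i) = f_i τ_{i-1} τ_{i+1} / τ_i`, this says that `s_i(h_i)` is `k` times the
logarithmic derivative of `s_i(τ_i)`. -/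
theorem IsRefl.map_h_self (hl : 2 ≤ l) {i : ZMod (l + 1)} {φ : RatField l ≃ₐ[ℂ] RatField l}
    (hφ : IsRefl i φ) : φ (toField (h i)) =
      toField (h (i - 1)) + toField (h (i + 1)) - toField (h i) + k l * toField (F i) / f i := by
  have hf := f_ne_zero i
  have d₁ := toField_h_add_one hl (i - 1)
  have d₂ := toField_h_add_one hl i
  rw [sub_add_cancel] at d₁
  have e := congrArg φ d₂
  rw [map_add, map_mul, map_sub, hφ.map_k hl, hφ.map_casimir hl,
    hφ.map_h hl (add_one_ne hl i).symm, hφ.map_gHat_self hl] at e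
  have hF : toField (F i) / f i =
      gHat (i - 1) - gHat i + α i * (eHat i / f i + parity l) := by
    rw [toField_F]
    field_simp
  rw [mul_div_assoc, hF]
  linear_combination d₁ - e

theorem IsRefl.comm_derivation (hl : 2 ≤ l) {i : ZMod (l + 1)}
    {φ : RatField l ≃ₐ[ℂ] RatField l} (hφ : IsRefl i φ)
    {D : Derivation ℂ (RatField l) (RatField l)} (hD : IsSystemDerivation D) (x : RatField l) :
    φ (D x) = D (φ x) := by
  have hf := f_ne_zero i
  have hz : ∀ n : ℤ, D (n : RatField l) = 0 := fun n => D.map_intCast n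
  refine comm_of_vars hD (hφ.map_k hl) (fun j => ?_) (fun j => ?_) (fun j => ?_) x
  · rw [hφ.map_alpha, map_sub, Derivation.leibniz, hD.alpha, hD.alpha, hz]
    simp
  · rw [hφ.map_f, hφ.map_F hl, map_add, Derivation.leibniz, Derivation.leibniz_div, hD.alpha,
      hD.f, hD.f, hz]
    simp only [smul_eq_mul]
    field_simp
    ring
  · by_cases hj : j = i
    · subst hj
      have h₀ := τ_ne_zero j
      have h₁ := hD.tau (j - 1)
      have h₂ := hD.tau (j + 1)
      have h₃ := hD.tau j
      rw [hφ.map_tau_self, hφ.map_h_self hl, Derivation.leibniz, Derivation.leibniz_div,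
        Derivation.leibniz, hD.f]
      simp only [smul_eq_mul]
      field_simp
      linear_combination f j * τ j * τ (j - 1) * h₂ + f j * τ j * τ (j + 1) * h₁ -
        f j * τ (j - 1) * τ (j + 1) * h₃
    · rw [hφ.map_tau j hj, hD.tau, hφ.map_h hl (Ne.symm hj)]

theorem IsRot.map_F {φ : RatField l ≃ₐ[ℂ] RatField l} (hφ : IsRot φ) (j : ZMod (l + 1)) :
    φ (toField (F j)) = toField (F (j + 1)) := by
  have he : φ (eHat j) = eHat (j + 1) := by
    rw [eHat, eHat, apply_ite φ]
    simp only [map_one, map_sum, hφ.map_f, add_right_comm]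
  rw [toField_F, toField_F, map_add, map_mul, map_mul, map_add, map_mul, map_sub, hφ.map_gHat,
    hφ.map_gHat, hφ.map_f, hφ.map_alpha, he, map_parity, add_sub_cancel_right, sub_add_cancel]

theorem IsRot.comm_derivation {φ : RatField l ≃ₐ[ℂ] RatField l} (hφ : IsRot φ)
    {D : Derivation ℂ (RatField l) (RatField l)} (hD : IsSystemDerivation D) (x : RatField l) :
    φ (D x) = D (φ x) := by
  refine comm_of_vars hD hφ.map_k (fun j => ?_) (fun j => ?_) (fun j => ?_) x
  · rw [hφ.map_alpha, hD.alpha]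
  · rw [hφ.map_f, hD.f, hφ.map_F]
  · rw [hφ.map_tau, hD.tau, hφ.map_h]

end Commutation

end NoumiYamada

end

theorem mainTheorem3 (l : ℕ) (hl : 2 ≤ l) :
    (∃! D : Derivation ℂ (NoumiYamada.RatField l) (NoumiYamada.RatField l),
      NoumiYamada.IsSystemDerivation D) ∧
    (∃! ρ : NoumiYamada.ExtAffineWeyl l →*
        (NoumiYamada.RatField l ≃ₐ[ℂ] NoumiYamada.RatField l),
      NoumiYamada.IsWeylAction ρ) ∧
    ∀ (D : Derivation ℂ (NoumiYamada.RatField l) (NoumiYamada.RatField l))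
      (ρ : NoumiYamada.ExtAffineWeyl l →*
        (NoumiYamada.RatField l ≃ₐ[ℂ] NoumiYamada.RatField l)),
      NoumiYamada.IsSystemDerivation D → NoumiYamada.IsWeylAction ρ →
        (∀ (w : NoumiYamada.ExtAffineWeyl l) (x : NoumiYamada.RatField l),
          ρ w (D x) = D (ρ w x)) ∧
        ∀ j : ZMod (l + 1),
          (NoumiYamada.f j : NoumiYamada.RatField l) =
            NoumiYamada.τ j * ρ (NoumiYamada.s j) (NoumiYamada.τ j) /
              (NoumiYamada.τ (j - 1) * NoumiYamada.τ (j + 1)) := by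
  refine ⟨NoumiYamada.existsUnique_isSystemDerivation,
    NoumiYamada.existsUnique_isWeylAction hl, fun D ρ hD hρ => ⟨?_, fun j => ?_⟩⟩
  · obtain ⟨hs, hr⟩ := (NoumiYamada.isWeylAction_iff hl).1 hρ
    exact NoumiYamada.comm_of_generators (fun i => (hs i).comm_derivation hl hD)
      (hr.comm_derivation hD)
  · have h₀ := NoumiYamada.τ_ne_zero j
    have h₁ := NoumiYamada.τ_ne_zero (j - 1)
    have h₂ := NoumiYamada.τ_ne_zero (j + 1)
    rw [hρ.s_tau_self]
    field_simp
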